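/- **Setting.** Let $G=SO(n+1,n)$, acting on $\mathbb R^{n+1,n}=\{(v,\tau,X)\}=(\mathbb R^n)^*\oplus\mathbb R\oplus\mathbb R^n$ with the metric $h\big((v,\tau,X),(w,\nu,Y)\big)=\tfrac12\,(w(X)+v(Y)+\tau\nu)$. Let $P\cong GL(n)\ltimes\exp\big((\mathbb R^n)^*\oplus\wedge^2(\mathbb R^n)^*\big)$ be the stabiliser of the isotropic plane $\{(v,0,0)\}$, and let $\mathfrak g,\mathfrak p,\mathfrak p^\perp$ be the Lie algebras of $G$, $P$ and the nilradical of $\mathfrak p$, with grading element $\epsilon_0=\mathrm{diag}(1,0,-1)$. Let $M$ be a smooth manifold (Hausdorff, second countable) with a Cartan geometry $(\mathcal P\to M,\omega)$ of type $(G,P)$; for example, but not only, the regular normal Cartan geometry of a free $n$-distribution $H$ on $M$. Let $\mathcal A=\mathcal P\times_P\mathfrak g$ with bracket $\{\,,\}$, $T=TM=\mathcal P\times_P\mathfrak g/\mathfrak p$ and $T^*=\mathcal P\times_P\mathfrak p^\perp\subset\mathcal A$. Let $\mathcal T=\mathcal P\times_P\mathbb R^{n+1,n}$ be the tractor bundle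 with its tractor connection $\overrightarrow\nabla$, and $\pi^2:\mathcal T\to H$, $(v,\tau,X)\mapsto X$, the natural projection, where $H\subset T$ has rank $n$. A Weyl structure is a section $\eta$ of $\mathcal P\times_P\mathfrak p$ that lifts the grading element of $\mathfrak p/\mathfrak p^\perp$. Weyl structures correspond bijectively to preferred connections $\nabla$, and they form an affine space modelled on the sections of $T^*$ through differences $\eta'-\eta$; affine structures below are meant in this sense. A Weyl structure splits $T=H\oplus T_{-2}$, $T^*=H^*\oplus T_2^*$ and $\mathcal T=H^*\oplus\mathbb R\oplus H$. On the reduction of $\mathcal P$ to $G_0=GL(n)$ that it defines, $\omega=\omega_-+\omega_0+\omega_+$, where $\omega_-$ is the soldering form, $\omega_0$ defines $\nabla$, and $\omega_+$ defines the rho-tensor $\mathsf P\in T^*\otimes T^*$, with components $\mathsf P_{ij}\in T_i^*\otimes T_j^*$ (the first index is that of the direction). Identify $T_{-2}\cong\wedge^2H$ with the skew maps $H^*\to H$, $v\mapsto\{Z_{-2},v\}$, and $T_2^*\cong\wedge^2H^*$ with skew maps $H\to H^*$, $X\mapsto\{\Upsilon_2,X\}$, with the signs for which $$\overrightarrow\nabla_Z(v,\tau,X)=\big(\nabla_Zv+\tau\mathsf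 P(Z)_1-\{\mathsf P(Z)_2,X\},\ \nabla_Z\tau-v(Z_{-1})-\mathsf P(Z)_1(X),\ \nabla_ZX+\tau Z_{-1}+\{Z_{-2},v\}\big).$$ Let $V\subset\mathcal T$ be a smooth subbundle of rank $r\le n$ that is generic: $\pi^2$ is injective on $V$ over some open dense subset of $M$. Let $U\subset M$ be any open set over which $\pi^2|_V$ is injective. Everything below is over $U$. Put $A=\pi^2(V)\subset H$. Let $g$ be the form on $A$ that corresponds to $h|_V$, let $\mathrm{iso}(A)=\{X\in A: g(X,A)=0\}$, and let $S^\perp$ denote annihilators in $H^*$ (of $S\subset H$) or in $H$ (of $S\subset H^*$). A preferred connection $\nabla$ splits $\mathcal T$, so that $V\cong A$ gives a map $\mu=\mu^\nabla:A\to H^*$. Call $\nabla$ *$V$-preferred* if $\mu(X)(Y)=g(X,Y)$ for all $X,Y\in A$, and *strongly $V$-preferred* if moreover $\mu(A)\cap A^\perp=0$. **Theorem.** $V$-preferred and strongly $V$-preferred connections exist over $U$. If $\nabla$ is $V$-preferred, the $V$-preferred connections are exactly those that differ from it by a section of $A^\perp\oplus\{H^*,A^\perp\}\subset T^*$; if $\nabla$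 is strongly $V$-preferred, the strongly $V$-preferred connections are exactly those that differ from it by a section of $A^\perp\oplus\{\mathrm{iso}(A)^\perp,A^\perp\}$. The subspace $B=\{A,A\}\subset T$ is the same for all $V$-preferred connections. For a $V$-preferred $\nabla$, $\mu$ extends at each point to a symmetric map $H\to H^*$; write $\mu$ for any such extension, and extend it to $T_{-2}$ by $\mu(Y_1\wedge Y_2)=\mu(Y_1)\wedge\mu(Y_2)$, that is, $\mu(Z)=\mu\circ Z\circ\mu$ on skew maps. If $\overrightarrow\nabla$ preserves $V$ over $U$, every $V$-preferred $\nabla$ has the following properties (for every choice of the extension of $\mu$). 1. $\nabla_Z$ maps sections of $A$ to $A$ for all $Z\in C=H\oplus\big(B+\{\mu(A)^\perp,\mu(A)^\perp\}\big)\subset T$. 2. $\nabla\mu$ is zero on $A\otimes A$: for all $Z\in T$ and sections $X,Y$ of $A$, $Z\cdot\mu(X,Y)=\mu(\nabla_ZX,Y)+\mu(X,\nabla_ZY)$. 3. $\mathsf P_{11}=-\mu+\eta_1$ with $\eta_1\in H^*\otimes A^\perp$. 4. $\mathsf P_{22}=-\mu+\eta_2$ with $\eta_2\in T_2^*\otimes\{A^\perp,H^*\}$.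 5. $\mathsf P_{21}\in T_2^*\otimes A^\perp$ and $\mathsf P_{12}\in T_1^*\otimes\{A^\perp,H^*\}$. If $\nabla$ is strongly $V$-preferred, then moreover $\eta_2\in T_2^*\otimes\{A^\perp,\mathrm{iso}(A)^\perp\}$ and $\mathsf P_{12}\in T_1^*\otimes\{A^\perp,\mathrm{iso}(A)^\perp\}$. -/

import Mathlib

open scoped Manifold ContDiff Matrix Topology

noncomputable section

namespace FreeDist

/-! ### The algebra: `ℝ^{n+1,n}`, `SO(n+1,n)` and the parabolic subgroup -/

/-- Coordinates of the standard representation, in the order `H* ⊕ ℝ ⊕ H`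
(`n`, `1` and `n` coordinates). -/
abbrev Idx (n : ℕ) : Type := Fin n ⊕ (Unit ⊕ Fin n)

/-- The standard representation space `ℝ^{n+1,n}`; its elements are triples `(v, τ, X)`. -/
abbrev Std (n : ℕ) : Type := Idx n → ℝ

abbrev Mat (n : ℕ) : Type := Matrix (Idx n) (Idx n) ℝ

/-- The index of the `i`-th coordinate of the `H*` block. -/
abbrev iV {n : ℕ} (i : Fin n) : Idx n := Sum.inl i

/-- The index of the central coordinate. -/
abbrev iR {n : ℕ} : Idx n := Sum.inr (Sum.inl ())

/-- The index of the `i`-th coordinate of the `H` block. -/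
abbrev iH {n : ℕ} (i : Fin n) : Idx n := Sum.inr (Sum.inr i)

/-- The Gram matrix with block rows `(0, 0, 1)`, `(0, 1, 0)`, `(1, 0, 0)`. -/
def gramJ (n : ℕ) : Mat n :=
  Matrix.of fun a b => match a, b with
    | Sum.inl i, Sum.inr (Sum.inr j) => if i = j then 1 else 0
    | Sum.inr (Sum.inl _), Sum.inr (Sum.inl _) => 1
    | Sum.inr (Sum.inr i), Sum.inl j => if i = j then 1 else 0
    | _, _ => 0

/-- The metric `h((v, τ, X), (w, ν, Y)) = (w(X) + v(Y) + τ ν) / 2`, written with the Gram matrix. -/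
def metricH {n : ℕ} (s t : Std n) : ℝ := (1 / 2) * (s ⬝ᵥ (gramJ n *ᵥ t))

/-- The Lie algebra `𝔤 = 𝔰𝔬(n+1,n)`, matrices `X` with `Xᵀ J + J X = 0`. -/
abbrev gAlg (n : ℕ) : Submodule ℝ (Mat n) := skewAdjointMatricesSubmodule (gramJ n)

/-- The Lie bracket of `𝔤`. -/
def lieBr {n : ℕ} (a b : Mat n) : Mat n := a * b - b * a

/-- The subgroup `P ⊂ SO(n+1,n)` that preserves the isotropic plane `{(v, 0, 0)}`. -/
def parabolicP (n : ℕ) : Subgroup (Matrix.SpecialLinearGroup (Idx n) ℝ) where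
  carrier := {p | (p : Mat n)ᵀ * gramJ n * (p : Mat n) = gramJ n ∧
    (∀ a j, (p : Mat n) (Sum.inr a) (iV j) = 0) ∧
    (∀ a j, ((p⁻¹ : Matrix.SpecialLinearGroup (Idx n) ℝ) : Mat n) (Sum.inr a) (iV j) = 0)}
  one_mem' := by
    refine ⟨by simp, fun a j => ?_, fun a j => ?_⟩ <;> simp
  mul_mem' := by
    have key : ∀ p q : Mat n, (∀ a j, p (Sum.inr a) (iV j) = 0) →
        (∀ a j, q (Sum.inr a) (iV j) = 0) → ∀ a j, (p * q) (Sum.inr a) (iV j) = 0 := by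
      intro p q hp hq a j
      rw [Matrix.mul_apply, Fintype.sum_sum_type]
      simp [hp, hq]
    rintro p q ⟨hp, hp1, hp2⟩ ⟨hq, hq1, hq2⟩
    refine ⟨?_, ?_, ?_⟩
    · rw [Matrix.SpecialLinearGroup.coe_mul, Matrix.transpose_mul]
      calc (q : Mat n)ᵀ * (p : Mat n)ᵀ * gramJ n * ((p : Mat n) * (q : Mat n))
          = (q : Mat n)ᵀ * ((p : Mat n)ᵀ * gramJ n * (p : Mat n)) * (q : Mat n) := by
            simp only [Matrix.mul_assoc]
        _ = gramJ n := by rw [hp, hq]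
    · rw [Matrix.SpecialLinearGroup.coe_mul]
      exact key _ _ hp1 hq1
    · rw [mul_inv_rev, Matrix.SpecialLinearGroup.coe_mul]
      exact key _ _ hq2 hp2
  inv_mem' := by
    rintro p ⟨hp, hp1, hp2⟩
    refine ⟨?_, hp2, by simpa using hp1⟩
    have h1 : (p : Mat n) * ((p⁻¹ : Matrix.SpecialLinearGroup (Idx n) ℝ) : Mat n) = 1 := by
      rw [← Matrix.SpecialLinearGroup.coe_mul, mul_inv_cancel, Matrix.SpecialLinearGroup.coe_one]
    set q : Mat n := ((p⁻¹ : Matrix.SpecialLinearGroup (Idx n) ℝ) : Mat n) with hq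
    calc qᵀ * gramJ n * q = qᵀ * ((p : Mat n)ᵀ * gramJ n * (p : Mat n)) * q := by rw [hp]
      _ = ((p : Mat n) * q)ᵀ * gramJ n * ((p : Mat n) * q) := by
          simp only [Matrix.transpose_mul, Matrix.mul_assoc]
      _ = gramJ n := by rw [h1]; simp

/-- The matrix of an element of `P`. -/
def pMat {n : ℕ} (p : parabolicP n) : Mat n := ((p : Matrix.SpecialLinearGroup (Idx n) ℝ) : Mat n)

/-- The Lie algebra `𝔭 ⊂ 𝔤` of `P`: the elements that preserve the plane `{(v, 0, 0)}`. -/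
def pAlg (n : ℕ) : Submodule ℝ (Mat n) where
  carrier := {X | X ∈ gAlg n ∧ ∀ a j, X (Sum.inr a) (iV j) = 0}
  zero_mem' := ⟨(gAlg n).zero_mem, by simp⟩
  add_mem' := fun ha hb => ⟨(gAlg n).add_mem ha.1 hb.1, fun a j => by simp [ha.2 a j, hb.2 a j]⟩
  smul_mem' := fun c x hx => ⟨(gAlg n).smul_mem c hx.1, fun a j => by simp [hx.2 a j]⟩

/-- The nilradical `𝔭^⊥` of `𝔭`. An element of `𝔤` that annihilates the plane `{(v, 0, 0)}` is
strictly block upper triangular. -/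
def nilAlg (n : ℕ) : Submodule ℝ (Mat n) where
  carrier := {X | X ∈ gAlg n ∧ ∀ a j, X a (iV j) = 0}
  zero_mem' := ⟨(gAlg n).zero_mem, by simp⟩
  add_mem' := fun ha hb => ⟨(gAlg n).add_mem ha.1 hb.1, fun a j => by simp [ha.2 a j, hb.2 a j]⟩
  smul_mem' := fun c x hx => ⟨(gAlg n).smul_mem c hx.1, fun a j => by simp [hx.2 a j]⟩

/-- The standard grading element `diag(1, 0, -1)`: `lieBr ε X = j X` on `𝔤_j`. -/
def gradEl (n : ℕ) : Mat n :=
  Matrix.diagonal (Sum.elim (fun _ => 1) (Sum.elim (fun _ => 0) (fun _ => -1)))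

/-! Blocks of a matrix in `𝔤`, with respect to the standard grading. -/

/-- The `𝔤_{-1} ≅ H` component `Z_{-1}`; it sends `(0, τ, 0)` to `(0, 0, τ Z_{-1})`. -/
def blkM1 {n : ℕ} (X : Mat n) : Fin n → ℝ := fun i => X (iH i) iR

/-- The `𝔤_{-2} ≅ Λ² H` component `Z_{-2}`, as the skew map `H* → H`, `v ↦ {Z_{-2}, v}`. -/
def blkM2 {n : ℕ} (X : Mat n) : Matrix (Fin n) (Fin n) ℝ := Matrix.of fun i j => X (iH i) (iV j)

/-- The action of the `𝔤_0 = 𝔤𝔩(n)` component on `H`. -/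
def blk0 {n : ℕ} (X : Mat n) : Matrix (Fin n) (Fin n) ℝ := Matrix.of fun i j => X (iH i) (iH j)

/-- The `𝔤_1 ≅ H*` component `Υ_1`; it sends `(0, τ, 0)` to `(τ Υ_1, 0, 0)`. -/
def blk1 {n : ℕ} (X : Mat n) : Fin n → ℝ := fun i => X (iV i) iR

/-- The `𝔤_2 ≅ Λ² H*` component `Υ_2`, as the skew map `H → H*`, `X ↦ {Υ_2, X}`, with the sign for
which `Υ_2` sends the tractor `(0, 0, X)` to `(-{Υ_2, X}, 0, 0)`. -/
def blk2 {n : ℕ} (X : Mat n) : Matrix (Fin n) (Fin n) ℝ :=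
  Matrix.of fun i j => -X (iV i) (iH j)

/-- The element of `𝔤_2` whose component is the given skew map `H → H*`; a right inverse of
`blk2`. -/
def ofBlk2 {n : ℕ} (S : Matrix (Fin n) (Fin n) ℝ) : Mat n :=
  Matrix.of fun a b => match a, b with
    | Sum.inl i, Sum.inr (Sum.inr j) => -S i j
    | _, _ => 0

/-- The projection `π² : ℝ^{n+1,n} → H`. -/
def piH (n : ℕ) : Std n →ₗ[ℝ] (Fin n → ℝ) := LinearMap.funLeft ℝ ℝ (fun i => (iH i : Idx n))

/-- The annihilator, for the pairing of `H = ℝⁿ` with `H* = (ℝⁿ)*`. -/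
def perp {n : ℕ} (S : Set (Fin n → ℝ)) : Submodule ℝ (Fin n → ℝ) where
  carrier := {α | ∀ X ∈ S, α ⬝ᵥ X = 0}
  zero_mem' := by intro X _; simp
  add_mem' := by intro a b ha hb X hX; simp [add_dotProduct, ha X hX, hb X hX]
  smul_mem' := by intro c a ha X hX; simp [smul_dotProduct, ha X hX]

/-! Subspaces of `𝔤`, graded by a lift `E ∈ 𝔭` of the grading element. -/

/-- `S ⊂ H`, embedded in the `-1` eigenspace of `E` (which is identified with `H`). -/
def inM1 {n : ℕ} (E : Mat n) (S : Submodule ℝ (Fin n → ℝ)) : Submodule ℝ (Mat n) where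
  carrier := {a | a ∈ gAlg n ∧ lieBr E a = -a ∧ blkM1 a ∈ S}
  zero_mem' := ⟨(gAlg n).zero_mem, by simp [lieBr], S.zero_mem⟩
  add_mem' := fun {a b} ha hb => ⟨(gAlg n).add_mem ha.1 hb.1,
    by
      have h1 := ha.2.1
      have h2 := hb.2.1
      simp only [lieBr] at h1 h2 ⊢
      rw [mul_add, add_mul, neg_add, ← h1, ← h2]
      abel, S.add_mem ha.2.2 hb.2.2⟩
  smul_mem' := fun c a ha => ⟨(gAlg n).smul_mem c ha.1,
    by
      have h1 := ha.2.1
      simp only [lieBr] at h1 ⊢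
      rw [mul_smul_comm, smul_mul_assoc, ← smul_sub, h1, smul_neg], S.smul_mem c ha.2.2⟩

/-- `S ⊂ H*`, embedded in the `+1` eigenspace of `E` (which is identified with `H*`). -/
def inP1 {n : ℕ} (E : Mat n) (S : Submodule ℝ (Fin n → ℝ)) : Submodule ℝ (Mat n) where
  carrier := {a | a ∈ gAlg n ∧ lieBr E a = a ∧ blk1 a ∈ S}
  zero_mem' := ⟨(gAlg n).zero_mem, by simp [lieBr], S.zero_mem⟩
  add_mem' := fun {a b} ha hb => ⟨(gAlg n).add_mem ha.1 hb.1,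
    by
      have h1 := ha.2.1
      have h2 := hb.2.1
      simp only [lieBr] at h1 h2 ⊢
      rw [mul_add, add_mul, add_sub_add_comm, h1, h2], S.add_mem ha.2.2 hb.2.2⟩
  smul_mem' := fun c a ha => ⟨(gAlg n).smul_mem c ha.1,
    by
      have h1 := ha.2.1
      simp only [lieBr] at h1 ⊢
      rw [mul_smul_comm, smul_mul_assoc, ← smul_sub, h1], S.smul_mem c ha.2.2⟩

/-- `{S, S'}`: the span of the brackets. -/
def brk {n : ℕ} (S S' : Submodule ℝ (Mat n)) : Submodule ℝ (Mat n) :=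
  Submodule.span ℝ {c | ∃ a ∈ S, ∃ b ∈ S', c = lieBr a b}

/-- The `H*` component of `t = (v, τ, X)` in the splitting of `ℝ^{n+1,n}` given by `E`: the
projection to the eigenspace of `E` for `1` (the eigenvalues are `1`, `0`, `-1`). -/
def compV {n : ℕ} (E : Mat n) (t : Std n) : Fin n → ℝ :=
  fun i => (((1 / 2 : ℝ) • (E * E + E)) *ᵥ t) (iV i)

/-! ### Cartan geometries of type `(SO(n+1,n), P)` -/

/-- A Cartan geometry on `M`: a smooth principal `P`-bundle `Q → M` and a Cartan connection. -/
structure CartanGeometry (n : ℕ)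
    (EM : Type*) [NormedAddCommGroup EM] [NormedSpace ℝ EM]
    (M : Type*) [TopologicalSpace M] [ChartedSpace EM M]
    (EQ : Type*) [NormedAddCommGroup EQ] [NormedSpace ℝ EQ]
    (Q : Type*) [TopologicalSpace Q] [ChartedSpace EQ Q] [IsManifold 𝓘(ℝ, EQ) ∞ Q] where
  /-- the projection -/
  proj : Q → M
  contMDiff_proj : ContMDiff 𝓘(ℝ, EQ) 𝓘(ℝ, EM) ∞ proj
  /-- the right action of `P` -/
  act : Q → parabolicP n → Q
  act_one : ∀ u, act u 1 = u
  act_mul : ∀ u p q, act u (p * q) = act (act u p) q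
  proj_act : ∀ u p, proj (act u p) = proj u
  /-- The action is smooth: it takes smooth families to smooth families. -/
  contMDiffAt_act : ∀ (k : ℕ) (f : EuclideanSpace ℝ (Fin k) → Q)
    (p : EuclideanSpace ℝ (Fin k) → parabolicP n) (e : EuclideanSpace ℝ (Fin k)),
    ContMDiffAt 𝓘(ℝ, EuclideanSpace ℝ (Fin k)) 𝓘(ℝ, EQ) ∞ f e →
    (∀ i j, ContDiffAt ℝ ∞ (fun x => pMat (p x) i j) e) →
    ContMDiffAt 𝓘(ℝ, EuclideanSpace ℝ (Fin k)) 𝓘(ℝ, EQ) ∞ (fun x => act (f x) (p x)) e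
  /-- Local triviality: near each point there is a smooth section `σ`, and
  `(y, p) ↦ σ(y) p` is bijective with a smooth inverse `u ↦ (proj u, γ u)`. -/
  locally_trivial : ∀ x : M, ∃ W : Set M, IsOpen W ∧ x ∈ W ∧
    ∃ (σ : M → Q) (γ : Q → parabolicP n),
      ContMDiffOn 𝓘(ℝ, EM) 𝓘(ℝ, EQ) ∞ σ W ∧ (∀ y ∈ W, proj (σ y) = y) ∧
      (∀ i j, ContMDiffOn 𝓘(ℝ, EQ) 𝓘(ℝ, ℝ) ∞ (fun u => pMat (γ u) i j) (proj ⁻¹' W)) ∧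
      (∀ u ∈ proj ⁻¹' W, act (σ (proj u)) (γ u) = u) ∧
      (∀ y ∈ W, ∀ p, γ (act (σ y) p) = p)
  /-- the Cartan connection `ω`, a linear isomorphism on each tangent space -/
  cform : ∀ u : Q, TangentSpace 𝓘(ℝ, EQ) u ≃ₗ[ℝ] gAlg n
  /-- The Cartan connection is a smooth one-form. -/
  contMDiff_cform : ∀ i j, ContMDiff (𝓘(ℝ, EQ)).tangent 𝓘(ℝ, ℝ) ∞
    (fun ξ : TangentBundle 𝓘(ℝ, EQ) Q => (cform ξ.1 ξ.2 : Mat n) i j)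
  /-- It is equivariant. -/
  cform_act : ∀ (u : Q) (p : parabolicP n) (ξ : TangentSpace 𝓘(ℝ, EQ) u),
    (cform (act u p) (mfderiv 𝓘(ℝ, EQ) 𝓘(ℝ, EQ) (fun u' => act u' p) u ξ) : Mat n) =
      pMat p⁻¹ * (cform u ξ : Mat n) * pMat p
  /-- It reproduces fundamental vector fields: the velocity at `0` of `t ↦ u c(t)`, for a curve `c`
  in `P` with `c(0) = 1` and `c'(0) = A`, is sent to `A`. -/
  cform_fundamental : ∀ (u : Q) (c : ℝ → parabolicP n) (A : Mat n), c 0 = 1 →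
    (∀ i j, ContDiff ℝ ∞ (fun t => pMat (c t) i j)) →
    (∀ i j, deriv (fun t => pMat (c t) i j) 0 = A i j) →
    (cform (act u (c 0)) (mfderiv 𝓘(ℝ, ℝ) 𝓘(ℝ, EQ) (fun t => act u (c t)) 0 (1 : ℝ)) : Mat n) = A

namespace CartanGeometry

variable {n : ℕ}
  {EM : Type*} [NormedAddCommGroup EM] [NormedSpace ℝ EM]
  {M : Type*} [TopologicalSpace M] [ChartedSpace EM M]
  {EQ : Type*} [NormedAddCommGroup EQ] [NormedSpace ℝ EQ]
  {Q : Type*} [TopologicalSpace Q] [ChartedSpace EQ Q] [IsManifold 𝓘(ℝ, EQ) ∞ Q]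

/-! Sections over an open set `W ⊂ M` of a bundle associated to `Q` are smooth equivariant functions
on the preimage of `W`; values elsewhere are irrelevant. -/

/-- Sections of the standard tractor bundle `𝒯 = Q ×_P ℝ^{n+1,n}`. -/
def IsTractorSection (𝒢 : CartanGeometry n EM M EQ Q) (W : Set M) (s : Q → Std n) : Prop :=
  ContMDiffOn 𝓘(ℝ, EQ) 𝓘(ℝ, Std n) ∞ s (𝒢.proj ⁻¹' W) ∧
  ∀ u ∈ 𝒢.proj ⁻¹' W, ∀ p, s (𝒢.act u p) = pMat p⁻¹ *ᵥ s u

/-- Sections of the bundle `H`, the quotient of `𝒯` by the kernel of `π²`. -/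
def IsHSection (𝒢 : CartanGeometry n EM M EQ Q) (W : Set M) (X : Q → (Fin n → ℝ)) : Prop :=
  ContMDiffOn 𝓘(ℝ, EQ) 𝓘(ℝ, Fin n → ℝ) ∞ X (𝒢.proj ⁻¹' W) ∧
  ∀ u ∈ 𝒢.proj ⁻¹' W, ∀ p, X (𝒢.act u p) = blk0 (pMat p⁻¹) *ᵥ X u

/-- Sections of the adjoint bundle (with values in all matrices). -/
def IsAdjSection (𝒢 : CartanGeometry n EM M EQ Q) (W : Set M) (Y : Q → Mat n) : Prop :=
  (∀ i j, ContMDiffOn 𝓘(ℝ, EQ) 𝓘(ℝ, ℝ) ∞ (fun u => Y u i j) (𝒢.proj ⁻¹' W)) ∧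
  ∀ u ∈ 𝒢.proj ⁻¹' W, ∀ p, Y (𝒢.act u p) = pMat p⁻¹ * Y u * pMat p

/-- The derivative along `ξ` of a function on `Q` with values in a normed space. -/
def dirDeriv {F : Type*} [NormedAddCommGroup F] [NormedSpace ℝ F] (f : Q → F) (u : Q)
    (ξ : TangentSpace 𝓘(ℝ, EQ) u) : F :=
  mfderiv 𝓘(ℝ, EQ) 𝓘(ℝ, F) f u ξ

/-- The tractor derivative of `s` along (the projection to `M` of) `ξ`. -/
def tractorDeriv (𝒢 : CartanGeometry n EM M EQ Q) (s : Q → Std n) (u : Q)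
    (ξ : TangentSpace 𝓘(ℝ, EQ) u) : Std n :=
  dirDeriv s u ξ + (𝒢.cform u ξ : Mat n) *ᵥ s u

/-! ### Subbundles of the tractor bundle -/

/-- `V` is a smooth subbundle of `𝒯` of rank `r`, given as an equivariant family of subspaces. -/
def IsSubbundle (𝒢 : CartanGeometry n EM M EQ Q) (r : ℕ) (V : Q → Submodule ℝ (Std n)) : Prop :=
  (∀ u p, V (𝒢.act u p) = (V u).map (Matrix.toLin' (pMat p⁻¹))) ∧
  ∀ x : M, ∃ W : Set M, IsOpen W ∧ x ∈ W ∧ ∃ s : Fin r → Q → Std n,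
    (∀ k, 𝒢.IsTractorSection W (s k)) ∧
    ∀ u ∈ 𝒢.proj ⁻¹' W, LinearIndependent ℝ (fun k => s k u) ∧
      V u = Submodule.span ℝ (Set.range fun k => s k u)

/-- `π²` is injective on the fibres of `V` over `U`. -/
def InjectiveOver (𝒢 : CartanGeometry n EM M EQ Q) (U : Set M) (V : Q → Submodule ℝ (Std n)) :
    Prop :=
  ∀ u ∈ 𝒢.proj ⁻¹' U, Set.InjOn (piH n) (V u : Set (Std n))

/-- `V` is generic: `π²` is injective on it over an open dense subset of `M`. -/
def IsGeneric (𝒢 : CartanGeometry n EM M EQ Q) (V : Q → Submodule ℝ (Std n)) : Prop :=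
  ∃ U : Set M, IsOpen U ∧ Dense U ∧ 𝒢.InjectiveOver U V

/-- The tractor connection preserves `V` over `U`: derivatives of local sections of `V` lie in
`V`. -/
def PreservedOver (𝒢 : CartanGeometry n EM M EQ Q) (U : Set M) (V : Q → Submodule ℝ (Std n)) :
    Prop :=
  ∀ W : Set M, IsOpen W → W ⊆ U → ∀ s : Q → Std n, 𝒢.IsTractorSection W s →
    (∀ u ∈ 𝒢.proj ⁻¹' W, s u ∈ V u) →
    ∀ u ∈ 𝒢.proj ⁻¹' W, ∀ ξ : TangentSpace 𝓘(ℝ, EQ) u, 𝒢.tractorDeriv s u ξ ∈ V u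

end CartanGeometry

section Fibrewise

variable {n : ℕ} {Q : Type*}

/-- The subbundle `A = π²(V)` of `H`. -/
def subA (V : Q → Submodule ℝ (Std n)) (u : Q) : Submodule ℝ (Fin n → ℝ) := (V u).map (piH n)

/-- The inverse `A → V` of `π²`. -/
def liftA (V : Q → Submodule ℝ (Std n)) (u : Q) (X : Fin n → ℝ) : Std n :=
  Function.invFunOn (piH n) (V u : Set (Std n)) X

/-- The metric `g` on `A`, the restriction of `h` to `V`. -/
def metricG (V : Q → Submodule ℝ (Std n)) (u : Q) (X Y : Fin n → ℝ) : ℝ :=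
  metricH (liftA V u X) (liftA V u Y)

/-- `iso(A)`: the elements of `A` that are `g`-orthogonal to `A`. -/
def isoA (V : Q → Submodule ℝ (Std n)) (u : Q) : Set (Fin n → ℝ) :=
  {X | X ∈ subA V u ∧ ∀ Y ∈ subA V u, metricG V u X Y = 0}

/-- The map `μ : A → H*`, in the splitting given by `η`. -/
def muMap (V : Q → Submodule ℝ (Std n)) (η : Q → Mat n) (u : Q) (X : Fin n → ℝ) : Fin n → ℝ :=
  compV (η u) (liftA V u X)

/-- `μ(A) ⊂ H*`. -/
def muA (V : Q → Submodule ℝ (Std n)) (η : Q → Mat n) (u : Q) : Set (Fin n → ℝ) :=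
  muMap V η u '' (subA V u : Set (Fin n → ℝ))

/-- `m : H → H*` is symmetric and extends `μ : A → H*` at `u`. -/
def IsSymmExtension (V : Q → Submodule ℝ (Std n)) (η : Q → Mat n) (u : Q)
    (m : Matrix (Fin n) (Fin n) ℝ) : Prop :=
  m.IsSymm ∧ ∀ X ∈ subA V u, m *ᵥ X = muMap V η u X

/-- `A^⊥ ⊂ H*`. -/
def perpA (V : Q → Submodule ℝ (Std n)) (u : Q) : Submodule ℝ (Fin n → ℝ) :=
  perp (subA V u : Set (Fin n → ℝ))

/-- `A^⊥ ⊕ {H*, A^⊥} ⊂ T*`. -/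
def modelPref (V : Q → Submodule ℝ (Std n)) (η : Q → Mat n) (u : Q) : Submodule ℝ (Mat n) :=
  inP1 (η u) (perpA V u) ⊔ brk (inP1 (η u) ⊤) (inP1 (η u) (perpA V u))

/-- `A^⊥ ⊕ {iso(A)^⊥, A^⊥} ⊂ T*`. -/
def modelStrong (V : Q → Submodule ℝ (Std n)) (η : Q → Mat n) (u : Q) : Submodule ℝ (Mat n) :=
  inP1 (η u) (perpA V u) ⊔ brk (inP1 (η u) (perp (isoA V u))) (inP1 (η u) (perpA V u))

/-! The tangent bundle is `Q ×_P 𝔤/𝔭`, so a subbundle of it is given by subspaces of `𝔤` that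
contain `𝔭`. -/

/-- `B = {A, A} ⊂ T`. -/
def bundleB (V : Q → Submodule ℝ (Std n)) (η : Q → Mat n) (u : Q) : Submodule ℝ (Mat n) :=
  brk (inM1 (η u) (subA V u)) (inM1 (η u) (subA V u)) ⊔ pAlg n

/-- `C = H ⊕ B + {μ(A)^⊥, μ(A)^⊥} ⊂ T`. -/
def bundleC (V : Q → Submodule ℝ (Std n)) (η : Q → Mat n) (u : Q) : Submodule ℝ (Mat n) :=
  inM1 (η u) ⊤ ⊔ bundleB V η u ⊔
    brk (inM1 (η u) (perp (muA V η u))) (inM1 (η u) (perp (muA V η u))) ⊔ pAlg n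

end Fibrewise

namespace CartanGeometry

variable {n : ℕ}
  {EM : Type*} [NormedAddCommGroup EM] [NormedSpace ℝ EM]
  {M : Type*} [TopologicalSpace M] [ChartedSpace EM M]
  {EQ : Type*} [NormedAddCommGroup EQ] [NormedSpace ℝ EQ]
  {Q : Type*} [TopologicalSpace Q] [ChartedSpace EQ Q] [IsManifold 𝓘(ℝ, EQ) ∞ Q]

/-! ### Weyl structures and their preferred connections -/

/-- Weyl structures over `U`: equivariant functions with values in the lifts to `𝔭` of the grading
element of `𝔭 / 𝔭^⊥`. They correspond bijectively to preferred connections over `U`. -/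
def IsWeyl (𝒢 : CartanGeometry n EM M EQ Q) (U : Set M) (η : Q → Mat n) : Prop :=
  𝒢.IsAdjSection U η ∧ ∀ u ∈ 𝒢.proj ⁻¹' U, η u - gradEl n ∈ nilAlg n

/-- The reduction of `Q` to `G₀` given by `η` consists of the `u` with `η u = gradEl n`, and
`ξ ∈ T_u Q` is tangent to it if the derivative of `η` along `ξ` vanishes. -/
def TangentToReduction (_𝒢 : CartanGeometry n EM M EQ Q) (η : Q → Mat n) (u : Q)
    (ξ : TangentSpace 𝓘(ℝ, EQ) u) : Prop :=
  η u = gradEl n ∧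
    ∀ i j, dirDeriv (fun u' => η u' i j) u ξ = 0

/-! For `ξ` tangent to the reduction, `ω(ξ) = Z + ω₀(ξ) + P(Z)`, where `Z = Z_{-1} + Z_{-2}` is the
image of `ξ` in `T`, `ω₀` is the connection form of the preferred connection `∇`, and
`P(Z) = P(Z)_1 + P(Z)_2` is the rho-tensor. -/

def zM1 (𝒢 : CartanGeometry n EM M EQ Q) (u : Q) (ξ : TangentSpace 𝓘(ℝ, EQ) u) : Fin n → ℝ :=
  blkM1 (𝒢.cform u ξ : Mat n)

def zM2 (𝒢 : CartanGeometry n EM M EQ Q) (u : Q) (ξ : TangentSpace 𝓘(ℝ, EQ) u) :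
    Matrix (Fin n) (Fin n) ℝ :=
  blkM2 (𝒢.cform u ξ : Mat n)

def rho1 (𝒢 : CartanGeometry n EM M EQ Q) (u : Q) (ξ : TangentSpace 𝓘(ℝ, EQ) u) : Fin n → ℝ :=
  blk1 (𝒢.cform u ξ : Mat n)

def rho2 (𝒢 : CartanGeometry n EM M EQ Q) (u : Q) (ξ : TangentSpace 𝓘(ℝ, EQ) u) :
    Matrix (Fin n) (Fin n) ℝ :=
  blk2 (𝒢.cform u ξ : Mat n)

/-- `∇_Z X` for a section `X` of `H`, where `ξ` is tangent to the reduction and projects to `Z`. -/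
def covDeriv (𝒢 : CartanGeometry n EM M EQ Q) (X : Q → (Fin n → ℝ)) (u : Q)
    (ξ : TangentSpace 𝓘(ℝ, EQ) u) : Fin n → ℝ :=
  dirDeriv X u ξ + blk0 (𝒢.cform u ξ : Mat n) *ᵥ X u

/-- `V`-preferred connections over `U`: `g^∇ = g`. -/
def IsPreferred (𝒢 : CartanGeometry n EM M EQ Q) (U : Set M) (V : Q → Submodule ℝ (Std n))
    (η : Q → Mat n) : Prop :=
  𝒢.IsWeyl U η ∧ ∀ u ∈ 𝒢.proj ⁻¹' U, ∀ X ∈ subA V u, ∀ Y ∈ subA V u,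
    muMap V η u X ⬝ᵥ Y = metricG V u X Y

/-- Strongly `V`-preferred connections over `U`: moreover `μ(A) ∩ A^⊥ = 0`. -/
def IsStronglyPreferred (𝒢 : CartanGeometry n EM M EQ Q) (U : Set M)
    (V : Q → Submodule ℝ (Std n)) (η : Q → Mat n) : Prop :=
  𝒢.IsPreferred U V η ∧ ∀ u ∈ 𝒢.proj ⁻¹' U,
    muA V η u ∩ (perpA V u : Set (Fin n → ℝ)) ⊆ {0}

/-- Sections over `U` of a family of subspaces of the adjoint bundle. -/
def IsSectionOf (𝒢 : CartanGeometry n EM M EQ Q) (U : Set M) (N : Q → Submodule ℝ (Mat n))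
    (Y : Q → Mat n) : Prop :=
  𝒢.IsAdjSection U Y ∧ ∀ u ∈ 𝒢.proj ⁻¹' U, Y u ∈ N u

/-- Sections over `W` of the subbundle `A` of `H`. -/
def IsASection (𝒢 : CartanGeometry n EM M EQ Q) (W : Set M) (V : Q → Submodule ℝ (Std n))
    (X : Q → (Fin n → ℝ)) : Prop :=
  𝒢.IsHSection W X ∧ ∀ u ∈ 𝒢.proj ⁻¹' W, X u ∈ subA V u

/-- `A` is preserved by `∇` along the directions in `C`. -/
def PreservesAAlongC (𝒢 : CartanGeometry n EM M EQ Q) (U : Set M) (V : Q → Submodule ℝ (Std n))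
    (η : Q → Mat n) : Prop :=
  ∀ W : Set M, IsOpen W → W ⊆ U → ∀ X, 𝒢.IsASection W V X →
    ∀ u ∈ 𝒢.proj ⁻¹' W, ∀ ξ : TangentSpace 𝓘(ℝ, EQ) u, 𝒢.TangentToReduction η u ξ →
      (𝒢.cform u ξ : Mat n) ∈ bundleC V η u → 𝒢.covDeriv X u ξ ∈ subA V u

/-- `∇μ` is zero on `A ⊗ A`: `Z (μ(X, Y)) = μ(∇_Z X, Y) + μ(X, ∇_Z Y)` for sections `X`, `Y` of `A`
and all `Z` in `T`. Here `μ` is extended to a symmetric form on `H`, since `∇_Z X` need not lie in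
`A`; the values involved do not depend on the extension. -/
def NablaMuZero (𝒢 : CartanGeometry n EM M EQ Q) (U : Set M) (V : Q → Submodule ℝ (Std n))
    (η : Q → Mat n) : Prop :=
  ∀ W : Set M, IsOpen W → W ⊆ U → ∀ X Y, 𝒢.IsASection W V X → 𝒢.IsASection W V Y →
    ∀ u ∈ 𝒢.proj ⁻¹' W, ∀ ξ : TangentSpace 𝓘(ℝ, EQ) u, 𝒢.TangentToReduction η u ξ →
      ∀ m, IsSymmExtension V η u m →
        dirDeriv (fun u' => muMap V η u' (X u') ⬝ᵥ Y u') u ξ =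
          (m *ᵥ 𝒢.covDeriv X u ξ) ⬝ᵥ Y u + (m *ᵥ X u) ⬝ᵥ 𝒢.covDeriv Y u ξ

/-- `P_{11} = -μ + η'` with `η'` a section of `H* ⊗ A^⊥`. -/
def Rho11Form (𝒢 : CartanGeometry n EM M EQ Q) (U : Set M) (V : Q → Submodule ℝ (Std n))
    (η : Q → Mat n) : Prop :=
  ∀ u ∈ 𝒢.proj ⁻¹' U, ∀ ξ : TangentSpace 𝓘(ℝ, EQ) u, 𝒢.TangentToReduction η u ξ →
    𝒢.zM2 u ξ = 0 → ∀ m, IsSymmExtension V η u m →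
      𝒢.rho1 u ξ + m *ᵥ 𝒢.zM1 u ξ ∈ perpA V u

/-- `P_{22} = -μ + η'` with `η'` a section of `T₂* ⊗ {A^⊥, S}`. Here `μ` is extended to
`T_{-2} = Λ² H` by `μ(Y₁ ∧ Y₂) = μ(Y₁) ∧ μ(Y₂)`; on skew maps this is `Z ↦ μ Z μ`. -/
def Rho22Form (𝒢 : CartanGeometry n EM M EQ Q) (U : Set M) (V : Q → Submodule ℝ (Std n))
    (η : Q → Mat n) (S : Q → Submodule ℝ (Fin n → ℝ)) : Prop :=
  ∀ u ∈ 𝒢.proj ⁻¹' U, ∀ ξ : TangentSpace 𝓘(ℝ, EQ) u, 𝒢.TangentToReduction η u ξ →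
    𝒢.zM1 u ξ = 0 → ∀ m, IsSymmExtension V η u m →
      ofBlk2 (𝒢.rho2 u ξ + m * 𝒢.zM2 u ξ * m) ∈
        brk (inP1 (η u) (perpA V u)) (inP1 (η u) (S u))

/-- `P_{21}` is a section of `T₂* ⊗ A^⊥`. -/
def Rho21Form (𝒢 : CartanGeometry n EM M EQ Q) (U : Set M) (V : Q → Submodule ℝ (Std n))
    (η : Q → Mat n) : Prop :=
  ∀ u ∈ 𝒢.proj ⁻¹' U, ∀ ξ : TangentSpace 𝓘(ℝ, EQ) u, 𝒢.TangentToReduction η u ξ →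
    𝒢.zM1 u ξ = 0 → 𝒢.rho1 u ξ ∈ perpA V u

/-- `P_{12}` is a section of `T₁* ⊗ {A^⊥, S}`. -/
def Rho12Form (𝒢 : CartanGeometry n EM M EQ Q) (U : Set M) (V : Q → Submodule ℝ (Std n))
    (η : Q → Mat n) (S : Q → Submodule ℝ (Fin n → ℝ)) : Prop :=
  ∀ u ∈ 𝒢.proj ⁻¹' U, ∀ ξ : TangentSpace 𝓘(ℝ, EQ) u, 𝒢.TangentToReduction η u ξ →
    𝒢.zM2 u ξ = 0 →
      ofBlk2 (𝒢.rho2 u ξ) ∈ brk (inP1 (η u) (perpA V u)) (inP1 (η u) (S u))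

end CartanGeometry

end FreeDist

end

/-! Everything is computed on `Q`, where bundle sections are equivariant functions and a Weyl
structure has values `E = gradEl + nilM b c`. The projection to the eigenspace of `E` for `1` is
`projP E = (E² + E) / 2`, and the tractor splits as `t = (v, τ, X)`, where `(v, 0, 0)` is `projP E
*ᵥ t`.

Pointwise algebra. `V`-preferred means `2 h(projP E t, s) = h(t, s)` on `V`
(`muMap_eq_metricG_iff`). For `s = t` the two sides differ by `τ² / 2`, so `τ` vanishes on `V`,
which fixes `b` on `A` (`IsPrefAt.iR_eq`); the rest of the condition is the symmetry of `μ`. A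
change `(d, e)` of `(b, c)` therefore keeps the condition exactly when `d ∈ A^⊥` and the degree-two
part of the change, graded by `E`, vanishes on `A × A`. Skew forms with this property span `{H*,
A^⊥}`; those that also kill `iso(A)` span `{iso(A)^⊥, A^⊥}` (`mem_wedgeSpan_iff`). For a preferred
structure `μ(X) ∈ A^⊥` means `X ∈ iso(A)`, so "strongly" says that `projP E` kills the radical of
`h` on `V`. That `B` is well defined follows because the brackets of `A` modulo `𝔭` see only `b` on
`A`.

Existence. From a frame of `V` an explicit formula, smooth in the frame because the Gram matrix
`XᵀX` is invertible, gives a strongly preferred lift. It is spread over `Q` by equivariance, and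
local solutions are averaged with a partition of unity, since the condition is affine.

Parallel `V`. Let `ξ` be tangent to the reduction, `a = ω(ξ)` and `t` a section of `V`. Then `η` is
constant to first order along `ξ`, while the tractor derivative `dt(ξ) + a t` lies in `V`.
Differentiating the two pointwise conditions leaves conditions on `a` alone
(`connection_relations`). Read in blocks, they give `P_1(X) = -μ(X)(Z_{-1})` and `P_2` on `A × A` in
terms of `Z_{-2}` and `μ`. Likewise `∇_Z X` is an element of `A` minus `Z_{-2} μ(X)`, which yields
the statements on `∇A` and `∇μ`.

The strong case needs `P_2` to vanish on `iso(A)`. The radical need not be known to be a smooth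
bundle, so its elements are extended along a curve only, by parallel transport: a linear ODE keeps
them in `V`, and uniqueness for a second linear ODE keeps them in the radical
(`blk2_mulVec_radical`). -/

noncomputable section

namespace FreeDist

/-! ### Index duality, the metric and the Lie algebra in coordinates -/

section Algebra

variable {n : ℕ}

/-- The index dual to `a` for the Gram matrix. -/
def dualIdx : Idx n → Idx n
  | Sum.inl i => iH i
  | Sum.inr (Sum.inl _) => iR
  | Sum.inr (Sum.inr i) => iV i

@[simp] lemma dualIdx_iV (i : Fin n) : dualIdx (iV i) = iH i := rfl
@[simp] lemma dualIdx_iR (x : Unit) : dualIdx (Sum.inr (Sum.inl x) : Idx n) = iR := rfl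
@[simp] lemma dualIdx_iH (i : Fin n) : dualIdx (iH i) = iV i := rfl

@[simp] lemma dualIdx_dualIdx (a : Idx n) : dualIdx (dualIdx a) = a := by
  rcases a with i | _ | i <;> rfl

lemma gramJ_apply (a b : Idx n) : gramJ n a b = if b = dualIdx a then 1 else 0 := by
  rcases a with i | _ | i <;> rcases b with j | _ | j <;> simp [gramJ, dualIdx, eq_comm]

lemma gramJ_mul_apply (X : Mat n) (a b : Idx n) : (gramJ n * X) a b = X (dualIdx a) b := by
  simp [Matrix.mul_apply, gramJ_apply]

lemma mul_gramJ_apply (X : Mat n) (a b : Idx n) : (X * gramJ n) a b = X a (dualIdx b) := by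
  have h : ∀ c : Idx n, b = dualIdx c ↔ c = dualIdx b := fun c =>
    ⟨fun h => by rw [h, dualIdx_dualIdx], fun h => by rw [h, dualIdx_dualIdx]⟩
  simp [Matrix.mul_apply, gramJ_apply, h]

lemma gramJ_mulVec (t : Std n) (a : Idx n) : (gramJ n *ᵥ t) a = t (dualIdx a) := by
  simp [Matrix.mulVec, dotProduct, gramJ_apply]

lemma mem_gAlg_iff' {X : Mat n} : X ∈ gAlg n ↔ Xᵀ * gramJ n = -(gramJ n * X) := by
  rw [mem_skewAdjointMatricesSubmodule, Matrix.IsSkewAdjoint, Matrix.IsAdjointPair, mul_neg]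

lemma mem_gAlg_iff {X : Mat n} : X ∈ gAlg n ↔ ∀ a b, X (dualIdx b) a = -X (dualIdx a) b := by
  rw [mem_gAlg_iff', ← Matrix.ext_iff]
  simp only [mul_gramJ_apply, Matrix.neg_apply, gramJ_mul_apply, Matrix.transpose_apply]

/-- The `H*` coordinates of a vector. -/
def piV (t : Std n) : Fin n → ℝ := fun i => t (iV i)

@[simp] lemma piV_apply (t : Std n) (i : Fin n) : piV t i = t (iV i) := rfl
@[simp] lemma piH_apply (t : Std n) (i : Fin n) : piH n t i = t (iH i) := rfl

lemma std_ext {s t : Std n} (h1 : piV s = piV t) (h2 : s iR = t iR) (h3 : piH n s = piH n t) :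
    s = t := by
  funext a
  rcases a with i | _ | i
  exacts [congrFun h1 i, h2, congrFun h3 i]

lemma metricH_eq (s t : Std n) :
    metricH s t = (1 / 2) * (piV s ⬝ᵥ piH n t + piH n s ⬝ᵥ piV t + s iR * t iR) := by
  simp only [metricH, dotProduct, gramJ_mulVec, Fintype.sum_sum_type, dualIdx_iV, dualIdx_iR,
    dualIdx_iH, piV_apply, piH_apply, Finset.univ_unique, Finset.sum_singleton]
  ring

lemma metricH_comm (s t : Std n) : metricH s t = metricH t s := by
  rw [metricH_eq, metricH_eq, dotProduct_comm (piV s), dotProduct_comm (piH n s)]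
  ring

/-- `metricH` as a bilinear map. -/
def metricB (n : ℕ) : Std n →ₗ[ℝ] Std n →ₗ[ℝ] ℝ :=
  LinearMap.mk₂ ℝ metricH
    (fun s s' t => by simp [metricH, mul_add])
    (fun c s t => by simp [metricH, mul_left_comm])
    (fun s t t' => by simp [metricH, Matrix.mulVec_add, mul_add])
    (fun c s t => by simp [metricH, Matrix.mulVec_smul, mul_left_comm])

@[simp] lemma metricB_apply (s t : Std n) : metricB n s t = metricH s t := rfl

lemma metricH_mulVec_left {X : Mat n} (hX : X ∈ gAlg n) (s t : Std n) :
    metricH (X *ᵥ s) t = -metricH s (X *ᵥ t) := by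
  have h := mem_gAlg_iff'.1 hX
  simp only [metricH]
  rw [Matrix.mulVec_mulVec, dotProduct_comm (X *ᵥ s), Matrix.dotProduct_mulVec,
    ← Matrix.mulVec_transpose, dotProduct_comm, Matrix.mulVec_mulVec, h]
  simp [Matrix.neg_mulVec]

lemma metricH_mulVec_mulVec {p : Mat n} (hp : pᵀ * gramJ n * p = gramJ n) (s t : Std n) :
    metricH (p *ᵥ s) (p *ᵥ t) = metricH s t := by
  simp only [metricH]
  rw [← Matrix.vecMul_transpose, ← Matrix.dotProduct_mulVec, Matrix.mulVec_mulVec,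
    Matrix.mulVec_mulVec, hp]

/-! ### The nilradical and the lifts of the grading element -/

/-- The element of the nilradical with components `b` and `c`. -/
def nilM (b : Fin n → ℝ) (c : Matrix (Fin n) (Fin n) ℝ) : Mat n :=
  Matrix.of fun x y => match x, y with
    | Sum.inl i, Sum.inr (Sum.inl _) => b i
    | Sum.inl i, Sum.inr (Sum.inr j) => c i j
    | Sum.inr (Sum.inl _), Sum.inr (Sum.inr j) => -b j
    | _, _ => 0

lemma nilM_add (b d : Fin n → ℝ) (c e : Matrix (Fin n) (Fin n) ℝ) :
    nilM b c + nilM d e = nilM (b + d) (c + e) := by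
  ext x y
  rcases x with i | _ | i <;> rcases y with j | _ | j <;> simp [nilM]
  ring

lemma nilM_smul (r : ℝ) (b : Fin n → ℝ) (c : Matrix (Fin n) (Fin n) ℝ) :
    r • nilM b c = nilM (r • b) (r • c) := by
  ext x y
  rcases x with i | _ | i <;> rcases y with j | _ | j <;> simp [nilM]

lemma nilM_injective {b d : Fin n → ℝ} {c e : Matrix (Fin n) (Fin n) ℝ}
    (h : nilM b c = nilM d e) : b = d ∧ c = e := by
  refine ⟨funext fun i => ?_, ?_⟩
  · exact congrFun (congrFun h (iV i)) iR
  · ext i j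
    exact congrFun (congrFun h (iV i)) (iH j)

lemma nilM_mem_gAlg (b : Fin n → ℝ) {c : Matrix (Fin n) (Fin n) ℝ} (hc : cᵀ = -c) :
    nilM b c ∈ gAlg n := by
  have hc' : ∀ i j, c i j = -c j i := fun i j => congrFun (congrFun hc j) i
  rw [mem_gAlg_iff]
  intro x y
  rcases x with i | _ | i <;> rcases y with j | _ | j <;> simp [nilM, dualIdx]
  exact hc' j i

lemma mem_nilAlg_iff {X : Mat n} : X ∈ nilAlg n ↔ ∃ b c, cᵀ = -c ∧ X = nilM b c := by
  constructor
  · rintro ⟨hg, h0⟩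
    rw [mem_gAlg_iff] at hg
    refine ⟨fun i => X (iV i) iR, Matrix.of fun i j => X (iV i) (iH j), ?_, ?_⟩
    · ext i j
      exact hg (iH i) (iH j)
    · ext x y
      rcases y with j | _ | j
      · rw [h0]; rcases x with i | _ | i <;> simp [nilM]
      · rcases x with i | _ | i
        · simp [nilM]
        · have := hg iR iR
          simp only [dualIdx_iR, nilM, Matrix.of_apply] at this ⊢
          linarith
        · have := hg iR (iV i)
          simp only [dualIdx_iR, dualIdx_iV, nilM, Matrix.of_apply] at this ⊢
          rw [this, h0, neg_zero]
      · rcases x with i | _ | i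
        · simp [nilM]
        · have := hg (iH j) iR
          simpa [nilM] using this
        · have := hg (iH j) (iV i)
          simp only [dualIdx_iH, dualIdx_iV, nilM, Matrix.of_apply] at this ⊢
          rw [this, h0, neg_zero]
  · rintro ⟨b, c, hc, rfl⟩
    refine ⟨nilM_mem_gAlg b hc, fun a j => ?_⟩
    rcases a with i | _ | i <;> simp [nilM]

lemma exists_eq_of_lift {E : Mat n} (hE : E - gradEl n ∈ nilAlg n) :
    ∃ b c, cᵀ = -c ∧ E = gradEl n + nilM b c := by
  obtain ⟨b, c, hc, h⟩ := mem_nilAlg_iff.1 hE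
  exact ⟨b, c, hc, by rw [← h]; abel⟩

lemma gradEl_mem_gAlg : gradEl n ∈ gAlg n := by
  rw [mem_gAlg_iff]
  intro x y
  rcases x with i | _ | i <;> rcases y with j | _ | j <;>
    simp [gradEl, dualIdx, Matrix.diagonal_apply]
  all_goals split_ifs with h1 h2 h2 <;> simp_all

lemma mem_gAlg_of_lift {E : Mat n} (hE : E - gradEl n ∈ nilAlg n) : E ∈ gAlg n := by
  have := (gAlg n).add_mem hE.1 gradEl_mem_gAlg
  simpa using this

/-- The projection to the eigenspace of `E` for the eigenvalue `1`. -/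
def projP (E : Mat n) : Mat n := (1 / 2 : ℝ) • (E * E + E)

lemma compV_eq (E : Mat n) (t : Std n) : compV E t = piV (projP E *ᵥ t) := rfl

section lift

variable (b : Fin n → ℝ) (c : Matrix (Fin n) (Fin n) ℝ)

lemma piV_lift_mulVec (t : Std n) :
    piV ((gradEl n + nilM b c) *ᵥ t) = piV t + t iR • b + c *ᵥ piH n t := by
  funext i
  simp [Matrix.mulVec, dotProduct, gradEl, nilM, Matrix.diagonal_apply, Fintype.sum_sum_type,
    mul_comm]
  ring

lemma iR_lift_mulVec (t : Std n) :
    ((gradEl n + nilM b c) *ᵥ t) iR = -(b ⬝ᵥ piH n t) := by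
  simp [Matrix.mulVec, dotProduct, gradEl, nilM, Matrix.diagonal_apply]

lemma piH_lift_mulVec (t : Std n) :
    piH n ((gradEl n + nilM b c) *ᵥ t) = -piH n t := by
  funext i
  simp [Matrix.mulVec, dotProduct, gradEl, nilM, Matrix.diagonal_apply]

lemma projP_mulVec (E : Mat n) (t : Std n) :
    projP E *ᵥ t = (1 / 2 : ℝ) • (E *ᵥ (E *ᵥ t) + E *ᵥ t) := by
  rw [projP, Matrix.smul_mulVec, Matrix.add_mulVec, Matrix.mulVec_mulVec]

lemma piH_projP (t : Std n) : piH n (projP (gradEl n + nilM b c) *ᵥ t) = 0 := by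
  rw [projP_mulVec, map_smul, map_add, piH_lift_mulVec, piH_lift_mulVec]
  simp

lemma iR_projP (t : Std n) : (projP (gradEl n + nilM b c) *ᵥ t) iR = 0 := by
  rw [projP_mulVec, Pi.smul_apply, Pi.add_apply, iR_lift_mulVec, iR_lift_mulVec, piH_lift_mulVec]
  simp

lemma piV_projP (t : Std n) :
    piV (projP (gradEl n + nilM b c) *ᵥ t) =
      piV t + t iR • b + (1 / 2 : ℝ) • (c *ᵥ piH n t) - ((1 / 2 : ℝ) * (b ⬝ᵥ piH n t)) • b := by
  have h : ∀ s s' : Std n, piV ((1 / 2 : ℝ) • (s + s')) = (1 / 2 : ℝ) • (piV s + piV s') :=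
    fun _ _ => rfl
  rw [projP_mulVec, h, piV_lift_mulVec, piV_lift_mulVec, piH_lift_mulVec, iR_lift_mulVec,
    Matrix.mulVec_neg]
  module

lemma metricH_projP (s t : Std n) :
    metricH (projP (gradEl n + nilM b c) *ᵥ s) t =
      (1 / 2) * (piV (projP (gradEl n + nilM b c) *ᵥ s) ⬝ᵥ piH n t) := by
  rw [metricH_eq, iR_projP, piH_projP]
  simp

lemma projP_eq_zero_iff (t : Std n) :
    projP (gradEl n + nilM b c) *ᵥ t = 0 ↔ piV (projP (gradEl n + nilM b c) *ᵥ t) = 0 := by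
  constructor
  · intro h; rw [h]; rfl
  · intro h
    exact std_ext h (iR_projP b c t) (by rw [piH_projP, map_zero])

/-- The form `h` in the splitting given by a lift of the grading element. -/
lemma metricH_lift (hc : cᵀ = -c) (s t : Std n) :
    metricH s t = (1 / 2) * (piV (projP (gradEl n + nilM b c) *ᵥ s) ⬝ᵥ piH n t
      + piV (projP (gradEl n + nilM b c) *ᵥ t) ⬝ᵥ piH n s
      + (s iR - b ⬝ᵥ piH n s) * (t iR - b ⬝ᵥ piH n t)) := by
  have h : (c *ᵥ piH n t) ⬝ᵥ piH n s = -((c *ᵥ piH n s) ⬝ᵥ piH n t) := by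
    rw [dotProduct_comm, Matrix.dotProduct_mulVec, ← Matrix.mulVec_transpose, hc,
      Matrix.neg_mulVec, neg_dotProduct]
  rw [metricH_eq, piV_projP, piV_projP]
  simp only [add_dotProduct, sub_dotProduct, smul_dotProduct, smul_eq_mul, h]
  rw [dotProduct_comm (piH n s) (piV t)]
  ring

end lift

/-! ### Spaces of skew forms -/

lemma mem_perp {S : Set (Fin n → ℝ)} {α : Fin n → ℝ} : α ∈ perp S ↔ ∀ X ∈ S, α ⬝ᵥ X = 0 := Iff.rfl

lemma perp_empty : perp (∅ : Set (Fin n → ℝ)) = ⊤ := by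
  ext α; simp [mem_perp]

/-- The skew matrix `β αᵀ - α βᵀ`. -/
def wedge (α β : Fin n → ℝ) : Matrix (Fin n) (Fin n) ℝ :=
  Matrix.vecMulVec β α - Matrix.vecMulVec α β

lemma wedge_mulVec (α β x : Fin n → ℝ) :
    wedge α β *ᵥ x = (α ⬝ᵥ x) • β - (β ⬝ᵥ x) • α := by
  funext i
  simp [wedge, Matrix.sub_mulVec, Matrix.vecMulVec_mulVec, mul_comm]

lemma wedge_transpose (α β : Fin n → ℝ) : (wedge α β)ᵀ = -wedge α β := by
  simp [wedge, Matrix.transpose_sub, Matrix.transpose_vecMulVec]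

/-- The span of the skew matrices `α ∧ β`. -/
def wedgeSpan (S S' : Submodule ℝ (Fin n → ℝ)) : Submodule ℝ (Matrix (Fin n) (Fin n) ℝ) :=
  Submodule.span ℝ {w | ∃ α ∈ S, ∃ β ∈ S', w = wedge α β}

lemma exists_proj (A : Submodule ℝ (Fin n → ℝ)) :
    ∃ P : Matrix (Fin n) (Fin n) ℝ, (∀ x ∈ A, P *ᵥ x = x) ∧ ∀ x, P *ᵥ x ∈ A := by
  obtain ⟨g, hg⟩ := LinearMap.exists_leftInverse_of_injective A.subtype (Submodule.ker_subtype A)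
  refine ⟨LinearMap.toMatrix' (A.subtype ∘ₗ g), fun x hx => ?_, fun x => ?_⟩
  · rw [← Matrix.toLin'_apply, Matrix.toLin'_toMatrix', LinearMap.comp_apply]
    have := LinearMap.congr_fun hg ⟨x, hx⟩
    simpa using congrArg Subtype.val this
  · rw [← Matrix.toLin'_apply, Matrix.toLin'_toMatrix', LinearMap.comp_apply]
    exact (g x).2

lemma dotProduct_mulVec_transpose {m : ℕ} (c : Matrix (Fin n) (Fin m) ℝ) (x : Fin n → ℝ)
    (y : Fin m → ℝ) :
    x ⬝ᵥ (c *ᵥ y) = (cᵀ *ᵥ x) ⬝ᵥ y := by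
  rw [Matrix.dotProduct_mulVec, Matrix.mulVec_transpose]

lemma matrix_ext_mulVec {m k : Type*} [Fintype k] {a b : Matrix m k ℝ}
    (h : ∀ x, a *ᵥ x = b *ᵥ x) : a = b := by
  classical
  ext i j
  have := congrFun (h (Pi.single j 1)) i
  simpa using this

/-- This turns the span of brackets `{K^⊥, A^⊥}` into two testable conditions. The converse
decomposes `w` along a projection `P` to `A`: the block `Pᵀ w P` is zero by hypothesis, and every
other block has a factor `1 - P`, whose rows lie in `A^⊥`. -/
lemma mem_wedgeSpan_iff {A : Submodule ℝ (Fin n → ℝ)} {K : Set (Fin n → ℝ)} (hK : K ⊆ A)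
    {w : Matrix (Fin n) (Fin n) ℝ} (hw : wᵀ = -w) :
    w ∈ wedgeSpan (perp K) (perp (A : Set (Fin n → ℝ))) ↔
      (∀ x ∈ A, ∀ y ∈ A, (w *ᵥ x) ⬝ᵥ y = 0) ∧ ∀ x ∈ K, w *ᵥ x = 0 := by
  constructor
  · intro h
    clear hw
    induction h using Submodule.span_induction with
    | mem w h =>
      obtain ⟨α, hα, β, hβ, rfl⟩ := h
      refine ⟨fun x hx y hy => ?_, fun x hx => ?_⟩
      · rw [wedge_mulVec, sub_dotProduct, smul_dotProduct, smul_dotProduct, hβ x hx, hβ y hy]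
        simp
      · rw [wedge_mulVec, hα x hx, hβ x (hK hx)]
        simp
    | zero => simp
    | add v w _ _ hv hw =>
      refine ⟨fun x hx y hy => ?_, fun x hx => ?_⟩
      · rw [Matrix.add_mulVec, add_dotProduct, hv.1 x hx y hy, hw.1 x hx y hy, add_zero]
      · rw [Matrix.add_mulVec, hv.2 x hx, hw.2 x hx, add_zero]
    | smul r w _ hw =>
      refine ⟨fun x hx y hy => ?_, fun x hx => ?_⟩
      · rw [Matrix.smul_mulVec, smul_dotProduct, hw.1 x hx y hy, smul_zero]
      · rw [Matrix.smul_mulVec, hw.2 x hx, smul_zero]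
  · rintro ⟨h1, h2⟩
    obtain ⟨P, hP, hPA⟩ := exists_proj A
    have hQ : ∀ x ∈ A, (1 - P) *ᵥ x = 0 := fun x hx => by
      rw [Matrix.sub_mulVec, Matrix.one_mulVec, hP x hx, sub_self]
    -- The mixed blocks of `w` are negative transposes of each other, so one of them is enough. The
    -- block `(1 - P)ᵀ w (1 - P)` is its own negative transpose, hence the factor `1 / 2`.
    set F : Matrix (Fin n) (Fin n) ℝ := Pᵀ * w + (1 / 2 : ℝ) • ((1 - P)ᵀ * w) with hF
    have h3 : Pᵀ * w * P = 0 := by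
      refine matrix_ext_mulVec fun x => ?_
      rw [Matrix.zero_mulVec]
      refine dotProduct_eq_zero _ fun y => ?_
      rw [Matrix.mul_assoc, ← Matrix.mulVec_mulVec, ← Matrix.mulVec_mulVec, dotProduct_comm,
        dotProduct_mulVec_transpose, Matrix.transpose_transpose, dotProduct_comm]
      exact h1 _ (hPA x) _ (hPA y)
    have h4 : w = F * (1 - P) - (F * (1 - P))ᵀ := by
      rw [hF]
      simp only [Matrix.transpose_mul, Matrix.transpose_add, Matrix.transpose_smul,
        Matrix.transpose_sub, Matrix.transpose_one, Matrix.transpose_transpose, hw]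
      have h5 : w * P = w * P - Pᵀ * w * P := by rw [h3, sub_zero]
      have h6 : Pᵀ * (w * P) = 0 := by rw [← Matrix.mul_assoc, h3]
      simp only [mul_add, add_mul, mul_sub, sub_mul, mul_one, one_mul, smul_mul_assoc,
        mul_smul_comm, neg_mul, mul_neg, Matrix.mul_assoc, h6, smul_sub, smul_neg]
      module
    have h5 : F * (1 - P) - (F * (1 - P))ᵀ =
        ∑ i, wedge (F.col i) (-(1 - P).row i) := by
      ext j k
      simp only [Matrix.sub_apply, Matrix.mul_apply, Matrix.transpose_apply, Matrix.sum_apply,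
        wedge, Matrix.vecMulVec_apply, ← Finset.sum_sub_distrib]
      refine Finset.sum_congr rfl fun i _ => ?_
      simp only [Matrix.row, Matrix.col, Pi.neg_apply, Matrix.transpose_apply, Matrix.sub_apply]
      ring
    -- The columns of `F` annihilate `K`, since `w` kills `K` and `P` fixes it; the rows of `1 - P`
    -- annihilate `A`.
    rw [h4, h5]
    refine Submodule.sum_mem _ fun i _ => Submodule.subset_span ⟨_, ?_, _, ?_, rfl⟩
    · intro x hx
      have h6 : Fᵀ *ᵥ x = 0 := by
        have : Fᵀ = -(w * P) - (1 / 2 : ℝ) • (w * (1 - P)) := by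
          rw [hF, Matrix.transpose_add, Matrix.transpose_smul, Matrix.transpose_mul,
            Matrix.transpose_mul, hw]
          simp
          abel
        rw [this, Matrix.sub_mulVec, Matrix.neg_mulVec, Matrix.smul_mulVec,
          ← Matrix.mulVec_mulVec, ← Matrix.mulVec_mulVec, hP x (hK hx), hQ x (hK hx), h2 x hx]
        simp
      exact congrFun h6 i
    · refine (perp _).neg_mem fun x hx => ?_
      exact congrFun (hQ x hx) i

/-! ### Brackets in the positive part -/

lemma mat_ext_blocks {a b : Mat n}
    (h1 : ∀ i j, a (iV i) (iV j) = b (iV i) (iV j)) (h2 : ∀ i, a (iV i) iR = b (iV i) iR)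
    (h3 : ∀ i j, a (iV i) (iH j) = b (iV i) (iH j)) (h4 : ∀ j, a iR (iV j) = b iR (iV j))
    (h5 : a iR iR = b iR iR) (h6 : ∀ j, a iR (iH j) = b iR (iH j))
    (h7 : ∀ i j, a (iH i) (iV j) = b (iH i) (iV j)) (h8 : ∀ i, a (iH i) iR = b (iH i) iR)
    (h9 : ∀ i j, a (iH i) (iH j) = b (iH i) (iH j)) : a = b := by
  ext p q
  rcases p with i | _ | i <;> rcases q with j | _ | j
  exacts [h1 i j, h2 i, h3 i j, h4 j, h5, h6 j, h7 i j, h8 i, h9 i j]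

section mul_nilM

variable (b : Fin n → ℝ) (c : Matrix (Fin n) (Fin n) ℝ) (a : Mat n)

lemma nilM_mul_iV (i : Fin n) (y : Idx n) :
    (nilM b c * a) (iV i) y = b i * a iR y + ∑ j, c i j * a (iH j) y := by
  simp [Matrix.mul_apply, nilM]

lemma nilM_mul_iR (y : Idx n) : (nilM b c * a) iR y = -∑ j, b j * a (iH j) y := by
  simp [Matrix.mul_apply, nilM]

lemma nilM_mul_iH (i : Fin n) (y : Idx n) : (nilM b c * a) (iH i) y = 0 := by
  simp [Matrix.mul_apply, nilM]

lemma mul_nilM_iV (x : Idx n) (j : Fin n) : (a * nilM b c) x (iV j) = 0 := by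
  simp [Matrix.mul_apply, nilM]

lemma mul_nilM_iR (x : Idx n) : (a * nilM b c) x iR = ∑ i, a x (iV i) * b i := by
  simp [Matrix.mul_apply, nilM]

lemma mul_nilM_iH (x : Idx n) (j : Fin n) :
    (a * nilM b c) x (iH j) = ∑ i, a x (iV i) * c i j - a x iR * b j := by
  simp [Matrix.mul_apply, nilM]
  ring

lemma lieBr_lift_apply (x y : Idx n) :
    lieBr (gradEl n + nilM b c) a x y =
      (gradEl n x x - gradEl n y y) * a x y + ((nilM b c * a) x y - (a * nilM b c) x y) := by
  simp only [lieBr, add_mul, mul_add, Matrix.sub_apply, Matrix.add_apply]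
  have h1 : (gradEl n * a) x y = gradEl n x x * a x y := by
    simp [gradEl, Matrix.diagonal_mul]
  have h2 : (a * gradEl n) x y = a x y * gradEl n y y := by
    simp [gradEl, Matrix.mul_diagonal]
  rw [h1, h2]
  ring

end mul_nilM

lemma gradEl_iV (i : Fin n) : gradEl n (iV i) (iV i) = 1 := by simp [gradEl]
lemma gradEl_iR : gradEl n iR iR = 0 := by simp [gradEl]
lemma gradEl_iH (i : Fin n) : gradEl n (iH i) (iH i) = -1 := by simp [gradEl]

lemma gAlg_iR_iR {a : Mat n} (ha : a ∈ gAlg n) : a iR iR = 0 := by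
  have := mem_gAlg_iff.1 ha iR iR
  simp only [dualIdx_iR] at this
  linarith

lemma gAlg_iR_iH {a : Mat n} (ha : a ∈ gAlg n) (i : Fin n) : a iR (iH i) = -a (iV i) iR :=
  mem_gAlg_iff.1 ha (iH i) iR

lemma gAlg_iR_iV {a : Mat n} (ha : a ∈ gAlg n) (i : Fin n) : a iR (iV i) = -a (iH i) iR :=
  mem_gAlg_iff.1 ha (iV i) iR

lemma gAlg_iV_iV {a : Mat n} (ha : a ∈ gAlg n) (i j : Fin n) :
    a (iV i) (iV j) = -a (iH j) (iH i) :=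
  mem_gAlg_iff.1 ha (iV j) (iH i)

lemma wedge_apply (α β : Fin n → ℝ) (i j : Fin n) :
    wedge α β i j = β i * α j - α i * β j := by
  simp [wedge, Matrix.vecMulVec_apply]

/-- The eigenvalue equation is solved block by block, from the lowest degree up. The nonpositive
blocks vanish, the degree-one component `d` is free, and regrading by `b` forces the top component
`wedge d b`. -/
lemma mem_inP1_iff (b : Fin n → ℝ) (c : Matrix (Fin n) (Fin n) ℝ)
    (S : Submodule ℝ (Fin n → ℝ)) (a : Mat n) :
    a ∈ inP1 (gradEl n + nilM b c) S ↔ ∃ d ∈ S, a = nilM d (wedge d b) := by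
  constructor
  · rintro ⟨hg, h, hS⟩
    have e : ∀ x y, (gradEl n x x - gradEl n y y) * a x y
        + ((nilM b c * a) x y - (a * nilM b c) x y) = a x y := fun x y => by
      rw [← lieBr_lift_apply, h]
    have z : ∀ i j, a (iH i) (iV j) = 0 := fun i j => by
      have := e (iH i) (iV j)
      rw [gradEl_iH, gradEl_iV, nilM_mul_iH, mul_nilM_iV] at this
      linarith
    have x : ∀ i, a (iH i) iR = 0 := fun i => by
      have := e (iH i) iR
      rw [gradEl_iH, gradEl_iR, nilM_mul_iH, mul_nilM_iR] at this
      simp only [z, zero_mul, Finset.sum_const_zero] at this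
      linarith
    have k : ∀ i j, a (iH i) (iH j) = 0 := fun i j => by
      have := e (iH i) (iH j)
      rw [gradEl_iH, gradEl_iH, nilM_mul_iH, mul_nilM_iH] at this
      simp only [z, x, zero_mul, Finset.sum_const_zero] at this
      linarith
    refine ⟨blk1 a, hS, ?_⟩
    ext p q
    rcases p with i | _ | i <;> rcases q with j | _ | j
    · rw [gAlg_iV_iV hg, k]; simp [nilM]
    · rfl
    · have := e (iV i) (iH j)
      rw [gradEl_iH, gradEl_iV, nilM_mul_iV, mul_nilM_iH] at this
      simp only [gAlg_iV_iV hg, k, gAlg_iR_iH hg, mul_zero, neg_zero, zero_mul,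
        Finset.sum_const_zero] at this
      simp only [nilM, Matrix.of_apply, wedge_apply, blk1]
      linarith
    · rw [gAlg_iR_iV hg, x]; simp [nilM]
    · rw [gAlg_iR_iR hg]; simp [nilM]
    · rw [gAlg_iR_iH hg]; simp [nilM, blk1]
    · rw [z]; simp [nilM]
    · rw [x]; simp [nilM]
    · rw [k]; simp [nilM]
  · rintro ⟨d, hd, rfl⟩
    refine ⟨nilM_mem_gAlg _ (wedge_transpose _ _), ?_, hd⟩
    apply mat_ext_blocks <;> intros <;> rw [lieBr_lift_apply] <;>
      simp only [mul_nilM_iV, mul_nilM_iR, mul_nilM_iH, gradEl_iV, gradEl_iR, gradEl_iH] <;>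
      simp [nilM, wedge_apply]
    ring

lemma lieBr_nilM (a b : Fin n → ℝ) (c d : Matrix (Fin n) (Fin n) ℝ) :
    lieBr (nilM a c) (nilM b d) = nilM 0 (wedge a b) := by
  apply mat_ext_blocks <;> intros <;> rw [lieBr, Matrix.sub_apply] <;>
    simp only [nilM_mul_iV, nilM_mul_iR, nilM_mul_iH] <;> simp [nilM, wedge_apply]
  ring

/-- The embedding of skew matrices as top degree elements. -/
def nilTop (n : ℕ) : Matrix (Fin n) (Fin n) ℝ →ₗ[ℝ] Mat n where
  toFun := nilM 0
  map_add' := fun c d => by rw [nilM_add, add_zero]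
  map_smul' := fun r c => by rw [RingHom.id_apply, nilM_smul, smul_zero]

lemma brk_inP1 (b : Fin n → ℝ) (c : Matrix (Fin n) (Fin n) ℝ)
    (S S' : Submodule ℝ (Fin n → ℝ)) :
    brk (inP1 (gradEl n + nilM b c) S) (inP1 (gradEl n + nilM b c) S') =
      (wedgeSpan S S').map (nilTop n) := by
  rw [wedgeSpan, Submodule.map_span, brk]
  congr 1
  ext x
  simp only [Set.mem_ofPred_eq, mem_inP1_iff, Set.mem_image]
  constructor
  · rintro ⟨_, ⟨d, hd, rfl⟩, _, ⟨d', hd', rfl⟩, rfl⟩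
    exact ⟨_, ⟨d, hd, d', hd', rfl⟩, (lieBr_nilM _ _ _ _).symm⟩
  · rintro ⟨_, ⟨d, hd, d', hd', rfl⟩, rfl⟩
    exact ⟨_, ⟨d, hd, rfl⟩, _, ⟨d', hd', rfl⟩, (lieBr_nilM _ _ _ _).symm⟩

lemma brk_comm (S S' : Submodule ℝ (Mat n)) : brk S S' = brk S' S := by
  have h : ∀ S S' : Submodule ℝ (Mat n), brk S S' ≤ brk S' S := by
    intro S S'
    refine Submodule.span_le.2 ?_
    rintro _ ⟨a, ha, b, hb, rfl⟩
    have : lieBr a b = -lieBr b a := by simp [lieBr]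
    rw [SetLike.mem_coe, this]
    exact Submodule.neg_mem _ (Submodule.subset_span ⟨b, hb, a, ha, rfl⟩)
  exact le_antisymm (h _ _) (h _ _)

lemma nilM_mem_brk_iff (b : Fin n → ℝ) (c : Matrix (Fin n) (Fin n) ℝ)
    {A : Submodule ℝ (Fin n → ℝ)} {K : Set (Fin n → ℝ)} (hK : K ⊆ A)
    {w : Matrix (Fin n) (Fin n) ℝ} (hw : wᵀ = -w) :
    nilM 0 w ∈ brk (inP1 (gradEl n + nilM b c) (perp K))
        (inP1 (gradEl n + nilM b c) (perp (A : Set (Fin n → ℝ)))) ↔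
      (∀ x ∈ A, ∀ y ∈ A, (w *ᵥ x) ⬝ᵥ y = 0) ∧ ∀ x ∈ K, w *ᵥ x = 0 := by
  rw [brk_inP1, ← mem_wedgeSpan_iff hK hw, Submodule.mem_map]
  constructor
  · rintro ⟨w', h, h'⟩
    rwa [← (nilM_injective h').2]
  · exact fun h => ⟨w, h, rfl⟩

/-- The component `d` determines the degree-one summand as `nilM d (wedge d b)`; what remains, `e -
wedge d b`, must come from the brackets. -/
lemma nilM_mem_sup_iff (b : Fin n → ℝ) (c : Matrix (Fin n) (Fin n) ℝ)
    {A : Submodule ℝ (Fin n → ℝ)} {K : Set (Fin n → ℝ)} (hK : K ⊆ A)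
    (d : Fin n → ℝ) {e : Matrix (Fin n) (Fin n) ℝ} (he : eᵀ = -e) :
    nilM d e ∈ inP1 (gradEl n + nilM b c) (perp (A : Set (Fin n → ℝ))) ⊔
        brk (inP1 (gradEl n + nilM b c) (perp K))
          (inP1 (gradEl n + nilM b c) (perp (A : Set (Fin n → ℝ)))) ↔
      d ∈ perp (A : Set (Fin n → ℝ)) ∧
      (∀ x ∈ A, ∀ y ∈ A, ((e - wedge d b) *ᵥ x) ⬝ᵥ y = 0) ∧
        ∀ x ∈ K, (e - wedge d b) *ᵥ x = 0 := by
  have hs : (e - wedge d b)ᵀ = -(e - wedge d b) := by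
    rw [Matrix.transpose_sub, he, wedge_transpose]; abel
  rw [← nilM_mem_brk_iff b c hK hs, Submodule.mem_sup]
  constructor
  · rintro ⟨p, hp, q, hq, h⟩
    obtain ⟨d', hd', rfl⟩ := (mem_inP1_iff b c _ p).1 hp
    have hq' := hq
    rw [brk_inP1, Submodule.mem_map] at hq'
    obtain ⟨w, -, rfl⟩ := hq'
    have h' : nilM (d' + 0) (wedge d' b + w) = nilM d e := by rw [← nilM_add]; exact h
    obtain ⟨h1, h2⟩ := nilM_injective h'
    rw [add_zero] at h1
    subst h1
    refine ⟨hd', ?_⟩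
    rw [← h2, add_sub_cancel_left]
    exact hq
  · rintro ⟨h1, h2⟩
    exact ⟨_, (mem_inP1_iff b c _ _).2 ⟨d, h1, rfl⟩, _, h2, by rw [nilM_add]; simp⟩

/-- Needed for the direction from model sections to Weyl structures: adding such a section to a lift
of the grading element gives a lift again. -/
lemma model_le_nilAlg {E : Mat n} (hE : E - gradEl n ∈ nilAlg n)
    (S S' : Submodule ℝ (Fin n → ℝ)) :
    inP1 E S ⊔ brk (inP1 E S') (inP1 E S) ≤ nilAlg n := by
  obtain ⟨b, c, -, rfl⟩ := exists_eq_of_lift hE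
  have h : ∀ (S : Submodule ℝ (Fin n → ℝ)), ∀ a ∈ inP1 (gradEl n + nilM b c) S,
      ∃ d, a = nilM d (wedge d b) := fun S a ha => by
    obtain ⟨d, -, rfl⟩ := (mem_inP1_iff b c _ _).1 ha
    exact ⟨d, rfl⟩
  refine sup_le (fun a ha => ?_) (Submodule.span_le.2 ?_)
  · obtain ⟨d, rfl⟩ := h S a ha
    exact mem_nilAlg_iff.2 ⟨d, _, wedge_transpose _ _, rfl⟩
  · rintro _ ⟨p, hp, q, hq, rfl⟩
    obtain ⟨d, rfl⟩ := h S' p hp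
    obtain ⟨d', rfl⟩ := h S q hq
    rw [lieBr_nilM]
    exact mem_nilAlg_iff.2 ⟨0, _, wedge_transpose _ _, rfl⟩

/-! ### Brackets in the negative part -/

lemma nilM_mul_nilM (b d : Fin n → ℝ) (c e : Matrix (Fin n) (Fin n) ℝ) :
    nilM b c * nilM d e = nilM 0 (-Matrix.vecMulVec b d) := by
  apply mat_ext_blocks <;> intros <;>
    simp only [nilM_mul_iV, nilM_mul_iR, nilM_mul_iH] <;> simp [nilM, Matrix.vecMulVec_apply]

lemma gradEl_mul_nilM (b : Fin n → ℝ) (c : Matrix (Fin n) (Fin n) ℝ) :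
    gradEl n * nilM b c = nilM b c * gradEl n + nilM b ((2 : ℝ) • c) := by
  ext x y
  simp only [gradEl, Matrix.add_apply, Matrix.diagonal_mul, Matrix.mul_diagonal]
  rcases x with i | _ | i <;> rcases y with j | _ | j <;> simp [nilM]
  ring

/-- The element of `𝔤_{-1}` with component `x`. -/
def negOne (x : Fin n → ℝ) : Mat n :=
  Matrix.of fun p q => match p, q with
    | Sum.inr (Sum.inl _), Sum.inl j => -x j
    | Sum.inr (Sum.inr i), Sum.inr (Sum.inl _) => x i
    | _, _ => 0

lemma negOne_mem_gAlg (x : Fin n → ℝ) : negOne x ∈ gAlg n := by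
  rw [mem_gAlg_iff]
  intro p q
  rcases p with i | _ | i <;> rcases q with j | _ | j <;> simp [negOne, dualIdx]

lemma gradEl_mul_negOne (x : Fin n → ℝ) :
    gradEl n * negOne x = negOne x * gradEl n - negOne x := by
  ext p q
  simp only [gradEl, Matrix.sub_apply, Matrix.diagonal_mul, Matrix.mul_diagonal]
  rcases p with i | _ | i <;> rcases q with j | _ | j <;> simp [negOne]

lemma lieBr_mem_gAlg {a b : Mat n} (ha : a ∈ gAlg n) (hb : b ∈ gAlg n) :
    lieBr a b ∈ gAlg n := by
  rw [mem_gAlg_iff'] at *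
  rw [lieBr, Matrix.transpose_sub, Matrix.transpose_mul, Matrix.transpose_mul, sub_mul,
    Matrix.mul_assoc, ha, Matrix.mul_assoc, hb, mul_neg, mul_neg, ← Matrix.mul_assoc, hb,
    ← Matrix.mul_assoc, ha, mul_sub, ← Matrix.mul_assoc, ← Matrix.mul_assoc]
  simp only [neg_mul, neg_neg]
  abel

/-- The lift `E` is conjugate to `gradEl` by a unipotent orthogonal matrix, and conjugating the
standard element `negOne x` adds only components of higher degree, so its `𝔤_{-1}` component is
still `x`. -/
lemma exists_mem_inM1 (b : Fin n → ℝ) {c : Matrix (Fin n) (Fin n) ℝ} (hc : cᵀ = -c)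
    (S : Submodule ℝ (Fin n → ℝ)) {x : Fin n → ℝ} (hx : x ∈ S) :
    ∃ a ∈ inM1 (gradEl n + nilM b c) S, blkM1 a = x := by
  -- The commutator with `gradEl` doubles the top component, so halving `c` makes `[gradEl, N] =
  -- nilM b c`. As `N³ = 0`, the matrices `q` and `q'` are `exp N` and `exp (-N)`, and `q' gradEl q
  -- = gradEl + nilM b c`.
  set N : Mat n := nilM b ((1 / 2 : ℝ) • c) with hN
  set q : Mat n := 1 + N + (1 / 2 : ℝ) • (N * N) with hq
  set q' : Mat n := 1 - N + (1 / 2 : ℝ) • (N * N) with hq'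
  have hNN : N * N = nilM 0 (-Matrix.vecMulVec b b) := nilM_mul_nilM _ _ _ _
  have h3 : N * N * N = 0 := by
    rw [hNN, hN, nilM_mul_nilM]
    ext p r
    rcases p with i | _ | i <;> rcases r with j | _ | j <;> simp [nilM]
  have h3' : N * (N * N) = 0 := by rw [← Matrix.mul_assoc, h3]
  have h4 : N * N * (N * N) = 0 := by rw [← Matrix.mul_assoc, h3, Matrix.zero_mul]
  have hqq : q * q' = 1 := by
    simp only [hq, hq', add_mul, mul_add, mul_sub, one_mul, mul_one, smul_mul_assoc,
      mul_smul_comm, h3, h3', h4, smul_zero]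
    module
  have hqN : q * nilM b c = nilM b c + N * N := by
    have e1 : N * nilM b c = N * N := by rw [hNN, hN, nilM_mul_nilM]
    have e2 : N * N * nilM b c = 0 := by rw [Matrix.mul_assoc, e1, h3']
    simp only [hq, add_mul, one_mul, e1, smul_mul_assoc, e2, smul_zero, add_zero]
  have hgq : gradEl n * q = q * (gradEl n + nilM b c) := by
    have e1 : gradEl n * N = N * gradEl n + nilM b c := by
      rw [hN, gradEl_mul_nilM]; simp
    have e2 : gradEl n * (N * N) = N * N * gradEl n + (2 : ℝ) • (N * N) := by
      rw [hNN, gradEl_mul_nilM, nilM_smul, smul_zero]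
    rw [mul_add q, hqN]
    simp only [hq, add_mul, mul_add, one_mul, mul_one, smul_mul_assoc, mul_smul_comm, e1, e2]
    module
  have hqq' : q' * q = 1 := mul_eq_one_comm.1 hqq
  have hgq' : q' * gradEl n = (gradEl n + nilM b c) * q' := by
    calc q' * gradEl n = q' * (gradEl n * q) * q' := by
          rw [Matrix.mul_assoc, Matrix.mul_assoc, hqq, Matrix.mul_one]
      _ = (gradEl n + nilM b c) * q' := by
          rw [hgq, ← Matrix.mul_assoc, hqq', Matrix.one_mul]
  have hT : qᵀ * gramJ n = gramJ n * q' := by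
    have hNg := mem_gAlg_iff'.1 (nilM_mem_gAlg b (c := (1 / 2 : ℝ) • c) (by
      rw [Matrix.transpose_smul, hc, smul_neg]))
    rw [← hN] at hNg
    simp only [hq, hq', Matrix.transpose_add, Matrix.transpose_one, Matrix.transpose_smul,
      Matrix.transpose_mul, add_mul, mul_add, mul_sub, one_mul, mul_one, smul_mul_assoc,
      mul_smul_comm, Matrix.mul_assoc, hNg, mul_neg]
    rw [← Matrix.mul_assoc Nᵀ, hNg, neg_mul, neg_neg, Matrix.mul_assoc]
    abel
  have hT' : q'ᵀ * gramJ n = gramJ n * q := by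
    calc q'ᵀ * gramJ n = q'ᵀ * (gramJ n * q') * q := by
          rw [Matrix.mul_assoc, Matrix.mul_assoc, hqq', Matrix.mul_one]
      _ = gramJ n * q := by
          rw [← hT, ← Matrix.mul_assoc, ← Matrix.transpose_mul, hqq, Matrix.transpose_one,
            Matrix.one_mul]
  have hz : blkM1 (q' * negOne x * q) = x := by
    funext i
    have e1 : ∀ y, (q' * negOne x) (iH i) y = negOne x (iH i) y := fun y => by
      rw [hq', hNN, add_mul, sub_mul, one_mul, smul_mul_assoc, Matrix.add_apply,
        Matrix.sub_apply, Matrix.smul_apply, nilM_mul_iH, nilM_mul_iH]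
      simp
    have e2 : (q' * negOne x * q) (iH i) iR = (negOne x * q) (iH i) iR := by
      rw [Matrix.mul_apply, Matrix.mul_apply]
      exact Finset.sum_congr rfl fun y _ => by rw [e1]
    change (q' * negOne x * q) (iH i) iR = x i
    rw [e2, hq, hNN, hN, mul_add, mul_add, mul_one, mul_smul_comm, Matrix.add_apply,
      Matrix.add_apply, Matrix.smul_apply, mul_nilM_iR, mul_nilM_iR]
    simp [negOne]
  refine ⟨q' * negOne x * q, ⟨?_, ?_, ?_⟩, hz⟩
  · have hx := mem_gAlg_iff'.1 (negOne_mem_gAlg x)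
    rw [mem_gAlg_iff', Matrix.transpose_mul, Matrix.transpose_mul, Matrix.mul_assoc,
      Matrix.mul_assoc, hT', ← Matrix.mul_assoc (negOne x)ᵀ, hx, neg_mul, mul_neg,
      Matrix.mul_assoc, ← Matrix.mul_assoc, hT]
    simp only [Matrix.mul_assoc]
  · rw [lieBr, ← Matrix.mul_assoc, ← Matrix.mul_assoc, ← hgq', Matrix.mul_assoc _ q, ← hgq,
      Matrix.mul_assoc q', gradEl_mul_negOne, mul_sub, sub_mul]
    simp only [Matrix.mul_assoc]
    abel
  · rw [hz]; exact hx

lemma inM1_blocks {b : Fin n → ℝ} {c : Matrix (Fin n) (Fin n) ℝ}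
    {S : Submodule ℝ (Fin n → ℝ)} {a : Mat n} (ha : a ∈ inM1 (gradEl n + nilM b c) S) :
    (∀ i j, a (iH i) (iV j) = 0) ∧ ∀ i j, a (iH i) (iH j) = -(blkM1 a i * b j) := by
  obtain ⟨-, h, -⟩ := ha
  have e : ∀ x y, (gradEl n x x - gradEl n y y) * a x y
      + ((nilM b c * a) x y - (a * nilM b c) x y) = -a x y := fun x y => by
    rw [← lieBr_lift_apply, h, Matrix.neg_apply]
  have z : ∀ i j, a (iH i) (iV j) = 0 := fun i j => by
    have := e (iH i) (iV j)
    rw [gradEl_iH, gradEl_iV, nilM_mul_iH, mul_nilM_iV] at this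
    linarith
  refine ⟨z, fun i j => ?_⟩
  have := e (iH i) (iH j)
  rw [gradEl_iH, gradEl_iH, nilM_mul_iH, mul_nilM_iH] at this
  simp only [z, zero_mul, Finset.sum_const_zero] at this
  simp only [blkM1]
  linarith

/-- Modulo `𝔭` the bracket depends on the lift only through the values of `b` on the two components;
this is what makes `B` independent of the choice. -/
lemma lieBr_inM1 {b : Fin n → ℝ} {c : Matrix (Fin n) (Fin n) ℝ}
    {S : Submodule ℝ (Fin n → ℝ)} {a a' : Mat n} (ha : a ∈ inM1 (gradEl n + nilM b c) S)
    (ha' : a' ∈ inM1 (gradEl n + nilM b c) S) :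
    blkM1 (lieBr a a') = (b ⬝ᵥ blkM1 a) • blkM1 a' - (b ⬝ᵥ blkM1 a') • blkM1 a ∧
      blkM2 (lieBr a a') = wedge (blkM1 a) (blkM1 a') := by
  obtain ⟨z, k⟩ := inM1_blocks ha
  obtain ⟨z', k'⟩ := inM1_blocks ha'
  have r := gAlg_iR_iV ha.1
  have r' := gAlg_iR_iV ha'.1
  constructor
  · funext i
    simp only [blkM1] at k k' ⊢
    simp only [lieBr, Matrix.sub_apply, Matrix.mul_apply, Fintype.sum_sum_type, z, z', k, k',
      gAlg_iR_iR ha.1, gAlg_iR_iR ha'.1, zero_mul, mul_zero, Finset.sum_const_zero, zero_add,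
      dotProduct, Pi.sub_apply, Pi.smul_apply, smul_eq_mul, neg_mul,
      Finset.sum_neg_distrib, mul_assoc, ← Finset.mul_sum, blkM1]
    ring
  · ext i j
    simp only [blkM1] at k k' ⊢
    simp only [blkM2, Matrix.of_apply, lieBr, Matrix.sub_apply, Matrix.mul_apply,
      Fintype.sum_sum_type, z, z', r, r', zero_mul, mul_zero, Finset.sum_const_zero, zero_add,
      wedge_apply, Finset.univ_unique, Finset.sum_singleton, blkM1]
    simp
    ring

lemma mem_pAlg_of_blocks {a : Mat n} (ha : a ∈ gAlg n) (h1 : blkM1 a = 0) (h2 : blkM2 a = 0) :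
    a ∈ pAlg n := by
  refine ⟨ha, fun x j => ?_⟩
  rcases x with _ | i
  · exact (gAlg_iR_iV ha j).trans (by rw [show a (iH j) iR = 0 from congrFun h1 j, neg_zero])
  · exact congrFun (congrFun h2 i) j

/-- Each bracket is replaced by the bracket of the elements with the same components in the other
grading. The difference has no `𝔤_{-1}` or `𝔤_{-2}` block, hence lies in `𝔭`. -/
lemma brk_inM1_le {b b' : Fin n → ℝ} {c c' : Matrix (Fin n) (Fin n) ℝ} (hc' : c'ᵀ = -c')
    {A : Submodule ℝ (Fin n → ℝ)} (hb : ∀ x ∈ A, b ⬝ᵥ x = b' ⬝ᵥ x) :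
    brk (inM1 (gradEl n + nilM b c) A) (inM1 (gradEl n + nilM b c) A) ≤
      brk (inM1 (gradEl n + nilM b' c') A) (inM1 (gradEl n + nilM b' c') A) ⊔ pAlg n := by
  refine Submodule.span_le.2 ?_
  rintro _ ⟨p, hp, q, hq, rfl⟩
  obtain ⟨p', hp', hpp⟩ := exists_mem_inM1 b' hc' A hp.2.2
  obtain ⟨q', hq', hqq⟩ := exists_mem_inM1 b' hc' A hq.2.2
  obtain ⟨h1, h2⟩ := lieBr_inM1 hp hq
  obtain ⟨h1', h2'⟩ := lieBr_inM1 hp' hq'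
  rw [hpp, hqq] at h1' h2'
  rw [hb _ hp.2.2, hb _ hq.2.2] at h1
  refine Submodule.mem_sup.2 ⟨lieBr p' q', Submodule.subset_span ⟨p', hp', q', hq', rfl⟩,
    lieBr p q - lieBr p' q', mem_pAlg_of_blocks ?_ ?_ ?_, by abel⟩
  · exact (gAlg n).sub_mem (lieBr_mem_gAlg hp.1 hq.1) (lieBr_mem_gAlg hp'.1 hq'.1)
  · exact (sub_eq_zero.2 (h1.trans h1'.symm) :)
  · exact (sub_eq_zero.2 (h2.trans h2'.symm) :)

/-- Only the bracket summands of `C` contribute to `Z_{-2}`: the eigenspace identified with `H` and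
the subalgebra `𝔭` both have zero `𝔤_{-2}` block. -/
lemma blkM2_sup {b : Fin n → ℝ} {c : Matrix (Fin n) (Fin n) ℝ}
    {S S' : Submodule ℝ (Fin n → ℝ)} {a : Mat n}
    (ha : a ∈ inM1 (gradEl n + nilM b c) ⊤ ⊔ (brk (inM1 (gradEl n + nilM b c) S)
      (inM1 (gradEl n + nilM b c) S) ⊔ pAlg n) ⊔ brk (inM1 (gradEl n + nilM b c) S')
      (inM1 (gradEl n + nilM b c) S') ⊔ pAlg n) :
    blkM2 a ∈ wedgeSpan S S ⊔ wedgeSpan S' S' := by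
  let φ : Mat n →ₗ[ℝ] Matrix (Fin n) (Fin n) ℝ :=
    { toFun := blkM2, map_add' := fun _ _ => rfl, map_smul' := fun _ _ => rfl }
  have hbrk : ∀ S : Submodule ℝ (Fin n → ℝ), brk (inM1 (gradEl n + nilM b c) S)
      (inM1 (gradEl n + nilM b c) S) ≤ (wedgeSpan S S).comap φ := by
    intro S
    refine Submodule.span_le.2 ?_
    rintro _ ⟨p, hp, q, hq, rfl⟩
    refine Submodule.subset_span ⟨_, hp.2.2, _, hq.2.2, (lieBr_inM1 hp hq).2⟩
  have hp : pAlg n ≤ (wedgeSpan S S ⊔ wedgeSpan S' S').comap φ := by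
    intro p hp
    have : φ p = 0 := by
      ext i j
      exact hp.2 (Sum.inr i) j
    rw [Submodule.mem_comap, this]
    exact Submodule.zero_mem _
  have h1 : inM1 (gradEl n + nilM b c) ⊤ ≤ (wedgeSpan S S ⊔ wedgeSpan S' S').comap φ := by
    intro p hp
    have : φ p = 0 := by
      ext i j
      exact (inM1_blocks hp).1 i j
    rw [Submodule.mem_comap, this]
    exact Submodule.zero_mem _
  have hS := (hbrk S).trans (Submodule.comap_mono (f := φ) (le_sup_left (b := wedgeSpan S' S')))
  have hS' := (hbrk S').trans (Submodule.comap_mono (f := φ) (le_sup_right (a := wedgeSpan S S)))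
  exact sup_le (sup_le (sup_le h1 (sup_le hS hp)) hS') hp ha

/-! ### Preferred lifts of the grading element at a point -/

/-- The fibrewise condition on a preferred connection. -/
def IsPrefAt (L : Submodule ℝ (Std n)) (E : Mat n) : Prop :=
  ∀ t ∈ L, ∀ s ∈ L, 2 * metricH (projP E *ᵥ t) s = metricH t s

/-- The radical of the restriction of the metric to `L`. -/
def radical (L : Submodule ℝ (Std n)) : Set (Std n) := {t | t ∈ L ∧ ∀ s ∈ L, metricH t s = 0}

/-- The fibrewise condition on a strongly preferred connection. -/
def IsStrongAt (L : Submodule ℝ (Std n)) (E : Mat n) : Prop :=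
  IsPrefAt L E ∧ ∀ t ∈ radical L, projP E *ᵥ t = 0

variable {L : Submodule ℝ (Std n)}

/-- In the preferred condition with both arguments equal, the two sides differ by half the square of
the middle component in the splitting of `E`, so that component is zero. -/
lemma IsPrefAt.iR_eq {b : Fin n → ℝ} {c : Matrix (Fin n) (Fin n) ℝ} (hc : cᵀ = -c)
    (h : IsPrefAt L (gradEl n + nilM b c)) {t : Std n} (ht : t ∈ L) : t iR = b ⬝ᵥ piH n t := by
  have h1 := h t ht t ht
  rw [metricH_lift b c hc t t, metricH_projP] at h1
  have h2 : (t iR - b ⬝ᵥ piH n t) * (t iR - b ⬝ᵥ piH n t) = 0 := by linarith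
  exact sub_eq_zero.1 (mul_self_eq_zero.1 h2)

/-- On vectors with vanishing middle component, a change of lift with `d ∈ A^⊥` alters `μ` only
through its degree-two part, taken with respect to the old grading. -/
lemma piV_projP_add (b d : Fin n → ℝ) (c e : Matrix (Fin n) (Fin n) ℝ) {t : Std n}
    (ht : t iR = b ⬝ᵥ piH n t) (hd : d ⬝ᵥ piH n t = 0) :
    piV (projP (gradEl n + nilM (b + d) (c + e)) *ᵥ t) =
      piV (projP (gradEl n + nilM b c) *ᵥ t) + (1 / 2 : ℝ) • ((e - wedge d b) *ᵥ piH n t) := by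
  rw [piV_projP, piV_projP, Matrix.add_mulVec, Matrix.sub_mulVec, wedge_mulVec, add_dotProduct, hd,
    ht]
  module

/-- Both lifts being preferred forces `b` and `b + d` to agree on `A`. Once `d ∈ A^⊥`, the two
preferred conditions differ by the form `e - wedge d b` on `A × A`. -/
lemma isPrefAt_add_iff {b d : Fin n → ℝ} {c e : Matrix (Fin n) (Fin n) ℝ} (hc : cᵀ = -c)
    (he : eᵀ = -e) (h : IsPrefAt L (gradEl n + nilM b c)) :
    IsPrefAt L (gradEl n + nilM (b + d) (c + e)) ↔ d ∈ perp (L.map (piH n) : Set (Fin n → ℝ)) ∧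
      ∀ x ∈ L.map (piH n), ∀ y ∈ L.map (piH n), ((e - wedge d b) *ᵥ x) ⬝ᵥ y = 0 := by
  have hce : (c + e)ᵀ = -(c + e) := by rw [Matrix.transpose_add, hc, he]; abel
  have key : d ∈ perp (L.map (piH n) : Set (Fin n → ℝ)) → ∀ t ∈ L, ∀ s ∈ L,
      2 * metricH (projP (gradEl n + nilM (b + d) (c + e)) *ᵥ t) s =
      metricH t s + (1 / 2) * (((e - wedge d b) *ᵥ piH n t) ⬝ᵥ piH n s) := by
    intro hd t ht s hs
    have h1 := h t ht s hs
    rw [metricH_projP] at h1 ⊢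
    rw [piV_projP_add b d c e (h.iR_eq hc ht) (hd _ ⟨t, ht, rfl⟩), add_dotProduct, smul_dotProduct,
      smul_eq_mul, ← h1]
    ring
  constructor
  · intro h'
    have hd : d ∈ perp (L.map (piH n) : Set (Fin n → ℝ)) := by
      rintro _ ⟨t, ht, rfl⟩
      have h1 := h.iR_eq hc ht
      have h2 := h'.iR_eq hce ht
      rw [add_dotProduct] at h2
      linarith
    refine ⟨hd, ?_⟩
    rintro _ ⟨t, ht, rfl⟩ _ ⟨s, hs, rfl⟩
    have := key hd t ht s hs
    rw [h' t ht s hs] at this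
    linarith
  · rintro ⟨hd, h'⟩ t ht s hs
    rw [key hd t ht s hs, h' _ ⟨t, ht, rfl⟩ _ ⟨s, hs, rfl⟩]
    ring

/-- On the radical the old `H*` component is zero, so the new one is half of `(e - wedge d b) X`. -/
lemma isStrongAt_add_iff {b d : Fin n → ℝ} {c e : Matrix (Fin n) (Fin n) ℝ} (hc : cᵀ = -c)
    (he : eᵀ = -e) (h : IsStrongAt L (gradEl n + nilM b c)) :
    IsStrongAt L (gradEl n + nilM (b + d) (c + e)) ↔
      d ∈ perp (L.map (piH n) : Set (Fin n → ℝ)) ∧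
      (∀ x ∈ L.map (piH n), ∀ y ∈ L.map (piH n), ((e - wedge d b) *ᵥ x) ⬝ᵥ y = 0) ∧
      ∀ x ∈ piH n '' radical L, (e - wedge d b) *ᵥ x = 0 := by
  rw [IsStrongAt, isPrefAt_add_iff hc he h.1, and_assoc]
  refine and_congr_right fun hd => and_congr_right fun _ => ?_
  rw [Set.forall_mem_image]
  refine forall₂_congr fun t ht => ?_
  rw [projP_eq_zero_iff, piV_projP_add b d c e (h.1.iR_eq hc ht.1) (hd _ ⟨t, ht.1, rfl⟩),
    (projP_eq_zero_iff b c t).1 (h.2 t ht), zero_add, smul_eq_zero]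
  norm_num

lemma image_radical_subset (L : Submodule ℝ (Std n)) :
    piH n '' radical L ⊆ (L.map (piH n) : Set (Fin n → ℝ)) := by
  rintro _ ⟨t, ht, rfl⟩
  exact ⟨t, ht.1, rfl⟩

/-- The space that models the preferred or strongly preferred lifts. -/
def model (E : Mat n) (A K : Set (Fin n → ℝ)) : Submodule ℝ (Mat n) :=
  inP1 E (perp A) ⊔ brk (inP1 E (perp K)) (inP1 E (perp A))

lemma exists_sub_eq {E E' : Mat n} (hE : E - gradEl n ∈ nilAlg n) (hE' : E' - gradEl n ∈ nilAlg n) :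
    ∃ b c d e, cᵀ = -c ∧ eᵀ = -e ∧ E = gradEl n + nilM b c ∧
      E' = gradEl n + nilM (b + d) (c + e) ∧ E' - E = nilM d e := by
  obtain ⟨b, c, hc, h⟩ := exists_eq_of_lift hE
  have h1 := (nilAlg n).sub_mem hE' hE
  rw [sub_sub_sub_cancel_right] at h1
  obtain ⟨d, e, he, h'⟩ := mem_nilAlg_iff.1 h1
  refine ⟨b, c, d, e, hc, he, h, ?_, h'⟩
  rw [← nilM_add, ← h', ← add_assoc, ← h]
  abel

lemma isPrefAt_iff_sub_mem {E E' : Mat n} (hE : E - gradEl n ∈ nilAlg n)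
    (hE' : E' - gradEl n ∈ nilAlg n) (h : IsPrefAt L E) :
    IsPrefAt L E' ↔ E' - E ∈ model E (L.map (piH n)) ∅ := by
  obtain ⟨b, c, d, e, hc, he, rfl, rfl, h'⟩ := exists_sub_eq hE hE'
  rw [h', model, nilM_mem_sup_iff b c (Set.empty_subset _) d he, isPrefAt_add_iff hc he h]
  simp

lemma isStrongAt_iff_sub_mem {E E' : Mat n} (hE : E - gradEl n ∈ nilAlg n)
    (hE' : E' - gradEl n ∈ nilAlg n) (h : IsStrongAt L E) :
    IsStrongAt L E' ↔ E' - E ∈ model E (L.map (piH n)) (piH n '' radical L) := by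
  obtain ⟨b, c, d, e, hc, he, rfl, rfl, h'⟩ := exists_sub_eq hE hE'
  rw [h', model, nilM_mem_sup_iff b c (image_radical_subset L) d he, isStrongAt_add_iff hc he h]

/-! ### The bridge to the definitions in terms of `A = π²(V)` -/

section bridge

variable {Q : Type*} {V : Q → Submodule ℝ (Std n)} {η : Q → Mat n} {u : Q}

lemma liftA_piH (hi : Set.InjOn (piH n) (V u : Set (Std n))) {t : Std n} (ht : t ∈ V u) :
    liftA V u (piH n t) = t :=
  hi.leftInvOn_invFunOn ht

lemma liftA_mem {X : Fin n → ℝ} (hX : X ∈ subA V u) :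
    liftA V u X ∈ V u ∧ piH n (liftA V u X) = X :=
  ⟨Function.invFunOn_mem hX, Function.invFunOn_eq hX⟩

lemma mem_isoA_iff (hi : Set.InjOn (piH n) (V u : Set (Std n))) :
    isoA V u = piH n '' radical (V u) := by
  ext X
  constructor
  · rintro ⟨⟨t, ht, rfl⟩, h⟩
    refine ⟨t, ⟨ht, fun s hs => ?_⟩, rfl⟩
    have := h _ ⟨s, hs, rfl⟩
    rwa [metricG, liftA_piH hi ht, liftA_piH hi hs] at this
  · rintro ⟨t, ht, rfl⟩
    refine ⟨⟨t, ht.1, rfl⟩, ?_⟩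
    rintro _ ⟨s, hs, rfl⟩
    rw [metricG, liftA_piH hi ht.1, liftA_piH hi hs]
    exact ht.2 s hs

lemma muMap_piH (hi : Set.InjOn (piH n) (V u : Set (Std n))) {t : Std n} (ht : t ∈ V u) :
    muMap V η u (piH n t) = piV (projP (η u) *ᵥ t) := by
  rw [muMap, liftA_piH hi ht, compV_eq]

lemma metricH_projP_of_lift {E : Mat n} (hE : E - gradEl n ∈ nilAlg n) (s t : Std n) :
    metricH (projP E *ᵥ s) t = (1 / 2) * (piV (projP E *ᵥ s) ⬝ᵥ piH n t) := by
  obtain ⟨b, c, -, rfl⟩ := exists_eq_of_lift hE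
  exact metricH_projP b c s t

lemma projP_eq_zero_iff_of_lift {E : Mat n} (hE : E - gradEl n ∈ nilAlg n) (t : Std n) :
    projP E *ᵥ t = 0 ↔ piV (projP E *ᵥ t) = 0 := by
  obtain ⟨b, c, -, rfl⟩ := exists_eq_of_lift hE
  exact projP_eq_zero_iff b c t

/-- The eigenspace for `1` is isotropic and pairs only with the `H` component, so `μ(X)(Y)` is twice
the metric of `projP E t` with `s`. -/
lemma muMap_eq_metricG_iff (hi : Set.InjOn (piH n) (V u : Set (Std n)))
    (hη : η u - gradEl n ∈ nilAlg n) :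
    (∀ X ∈ subA V u, ∀ Y ∈ subA V u, muMap V η u X ⬝ᵥ Y = metricG V u X Y) ↔
      IsPrefAt (V u) (η u) := by
  have key : ∀ t ∈ V u, ∀ s ∈ V u,
      (muMap V η u (piH n t) ⬝ᵥ piH n s = metricG V u (piH n t) (piH n s) ↔
        2 * metricH (projP (η u) *ᵥ t) s = metricH t s) := by
    intro t ht s hs
    rw [muMap_piH hi ht, metricG, liftA_piH hi ht, liftA_piH hi hs, metricH_projP_of_lift hη]
    ring_nf
  constructor
  · intro h t ht s hs
    exact (key t ht s hs).1 (h _ ⟨t, ht, rfl⟩ _ ⟨s, hs, rfl⟩)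
  · rintro h _ ⟨t, ht, rfl⟩ _ ⟨s, hs, rfl⟩
    exact (key t ht s hs).2 (h t ht s hs)

/-- For a preferred lift `μ(X)(Y)` equals `g(X, Y)`, so `μ(X)` annihilates `A` exactly when `X` is
the image of a vector in the radical. -/
lemma muA_inter_perpA_iff (hi : Set.InjOn (piH n) (V u : Set (Std n)))
    (hη : η u - gradEl n ∈ nilAlg n) (hp : IsPrefAt (V u) (η u)) :
    muA V η u ∩ (perpA V u : Set (Fin n → ℝ)) ⊆ {0} ↔
      ∀ t ∈ radical (V u), projP (η u) *ᵥ t = 0 := by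
  have hperp : ∀ t ∈ V u, (piV (projP (η u) *ᵥ t) ∈ perpA V u ↔ t ∈ radical (V u)) := by
    intro t ht
    constructor
    · refine fun h => ⟨ht, fun s hs => ?_⟩
      rw [← hp t ht s hs, metricH_projP_of_lift hη, h _ ⟨s, hs, rfl⟩]
      ring
    · rintro h _ ⟨s, hs, rfl⟩
      have := hp t ht s hs
      rw [metricH_projP_of_lift hη, h.2 s hs] at this
      linarith
  constructor
  · intro h t ht
    rw [projP_eq_zero_iff_of_lift hη]
    exact h ⟨⟨_, ⟨t, ht.1, rfl⟩, muMap_piH hi ht.1⟩, (hperp t ht.1).2 ht⟩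
  · rintro h _ ⟨⟨_, ⟨t, ht, rfl⟩, rfl⟩, h2⟩
    rw [muMap_piH hi ht] at h2 ⊢
    rw [h t ((hperp t ht).1 h2)]
    rfl

lemma modelPref_eq : modelPref V η u = model (η u) ((V u).map (piH n)) ∅ := by
  rw [model, perp_empty]; rfl

lemma modelStrong_eq (hi : Set.InjOn (piH n) (V u : Set (Std n))) :
    modelStrong V η u = model (η u) ((V u).map (piH n)) (piH n '' radical (V u)) := by
  rw [model, ← mem_isoA_iff hi]; rfl

lemma exists_leftInverse (hi : Set.InjOn (piH n) (V u : Set (Std n))) :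
    ∃ l : Matrix (Idx n) (Fin n) ℝ, (∀ t ∈ V u, l *ᵥ piH n t = t) ∧ ∀ x, l *ᵥ x ∈ V u := by
  obtain ⟨g, hg⟩ := LinearMap.exists_leftInverse_of_injective ((piH n).comp (V u).subtype)
    (LinearMap.ker_eq_bot.2 fun s t h => Subtype.ext (hi s.2 t.2 h))
  refine ⟨LinearMap.toMatrix' ((V u).subtype ∘ₗ g), fun t ht => ?_, fun x => ?_⟩
  · rw [← Matrix.toLin'_apply, Matrix.toLin'_toMatrix', LinearMap.comp_apply]
    have := LinearMap.congr_fun hg ⟨t, ht⟩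
    simpa using congrArg Subtype.val this
  · rw [← Matrix.toLin'_apply, Matrix.toLin'_toMatrix', LinearMap.comp_apply]
    exact (g x).2

/-- With `P` a projection to `A` and `N = μ ∘ P`, symmetry of `μ` on `A` says that `Pᵀ N` is
symmetric. -/
lemma exists_isSymmExtension (hi : Set.InjOn (piH n) (V u : Set (Std n)))
    (hη : η u - gradEl n ∈ nilAlg n) (hp : IsPrefAt (V u) (η u)) :
    ∃ m, IsSymmExtension V η u m := by
  obtain ⟨l, hl, hlV⟩ := exists_leftInverse hi
  set N : Matrix (Fin n) (Fin n) ℝ := Matrix.of fun i j => (projP (η u) * l) (iV i) j with hN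
  set P : Matrix (Fin n) (Fin n) ℝ := Matrix.of fun i j => l (iH i) j with hP
  have hNx : ∀ x, N *ᵥ x = piV (projP (η u) *ᵥ (l *ᵥ x)) := fun x => by
    rw [Matrix.mulVec_mulVec]; rfl
  have hPx : ∀ x, P *ᵥ x = piH n (l *ᵥ x) := fun x => rfl
  have hsymm : ∀ x y, (N *ᵥ x) ⬝ᵥ (P *ᵥ y) = (N *ᵥ y) ⬝ᵥ (P *ᵥ x) := by
    intro x y
    have h1 := hp _ (hlV x) _ (hlV y)
    have h2 := hp _ (hlV y) _ (hlV x)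
    rw [metricH_projP_of_lift hη] at h1 h2
    rw [metricH_comm, ← h1] at h2
    rw [hNx, hNx, hPx, hPx]
    linarith
  have hPN : Pᵀ * N = Nᵀ * P := by
    refine matrix_ext_mulVec fun x => dotProduct_eq _ _ fun y => ?_
    rw [← Matrix.mulVec_mulVec, ← Matrix.mulVec_mulVec, ← dotProduct_mulVec_transpose,
      ← dotProduct_mulVec_transpose, hsymm, dotProduct_comm]
  -- On `A`, where `P` is the identity, `Nᵀ` and `Pᵀ N = Nᵀ P` cancel and `N = μ` is left.
  refine ⟨N + Nᵀ - Pᵀ * N, ?_, ?_⟩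
  · rw [Matrix.IsSymm, Matrix.transpose_sub, Matrix.transpose_add, Matrix.transpose_transpose,
      Matrix.transpose_mul, Matrix.transpose_transpose, ← hPN]
    abel
  · rintro _ ⟨t, ht, rfl⟩
    have h1 : P *ᵥ piH n t = piH n t := by rw [hPx, hl t ht]
    rw [hPN, Matrix.sub_mulVec, Matrix.add_mulVec, ← Matrix.mulVec_mulVec, h1, hNx, hl t ht,
      muMap_piH hi ht]
    abel

/-- The equation `τ = b(X)` on `V` determines `b` on `A` by `V` alone, so two preferred lifts agree
there and `brk_inM1_le` applies in both directions. -/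
lemma bundleB_eq {η' : Q → Mat n} (hη : η u - gradEl n ∈ nilAlg n) (hp : IsPrefAt (V u) (η u))
    (hη' : η' u - gradEl n ∈ nilAlg n) (hp' : IsPrefAt (V u) (η' u)) :
    bundleB V η u = bundleB V η' u := by
  obtain ⟨b, c, hc, h⟩ := exists_eq_of_lift hη
  obtain ⟨b', c', hc', h'⟩ := exists_eq_of_lift hη'
  rw [bundleB, bundleB]
  rw [h] at hp ⊢
  rw [h'] at hp' ⊢
  have hb : ∀ x ∈ subA V u, b ⬝ᵥ x = b' ⬝ᵥ x := by
    rintro _ ⟨t, ht, rfl⟩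
    rw [← hp.iR_eq hc ht, ← hp'.iR_eq hc' ht]
  exact le_antisymm (sup_le (brk_inM1_le hc' hb) le_sup_right)
    (sup_le (brk_inM1_le hc fun x hx => (hb x hx).symm) le_sup_right)

end bridge

/-! ### The action of the parabolic subgroup -/

lemma pMat_mul_inv (p : parabolicP n) : pMat p * pMat p⁻¹ = 1 := by
  rw [pMat, pMat, ← Matrix.SpecialLinearGroup.coe_mul, ← Subgroup.coe_mul, mul_inv_cancel]
  simp

lemma pMat_inv_mul (p : parabolicP n) : pMat p⁻¹ * pMat p = 1 := mul_eq_one_comm.1 (pMat_mul_inv p)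

lemma pMat_mul (p q : parabolicP n) : pMat (p * q) = pMat p * pMat q := by
  rw [pMat, pMat, pMat, Subgroup.coe_mul, Matrix.SpecialLinearGroup.coe_mul]

lemma pMat_gram (p : parabolicP n) : (pMat p)ᵀ * gramJ n * pMat p = gramJ n := p.2.1

lemma pMat_iV (p : parabolicP n) (a) (j : Fin n) : pMat p (Sum.inr a) (iV j) = 0 := p.2.2.1 a j

lemma gramJ_mul_gramJ : gramJ n * gramJ n = 1 := by
  ext a b
  rw [gramJ_mul_apply, gramJ_apply, dualIdx_dualIdx, Matrix.one_apply]
  simp [eq_comm]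

lemma pMat_inv_eq (p : parabolicP n) : pMat p⁻¹ = gramJ n * (pMat p)ᵀ * gramJ n := by
  have h : gramJ n * (pMat p)ᵀ * gramJ n * pMat p = 1 := by
    rw [Matrix.mul_assoc, Matrix.mul_assoc, ← Matrix.mul_assoc _ (gramJ n), pMat_gram,
      gramJ_mul_gramJ]
  calc pMat p⁻¹ = gramJ n * (pMat p)ᵀ * gramJ n * pMat p * pMat p⁻¹ := by rw [h, Matrix.one_mul]
    _ = _ := by rw [Matrix.mul_assoc, pMat_mul_inv, Matrix.mul_one]

lemma pMat_inv_apply (p : parabolicP n) (a b : Idx n) :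
    pMat p⁻¹ a b = pMat p (dualIdx b) (dualIdx a) := by
  rw [pMat_inv_eq, mul_gramJ_apply, gramJ_mul_apply, Matrix.transpose_apply]

/-- Orthogonality moves this entry to one of `p⁻¹` that vanishes because `p⁻¹` also preserves the
plane. Thus `p` is fully block triangular and acts on `H`. -/
lemma pMat_iH_iR (p : parabolicP n) (i : Fin n) : pMat p (iH i) iR = 0 := by
  have := pMat_inv_apply p⁻¹ (iH i) iR
  rw [inv_inv, dualIdx_iR, dualIdx_iH] at this
  rw [this]
  exact pMat_iV _ _ _

lemma piH_pMat_mulVec (p : parabolicP n) (t : Std n) :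
    piH n (pMat p *ᵥ t) = blk0 (pMat p) *ᵥ piH n t := by
  funext i
  have h1 : ∀ j : Fin n, pMat p (iH i) (iV j) = 0 := fun j => pMat_iV p _ j
  have h2 : pMat p (iH i) iR = 0 := pMat_iH_iR p i
  simp only [piH_apply, Matrix.mulVec, dotProduct, Fintype.sum_sum_type, h1, zero_mul,
    Finset.sum_const_zero, zero_add, Finset.univ_unique, Finset.sum_singleton, blk0,
    Matrix.of_apply]
  rw [show (default : Unit) = () from rfl, h2, zero_mul, zero_add]

lemma conj_mem_gAlg (p : parabolicP n) {a : Mat n} (ha : a ∈ gAlg n) :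
    pMat p⁻¹ * a * pMat p ∈ gAlg n := by
  have h1 : (pMat p⁻¹)ᵀ * gramJ n = gramJ n * pMat p := by
    rw [pMat_inv_eq]
    simp only [Matrix.transpose_mul, Matrix.transpose_transpose]
    have hJ : (gramJ n)ᵀ = gramJ n := by
      ext x y
      have : (y = dualIdx x) ↔ (x = dualIdx y) :=
        ⟨fun h => by rw [h, dualIdx_dualIdx], fun h => by rw [h, dualIdx_dualIdx]⟩
      rw [Matrix.transpose_apply, gramJ_apply, gramJ_apply]
      simp only [this]
    rw [hJ, Matrix.mul_assoc, Matrix.mul_assoc, gramJ_mul_gramJ, Matrix.mul_one]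
  have h2 : (pMat p)ᵀ * gramJ n = gramJ n * pMat p⁻¹ := by
    rw [pMat_inv_eq, ← Matrix.mul_assoc, ← Matrix.mul_assoc, gramJ_mul_gramJ, Matrix.one_mul]
  rw [mem_gAlg_iff'] at ha ⊢
  rw [Matrix.transpose_mul, Matrix.transpose_mul, Matrix.mul_assoc, Matrix.mul_assoc, h1,
    ← Matrix.mul_assoc aᵀ, ha, neg_mul, mul_neg, Matrix.mul_assoc, ← Matrix.mul_assoc, h2]
  simp only [Matrix.mul_assoc]

/-- A lift is an element of `𝔤` that acts as the identity on the plane `{(v, 0, 0)}`; the plane is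
preserved by `P`, so conjugation keeps this property. -/
lemma lift_conj (p : parabolicP n) {E : Mat n} (hE : E - gradEl n ∈ nilAlg n) :
    pMat p⁻¹ * E * pMat p - gradEl n ∈ nilAlg n := by
  refine ⟨(gAlg n).sub_mem (conj_mem_gAlg p (mem_gAlg_of_lift hE)) gradEl_mem_gAlg,
    fun a j => ?_⟩
  have h1 : ∀ a i, E a (iV i) = if a = iV i then 1 else 0 := fun a i => by
    have h := hE.2 a i
    rw [Matrix.sub_apply, sub_eq_zero] at h
    rw [h, gradEl, Matrix.diagonal_apply]
    split_ifs with h <;> simp [h]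
  have h3 : ∀ a, (E * pMat p) a (iV j) = pMat p a (iV j) := fun a => by
    rw [Matrix.mul_apply, Fintype.sum_sum_type]
    have : ∀ x, pMat p (Sum.inr x) (iV j) = 0 := fun x => pMat_iV p x j
    simp only [this, mul_zero, Finset.sum_const_zero, add_zero]
    rcases a with i | a
    · simp [h1]
    · simp [h1, this]
  have h4 : (pMat p⁻¹ * E * pMat p) a (iV j) = (1 : Mat n) a (iV j) := by
    rw [← pMat_inv_mul p, Matrix.mul_assoc, Matrix.mul_apply, Matrix.mul_apply]
    exact Finset.sum_congr rfl fun x _ => by rw [h3]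
  rw [Matrix.sub_apply, h4, gradEl, Matrix.one_apply, Matrix.diagonal_apply]
  split_ifs with h <;> simp [h]

lemma projP_conj (p : parabolicP n) (E : Mat n) :
    projP (pMat p⁻¹ * E * pMat p) = pMat p⁻¹ * projP E * pMat p := by
  have h : pMat p⁻¹ * E * pMat p * (pMat p⁻¹ * E * pMat p) = pMat p⁻¹ * (E * E) * pMat p := by
    calc _ = pMat p⁻¹ * E * (pMat p * pMat p⁻¹) * E * pMat p := by simp only [Matrix.mul_assoc]
      _ = _ := by rw [pMat_mul_inv]; simp only [Matrix.mul_assoc, Matrix.one_mul]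
  rw [projP, projP, h, Matrix.mul_smul, Matrix.smul_mul, mul_add, add_mul]

lemma IsStrongAt.conj (p : parabolicP n) {L : Submodule ℝ (Std n)} {E : Mat n}
    (h : IsStrongAt L E) :
    IsStrongAt (L.map (Matrix.toLin' (pMat p⁻¹))) (pMat p⁻¹ * E * pMat p) := by
  have hP : ∀ t, projP (pMat p⁻¹ * E * pMat p) *ᵥ (pMat p⁻¹ *ᵥ t) =
      pMat p⁻¹ *ᵥ (projP E *ᵥ t) := fun t => by
    rw [projP_conj, Matrix.mulVec_mulVec, Matrix.mul_assoc, pMat_mul_inv, Matrix.mul_one,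
      Matrix.mulVec_mulVec]
  constructor
  · rintro _ ⟨t, ht, rfl⟩ _ ⟨s, hs, rfl⟩
    rw [Matrix.toLin'_apply, Matrix.toLin'_apply, hP, metricH_mulVec_mulVec (pMat_gram _),
      metricH_mulVec_mulVec (pMat_gram _)]
    exact h.1 t ht s hs
  · rintro _ ⟨⟨t, ht, rfl⟩, h'⟩
    rw [Matrix.toLin'_apply, hP, h.2 t ⟨ht, fun s hs => ?_⟩, Matrix.mulVec_zero]
    have := h' _ ⟨s, hs, rfl⟩
    rwa [Matrix.toLin'_apply, Matrix.toLin'_apply, metricH_mulVec_mulVec (pMat_gram _)] at this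

/-! ### A strongly preferred lift for a subspace with a given basis -/

section localLift

variable {r : ℕ}

lemma det_gram_ne_zero {X : Matrix (Fin n) (Fin r) ℝ} (hX : ∀ x, X *ᵥ x = 0 → x = 0) :
    (Xᵀ * X).det ≠ 0 := by
  intro h
  obtain ⟨x, hx, h'⟩ := Matrix.exists_mulVec_eq_zero_iff.2 h
  refine hx (hX x (dotProduct_self_eq_zero.1 ?_))
  rw [Matrix.dotProduct_mulVec, ← Matrix.mulVec_transpose, Matrix.mulVec_mulVec, h',
    zero_dotProduct]

/-- A skew matrix `c` with `c X = W`, if `Xᵀ W` is skew. -/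
def skewSolve (X W : Matrix (Fin n) (Fin r) ℝ) : Matrix (Fin n) (Fin n) ℝ :=
  W * (Xᵀ * X)⁻¹ * Xᵀ - X * (Xᵀ * X)⁻¹ * Wᵀ - X * (Xᵀ * X)⁻¹ * (Xᵀ * W) * (Xᵀ * X)⁻¹ * Xᵀ

lemma gram_inv_transpose (X : Matrix (Fin n) (Fin r) ℝ) : ((Xᵀ * X)⁻¹)ᵀ = (Xᵀ * X)⁻¹ := by
  rw [Matrix.transpose_nonsing_inv, Matrix.transpose_mul, Matrix.transpose_transpose]

lemma skewSolve_transpose {X W : Matrix (Fin n) (Fin r) ℝ} (h : (Xᵀ * W)ᵀ = -(Xᵀ * W)) :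
    (skewSolve X W)ᵀ = -skewSolve X W := by
  rw [Matrix.transpose_mul, Matrix.transpose_transpose] at h
  simp only [skewSolve, Matrix.transpose_sub, Matrix.transpose_mul, Matrix.transpose_transpose,
    gram_inv_transpose, h, Matrix.neg_mul, Matrix.mul_neg, Matrix.mul_assoc]
  abel

/-- The first term of `skewSolve` alone already sends `X` to `W`. The second makes it skew together
with the first, and the third, itself skew, removes what the second adds on the image of `X`. -/
lemma skewSolve_mul {X W : Matrix (Fin n) (Fin r) ℝ} (hX : ∀ x, X *ᵥ x = 0 → x = 0)
    (h : (Xᵀ * W)ᵀ = -(Xᵀ * W)) : skewSolve X W * X = W := by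
  rw [Matrix.transpose_mul, Matrix.transpose_transpose] at h
  have hG : (Xᵀ * X)⁻¹ * (Xᵀ * X) = 1 :=
    Matrix.nonsing_inv_mul _ (isUnit_iff_ne_zero.2 (det_gram_ne_zero hX))
  simp only [skewSolve, Matrix.sub_mul, Matrix.mul_assoc, hG, h, Matrix.mul_neg, Matrix.mul_one]
  abel

/-- The `b` component of the lift. -/
def liftB (τ : Fin r → ℝ) (X : Matrix (Fin n) (Fin r) ℝ) : Fin n → ℝ :=
  (X * (Xᵀ * X)⁻¹) *ᵥ τ

/-- The Gram matrix of the metric. -/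
def gramG (v : Matrix (Fin n) (Fin r) ℝ) (τ : Fin r → ℝ) (X : Matrix (Fin n) (Fin r) ℝ) :
    Matrix (Fin r) (Fin r) ℝ :=
  (1 / 2 : ℝ) • (Xᵀ * v + vᵀ * X + Matrix.vecMulVec τ τ)

/-- The prescribed values of the `c` component of the lift. -/
def liftW (v : Matrix (Fin n) (Fin r) ℝ) (τ : Fin r → ℝ) (X : Matrix (Fin n) (Fin r) ℝ) :
    Matrix (Fin n) (Fin r) ℝ :=
  (2 : ℝ) • (X * (Xᵀ * X)⁻¹ * gramG v τ X - v) - Matrix.vecMulVec (liftB τ X) τ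

/-- A strongly preferred lift for the span of the vectors `(v_k, τ_k, X_k)`. -/
def localLift (v : Matrix (Fin n) (Fin r) ℝ) (τ : Fin r → ℝ) (X : Matrix (Fin n) (Fin r) ℝ) :
    Mat n :=
  gradEl n + nilM (liftB τ X) (skewSolve X (liftW v τ X))

variable {v : Matrix (Fin n) (Fin r) ℝ} {τ : Fin r → ℝ} {X : Matrix (Fin n) (Fin r) ℝ}

lemma gram_mul_inv (hX : ∀ x, X *ᵥ x = 0 → x = 0) : Xᵀ * X * (Xᵀ * X)⁻¹ = 1 :=
  Matrix.mul_nonsing_inv _ (isUnit_iff_ne_zero.2 (det_gram_ne_zero hX))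

lemma liftB_dotProduct (hX : ∀ x, X *ᵥ x = 0 → x = 0) (x : Fin r → ℝ) :
    liftB τ X ⬝ᵥ (X *ᵥ x) = τ ⬝ᵥ x := by
  rw [liftB, Matrix.dotProduct_mulVec, ← Matrix.mulVec_transpose, Matrix.mulVec_mulVec,
    ← Matrix.mul_assoc, gram_mul_inv hX, Matrix.one_mulVec]

lemma liftW_skew (hX : ∀ x, X *ᵥ x = 0 → x = 0) :
    (Xᵀ * liftW v τ X)ᵀ = -(Xᵀ * liftW v τ X) := by
  have h1 : Xᵀ * Matrix.vecMulVec (liftB τ X) τ = Matrix.vecMulVec τ τ := by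
    rw [Matrix.mul_vecMulVec, liftB, Matrix.mulVec_mulVec, ← Matrix.mul_assoc, gram_mul_inv hX,
      Matrix.one_mulVec]
  have h2 : Xᵀ * liftW v τ X = vᵀ * X - Xᵀ * v := by
    rw [liftW, Matrix.mul_sub, Matrix.mul_smul, Matrix.mul_sub, h1, ← Matrix.mul_assoc, ← Matrix.mul_assoc,
      gram_mul_inv hX, Matrix.one_mul, gramG]
    module
  rw [h2, Matrix.transpose_sub, Matrix.transpose_mul, Matrix.transpose_mul,
    Matrix.transpose_transpose, Matrix.transpose_transpose]
  abel

lemma localLift_mem (hX : ∀ x, X *ᵥ x = 0 → x = 0) :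
    localLift v τ X - gradEl n ∈ nilAlg n :=
  mem_nilAlg_iff.2 ⟨_, _, skewSolve_transpose (liftW_skew hX), by rw [localLift]; abel⟩

/-- The matrix `liftW` comes from solving `v + τ b + c X / 2 - (b · X) b / 2 = X (XᵀX)⁻¹ g` for `c
X`, so here `μ` is `g` followed by the Euclidean identification of `A` with a complement of `A^⊥`.
-/
lemma piV_projP_localLift (hX : ∀ x, X *ᵥ x = 0 → x = 0) {t : Std n} {x : Fin r → ℝ}
    (h1 : piV t = v *ᵥ x) (h2 : t iR = τ ⬝ᵥ x) (h3 : piH n t = X *ᵥ x) :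
    piV (projP (localLift v τ X) *ᵥ t) = (X * (Xᵀ * X)⁻¹) *ᵥ (gramG v τ X *ᵥ x) := by
  rw [localLift, piV_projP, h1, h2, h3, liftB_dotProduct hX, Matrix.mulVec_mulVec,
    skewSolve_mul hX (liftW_skew hX), liftW, Matrix.sub_mulVec, Matrix.smul_mulVec,
    Matrix.sub_mulVec, Matrix.vecMulVec_mulVec, ← Matrix.mulVec_mulVec]
  simp only [op_smul_eq_smul]
  module

lemma metricH_gramG {s t : Std n} {x y : Fin r → ℝ}
    (h1 : piV t = v *ᵥ x) (h2 : t iR = τ ⬝ᵥ x) (h3 : piH n t = X *ᵥ x)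
    (h1' : piV s = v *ᵥ y) (h2' : s iR = τ ⬝ᵥ y) (h3' : piH n s = X *ᵥ y) :
    metricH t s = (gramG v τ X *ᵥ x) ⬝ᵥ y := by
  rw [metricH_eq, h1, h2, h3, h1', h2', h3', gramG, Matrix.smul_mulVec, Matrix.add_mulVec,
    Matrix.add_mulVec, Matrix.vecMulVec_mulVec, smul_dotProduct, add_dotProduct, add_dotProduct,
    ← Matrix.mulVec_mulVec, ← Matrix.mulVec_mulVec, ← dotProduct_mulVec_transpose,
    ← dotProduct_mulVec_transpose, op_smul_eq_smul, smul_dotProduct]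
  simp only [smul_eq_mul]

/-- Since `Xᵀ X (XᵀX)⁻¹ g = g`, the lift is preferred; since `μ` factors through `g`, it vanishes on
the radical. -/
lemma isStrongAt_localLift (hX : ∀ x, X *ᵥ x = 0 → x = 0) {L : Submodule ℝ (Std n)}
    (hL : ∀ t ∈ L, ∃ x, piV t = v *ᵥ x ∧ t iR = τ ⬝ᵥ x ∧ piH n t = X *ᵥ x)
    (hL' : ∀ x, ∃ t ∈ L, piV t = v *ᵥ x ∧ t iR = τ ⬝ᵥ x ∧ piH n t = X *ᵥ x) :
    IsStrongAt L (localLift v τ X) := by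
  constructor
  · intro t ht s hs
    obtain ⟨x, h1, h2, h3⟩ := hL t ht
    obtain ⟨y, h1', h2', h3'⟩ := hL s hs
    rw [metricH_projP_of_lift (localLift_mem hX), piV_projP_localLift hX h1 h2 h3,
      metricH_gramG h1 h2 h3 h1' h2' h3', h3', dotProduct_mulVec_transpose,
      Matrix.mulVec_mulVec, ← Matrix.mul_assoc, gram_mul_inv hX, Matrix.one_mulVec]
    ring
  · rintro t ⟨ht, h⟩
    obtain ⟨x, h1, h2, h3⟩ := hL t ht
    have h0 : gramG v τ X *ᵥ x = 0 := by
      refine dotProduct_eq_zero _ fun y => ?_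
      obtain ⟨s, hs, h1', h2', h3'⟩ := hL' y
      rw [← metricH_gramG h1 h2 h3 h1' h2' h3']
      exact h s hs
    rw [projP_eq_zero_iff_of_lift (localLift_mem hX), piV_projP_localLift hX h1 h2 h3, h0,
      Matrix.mulVec_zero]

end localLift

end Algebra

/-! ### Coordinates with respect to a frame -/

section Frame

variable {n r : ℕ} {Q : Type*}

/-- The matrix of `π²` with respect to a frame. -/
def frameX (s : Fin r → Q → Std n) (u : Q) : Matrix (Fin n) (Fin r) ℝ :=
  Matrix.of fun i k => s k u (iH i)

/-- The matrix of the `H*` coordinates of a frame. -/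
def frameV (s : Fin r → Q → Std n) (u : Q) : Matrix (Fin n) (Fin r) ℝ :=
  Matrix.of fun i k => s k u (iV i)

lemma piH_sum (s : Fin r → Q → Std n) (u : Q) (x : Fin r → ℝ) :
    piH n (∑ k, x k • s k u) = frameX s u *ᵥ x := by
  funext i
  simp [frameX, Matrix.mulVec, dotProduct, mul_comm]

lemma piV_sum (s : Fin r → Q → Std n) (u : Q) (x : Fin r → ℝ) :
    piV (∑ k, x k • s k u) = frameV s u *ᵥ x := by
  funext i
  simp [frameV, Matrix.mulVec, dotProduct, mul_comm]

lemma iR_sum (s : Fin r → Q → Std n) (u : Q) (x : Fin r → ℝ) :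
    (∑ k, x k • s k u) iR = (fun k => s k u iR) ⬝ᵥ x := by
  simp [dotProduct, mul_comm]

end Frame

section Smooth

variable {EQ : Type*} [NormedAddCommGroup EQ] [NormedSpace ℝ EQ]
  {Q : Type*} [TopologicalSpace Q] [ChartedSpace EQ Q]

/-! ### Smooth families of matrices -/

variable (EQ) in
/-- A family of matrices with smooth entries. -/
def SmoothMat {m k : Type*} (S : Set Q) (f : Q → Matrix m k ℝ) : Prop :=
  ∀ i j, ContMDiffOn 𝓘(ℝ, EQ) 𝓘(ℝ, ℝ) ∞ (fun u => f u i j) S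

namespace SmoothMat

variable {m k l : Type*} {S : Set Q}

lemma const (a : Matrix m k ℝ) : SmoothMat EQ S fun _ : Q => a := fun _ _ => contMDiffOn_const

lemma add {f g : Q → Matrix m k ℝ} (hf : SmoothMat EQ S f) (hg : SmoothMat EQ S g) :
    SmoothMat EQ S fun u => f u + g u := fun i j => (hf i j).add (hg i j)

lemma sub {f g : Q → Matrix m k ℝ} (hf : SmoothMat EQ S f) (hg : SmoothMat EQ S g) :
    SmoothMat EQ S fun u => f u - g u := fun i j => (hf i j).sub (hg i j)

lemma smul {c : Q → ℝ} {f : Q → Matrix m k ℝ} (hc : ContMDiffOn 𝓘(ℝ, EQ) 𝓘(ℝ, ℝ) ∞ c S)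
    (hf : SmoothMat EQ S f) : SmoothMat EQ S fun u => c u • f u :=
  fun i j => hc.mul (hf i j)

lemma transpose {f : Q → Matrix m k ℝ} (hf : SmoothMat EQ S f) :
    SmoothMat EQ S fun u => (f u)ᵀ := fun i j => hf j i

lemma mul [Fintype k] {f : Q → Matrix m k ℝ} {g : Q → Matrix k l ℝ} (hf : SmoothMat EQ S f)
    (hg : SmoothMat EQ S g) : SmoothMat EQ S fun u => f u * g u := fun i j => by
  simp only [Matrix.mul_apply]
  exact contMDiffOn_finsetSum fun x _ => (hf i x).mul (hg x j)

lemma vecMulVec {a : Q → m → ℝ} {b : Q → k → ℝ}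
    (ha : ∀ i, ContMDiffOn 𝓘(ℝ, EQ) 𝓘(ℝ, ℝ) ∞ (fun u => a u i) S)
    (hb : ∀ i, ContMDiffOn 𝓘(ℝ, EQ) 𝓘(ℝ, ℝ) ∞ (fun u => b u i) S) :
    SmoothMat EQ S fun u => Matrix.vecMulVec (a u) (b u) := fun i j => by
  simp only [Matrix.vecMulVec_apply]
  exact (ha i).mul (hb j)

lemma mulVec [Fintype k] {f : Q → Matrix m k ℝ} {a : Q → k → ℝ} (hf : SmoothMat EQ S f)
    (ha : ∀ i, ContMDiffOn 𝓘(ℝ, EQ) 𝓘(ℝ, ℝ) ∞ (fun u => a u i) S) (i : m) :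
    ContMDiffOn 𝓘(ℝ, EQ) 𝓘(ℝ, ℝ) ∞ (fun u => (f u *ᵥ a u) i) S := by
  simp only [Matrix.mulVec, dotProduct]
  exact contMDiffOn_finsetSum fun x _ => (hf i x).mul (ha x)

lemma det [Fintype k] [DecidableEq k] {f : Q → Matrix k k ℝ} (hf : SmoothMat EQ S f) :
    ContMDiffOn 𝓘(ℝ, EQ) 𝓘(ℝ, ℝ) ∞ (fun u => (f u).det) S := by
  simp only [Matrix.det_apply']
  exact contMDiffOn_finsetSum fun σ _ =>
    contMDiffOn_const.mul (contMDiffOn_finsetProd fun i _ => hf _ _)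

lemma inv [Fintype k] [DecidableEq k] {f : Q → Matrix k k ℝ} (hf : SmoothMat EQ S f)
    (h : ∀ u ∈ S, (f u).det ≠ 0) : SmoothMat EQ S fun u => (f u)⁻¹ := fun i j => by
  simp only [Matrix.inv_def, Ring.inverse_eq_inv', Matrix.smul_apply, Matrix.adjugate_apply,
    smul_eq_mul]
  refine (hf.det.inv₀ h).mul (det fun x y => ?_)
  by_cases hx : x = j
  · subst hx
    simp only [Matrix.updateRow_self]
    exact contMDiffOn_const
  · simp only [Matrix.updateRow_ne hx]
    exact hf x y

variable {n : ℕ}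

lemma nilM {b : Q → Fin n → ℝ} {c : Q → Matrix (Fin n) (Fin n) ℝ}
    (hb : ∀ i, ContMDiffOn 𝓘(ℝ, EQ) 𝓘(ℝ, ℝ) ∞ (fun u => b u i) S) (hc : SmoothMat EQ S c) :
    SmoothMat EQ S fun u => FreeDist.nilM (b u) (c u) := by
  rintro (i | _ | i) (j | _ | j) <;> simp only [FreeDist.nilM, Matrix.of_apply]
  exacts [contMDiffOn_const, hb i, hc i j, contMDiffOn_const, contMDiffOn_const, (hb j).neg,
    contMDiffOn_const, contMDiffOn_const, contMDiffOn_const]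

lemma gram_inv {r : ℕ} {X : Q → Matrix (Fin n) (Fin r) ℝ} (hX : SmoothMat EQ S X)
    (h : ∀ u ∈ S, ∀ x, X u *ᵥ x = 0 → x = 0) :
    SmoothMat EQ S fun u => ((X u)ᵀ * X u)⁻¹ :=
  (hX.transpose.mul hX).inv fun u hu => det_gram_ne_zero (h u hu)

lemma localLift {r : ℕ} {v X : Q → Matrix (Fin n) (Fin r) ℝ} {τ : Q → Fin r → ℝ}
    (hv : SmoothMat EQ S v) (hX : SmoothMat EQ S X)
    (hτ : ∀ i, ContMDiffOn 𝓘(ℝ, EQ) 𝓘(ℝ, ℝ) ∞ (fun u => τ u i) S)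
    (h : ∀ u ∈ S, ∀ x, X u *ᵥ x = 0 → x = 0) :
    SmoothMat EQ S fun u => FreeDist.localLift (v u) (τ u) (X u) := by
  have hG := hX.gram_inv h
  have hb : ∀ i, ContMDiffOn 𝓘(ℝ, EQ) 𝓘(ℝ, ℝ) ∞ (fun u => liftB (τ u) (X u) i) S :=
    (hX.mul hG).mulVec hτ
  have hg : SmoothMat EQ S fun u => gramG (v u) (τ u) (X u) :=
    smul contMDiffOn_const (((hX.transpose.mul hv).add (hv.transpose.mul hX)).add
      (vecMulVec hτ hτ))
  have hW : SmoothMat EQ S fun u => liftW (v u) (τ u) (X u) :=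
    (smul contMDiffOn_const (((hX.mul hG).mul hg).sub hv)).sub (vecMulVec hb hτ)
  exact (const _).add (SmoothMat.nilM hb ((((hW.mul hG).mul hX.transpose).sub
    ((hX.mul hG).mul hW.transpose)).sub
      ((((hX.mul hG).mul (hX.transpose.mul hW)).mul hG).mul hX.transpose)))

end SmoothMat

end Smooth

/-! ### Frames of `V` and local existence of strongly preferred Weyl structures -/

namespace CartanGeometry

variable {n : ℕ}
  {EM : Type*} [NormedAddCommGroup EM] [NormedSpace ℝ EM]
  {M : Type*} [TopologicalSpace M] [ChartedSpace EM M]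
  {EQ : Type*} [NormedAddCommGroup EQ] [NormedSpace ℝ EQ]
  {Q : Type*} [TopologicalSpace Q] [ChartedSpace EQ Q] [IsManifold 𝓘(ℝ, EQ) ∞ Q]
  {𝒢 : CartanGeometry n EM M EQ Q} {r : ℕ} {V : Q → Submodule ℝ (Std n)} {U : Set M}

lemma isOpen_preimage (𝒢 : CartanGeometry n EM M EQ Q) {W : Set M} (hW : IsOpen W) :
    IsOpen (𝒢.proj ⁻¹' W) :=
  hW.preimage 𝒢.contMDiff_proj.continuous

lemma IsTractorSection.apply {W : Set M} {s : Q → Std n} (h : 𝒢.IsTractorSection W s) (a : Idx n) :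
    ContMDiffOn 𝓘(ℝ, EQ) 𝓘(ℝ, ℝ) ∞ (fun u => s u a) (𝒢.proj ⁻¹' W) :=
  (contMDiffOn_pi_space.1 h.1) a

lemma IsTractorSection.mono {W W' : Set M} (hW : W' ⊆ W) {s : Q → Std n}
    (h : 𝒢.IsTractorSection W s) : 𝒢.IsTractorSection W' s :=
  ⟨h.1.mono (Set.preimage_mono hW), fun u hu => h.2 u (hW hu)⟩

/-- A smooth frame of `V` over an open set. -/
structure IsFrame (𝒢 : CartanGeometry n EM M EQ Q) (V : Q → Submodule ℝ (Std n)) (W : Set M)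
    (s : Fin r → Q → Std n) : Prop where
  isOpen : IsOpen W
  isSection : ∀ k, 𝒢.IsTractorSection W (s k)
  mem : ∀ k, ∀ u ∈ 𝒢.proj ⁻¹' W, s k u ∈ V u
  exists_eq : ∀ u ∈ 𝒢.proj ⁻¹' W, ∀ t ∈ V u, ∃ x : Fin r → ℝ, t = ∑ k, x k • s k u
  injective : ∀ u ∈ 𝒢.proj ⁻¹' W, ∀ x, frameX s u *ᵥ x = 0 → x = 0

lemma exists_isFrame (hV : 𝒢.IsSubbundle r V) (hU : IsOpen U) (hi : 𝒢.InjectiveOver U V) {x : M}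
    (hx : x ∈ U) : ∃ W ⊆ U, x ∈ W ∧ ∃ s : Fin r → Q → Std n, 𝒢.IsFrame V W s := by
  obtain ⟨W, hW, hxW, s, hs, h⟩ := hV.2 x
  refine ⟨W ∩ U, Set.inter_subset_right, ⟨hxW, hx⟩, s, hW.inter hU,
    fun k => (hs k).mono Set.inter_subset_left, fun k u hu => ?_, fun u hu t ht => ?_,
    fun u hu x hx => ?_⟩
  · rw [(h u hu.1).2]
    exact Submodule.subset_span ⟨k, rfl⟩
  · rw [(h u hu.1).2, Submodule.mem_span_range_iff_exists_fun] at ht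
    obtain ⟨x, rfl⟩ := ht
    exact ⟨x, rfl⟩
  · have hm : ∑ k, x k • s k u ∈ V u := Submodule.sum_mem _ fun k _ =>
      Submodule.smul_mem _ _ (by rw [(h u hu.1).2]; exact Submodule.subset_span ⟨k, rfl⟩)
    rw [← piH_sum] at hx
    have h0 := hi u hu.2 hm (V u).zero_mem (hx.trans (map_zero _).symm)
    funext k
    exact Fintype.linearIndependent_iff.1 (h u hu.1).1 x h0 k

namespace IsFrame

variable {W : Set M} {s : Fin r → Q → Std n}

lemma mono (h : 𝒢.IsFrame V W s) {W' : Set M} (hW' : IsOpen W') (hW : W' ⊆ W) :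
    𝒢.IsFrame V W' s :=
  ⟨hW', fun k => (h.isSection k).mono hW, fun k u hu => h.mem k u (hW hu),
    fun u hu => h.exists_eq u (hW hu), fun u hu => h.injective u (hW hu)⟩

lemma sum_mem (h : 𝒢.IsFrame V W s) {u : Q} (hu : u ∈ 𝒢.proj ⁻¹' W) (x : Fin r → ℝ) :
    ∑ k, x k • s k u ∈ V u :=
  Submodule.sum_mem _ fun k _ => Submodule.smul_mem _ _ (h.mem k u hu)

lemma smooth_frameX (h : 𝒢.IsFrame V W s) : SmoothMat EQ (𝒢.proj ⁻¹' W) (frameX s) :=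
  fun i k => (h.isSection k).apply (iH i)

lemma smooth_frameV (h : 𝒢.IsFrame V W s) : SmoothMat EQ (𝒢.proj ⁻¹' W) (frameV s) :=
  fun i k => (h.isSection k).apply (iV i)

lemma isStrongAt_localLift (h : 𝒢.IsFrame V W s) {u : Q} (hu : u ∈ 𝒢.proj ⁻¹' W) :
    IsStrongAt (V u) (localLift (frameV s u) (fun k => s k u iR) (frameX s u)) := by
  refine FreeDist.isStrongAt_localLift (h.injective u hu) (fun t ht => ?_) fun x => ?_
  · obtain ⟨x, rfl⟩ := h.exists_eq u hu t ht
    exact ⟨x, piV_sum s u x, iR_sum s u x, piH_sum s u x⟩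
  · exact ⟨_, h.sum_mem hu x, piV_sum s u x, iR_sum s u x, piH_sum s u x⟩

/-- The left inverse of the matrix of `π²` with respect to a frame. -/
def coeff (s : Fin r → Q → Std n) (u : Q) : Matrix (Fin r) (Fin n) ℝ :=
  ((frameX s u)ᵀ * frameX s u)⁻¹ * (frameX s u)ᵀ

lemma smooth_coeff (h : 𝒢.IsFrame V W s) : SmoothMat EQ (𝒢.proj ⁻¹' W) (coeff s) :=
  (h.smooth_frameX.gram_inv h.injective).mul h.smooth_frameX.transpose

lemma eq_sum_coeff (h : 𝒢.IsFrame V W s) {u : Q} (hu : u ∈ 𝒢.proj ⁻¹' W) {t : Std n}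
    (ht : t ∈ V u) : t = ∑ k, (coeff s u *ᵥ piH n t) k • s k u := by
  obtain ⟨x, rfl⟩ := h.exists_eq u hu t ht
  rw [piH_sum, Matrix.mulVec_mulVec, coeff, Matrix.mul_assoc,
    Matrix.nonsing_inv_mul _ (isUnit_iff_ne_zero.2 (det_gram_ne_zero (h.injective u hu))),
    Matrix.one_mulVec]

end IsFrame

/-- Strongly preferred Weyl structures, described fibrewise. -/
def IsStrongWeyl (𝒢 : CartanGeometry n EM M EQ Q) (U : Set M) (V : Q → Submodule ℝ (Std n))
    (η : Q → Mat n) : Prop :=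
  𝒢.IsWeyl U η ∧ ∀ u ∈ 𝒢.proj ⁻¹' U, IsStrongAt (V u) (η u)

/-- The explicit lift is taken along a local section `σ` of `Q`. It need not be equivariant in the
frame formula itself, so its values off `σ` are defined by conjugation. -/
lemma exists_isStrongWeyl_local (hV : 𝒢.IsSubbundle r V) (hU : IsOpen U)
    (hi : 𝒢.InjectiveOver U V) {x : M} (hx : x ∈ U) :
    ∃ W ⊆ U, IsOpen W ∧ x ∈ W ∧ ∃ η, 𝒢.IsStrongWeyl W V η := by
  obtain ⟨W₁, hW₁U, hxW₁, s, hs⟩ := exists_isFrame hV hU hi hx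
  obtain ⟨W₂, hW₂, hxW₂, σ, γ, hσ, hσp, hγ, hγ₁, hγ₂⟩ := 𝒢.locally_trivial x
  have hWo : IsOpen (W₁ ∩ W₂) := hs.isOpen.inter hW₂
  refine ⟨W₁ ∩ W₂, Set.inter_subset_left.trans hW₁U, hWo, ⟨hxW₁, hxW₂⟩, ?_⟩
  have hs := hs.mono hWo Set.inter_subset_left
  have hγ' : SmoothMat EQ (𝒢.proj ⁻¹' (W₁ ∩ W₂)) fun u => pMat (γ u) :=
    fun i j => (hγ i j).mono (Set.preimage_mono Set.inter_subset_right)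
  have hγi : SmoothMat EQ (𝒢.proj ⁻¹' (W₁ ∩ W₂)) fun u => pMat (γ u)⁻¹ := fun i j => by
    simp only [pMat_inv_apply]
    exact hγ' _ _
  have hmem : ∀ u ∈ 𝒢.proj ⁻¹' (W₁ ∩ W₂), σ (𝒢.proj u) ∈ 𝒢.proj ⁻¹' (W₁ ∩ W₂) := fun u hu => by
    rw [Set.mem_preimage, hσp _ hu.2]
    exact hu
  have hσ' : ContMDiffOn 𝓘(ℝ, EQ) 𝓘(ℝ, EQ) ∞ (fun u => σ (𝒢.proj u)) (𝒢.proj ⁻¹' (W₁ ∩ W₂)) :=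
    hσ.comp 𝒢.contMDiff_proj.contMDiffOn fun u hu => hu.2
  have hE : SmoothMat EQ (𝒢.proj ⁻¹' (W₁ ∩ W₂)) fun u => localLift (frameV s (σ (𝒢.proj u)))
      (fun k => s k (σ (𝒢.proj u)) iR) (frameX s (σ (𝒢.proj u))) := by
    refine SmoothMat.localLift (fun i j => ?_) (fun i j => ?_) (fun i => ?_) fun u hu =>
      hs.injective _ (hmem u hu)
    exacts [(hs.smooth_frameV i j).comp hσ' hmem, (hs.smooth_frameX i j).comp hσ' hmem,
      ((hs.isSection i).apply iR).comp hσ' hmem]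
  refine ⟨fun u => pMat (γ u)⁻¹ * localLift (frameV s (σ (𝒢.proj u)))
      (fun k => s k (σ (𝒢.proj u)) iR) (frameX s (σ (𝒢.proj u))) * pMat (γ u),
    ⟨⟨(hγi.mul hE).mul hγ', fun u hu p => ?_⟩, fun u hu => ?_⟩, fun u hu => ?_⟩
  -- Equivariance reduces to that of `γ`, which holds because `u = σ(proj u) γ(u)` and `γ` is
  -- determined on each fibre.
  · have h1 : γ (𝒢.act u p) = γ u * p := by
      conv_lhs => rw [← hγ₁ u hu.2, ← 𝒢.act_mul]
      exact hγ₂ _ hu.2 _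
    beta_reduce
    rw [𝒢.proj_act, h1, mul_inv_rev, pMat_mul, pMat_mul]
    simp only [Matrix.mul_assoc]
  · exact lift_conj _ (localLift_mem (hs.injective _ (hmem u hu)))
  · have h1 := (hs.isStrongAt_localLift (hmem u hu)).conj (γ u)
    rwa [← hV.1, hγ₁ u hu.2] at h1

end CartanGeometry

/-! ### Affine structures and global existence -/

namespace CartanGeometry

variable {n : ℕ}
  {EM : Type*} [NormedAddCommGroup EM] [NormedSpace ℝ EM]
  {M : Type*} [TopologicalSpace M] [ChartedSpace EM M]
  {EQ : Type*} [NormedAddCommGroup EQ] [NormedSpace ℝ EQ]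
  {Q : Type*} [TopologicalSpace Q] [ChartedSpace EQ Q] [IsManifold 𝓘(ℝ, EQ) ∞ Q]
  {𝒢 : CartanGeometry n EM M EQ Q} {r : ℕ} {V : Q → Submodule ℝ (Std n)} {U : Set M}
  {η η' : Q → Mat n}

lemma isPreferred_iff (hi : 𝒢.InjectiveOver U V) :
    𝒢.IsPreferred U V η ↔ 𝒢.IsWeyl U η ∧ ∀ u ∈ 𝒢.proj ⁻¹' U, IsPrefAt (V u) (η u) :=
  and_congr_right fun h => forall₂_congr fun u hu => muMap_eq_metricG_iff (hi u hu) (h.2 u hu)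

lemma isStronglyPreferred_iff (hi : 𝒢.InjectiveOver U V) :
    𝒢.IsStronglyPreferred U V η ↔ 𝒢.IsStrongWeyl U V η := by
  rw [IsStronglyPreferred, isPreferred_iff hi, IsStrongWeyl, and_assoc]
  refine and_congr_right fun h => ?_
  constructor
  · exact fun h' u hu => ⟨h'.1 u hu, (muA_inter_perpA_iff (hi u hu) (h.2 u hu) (h'.1 u hu)).1
      (h'.2 u hu)⟩
  · exact fun h' => ⟨fun u hu => (h' u hu).1, fun u hu =>
      (muA_inter_perpA_iff (hi u hu) (h.2 u hu) (h' u hu).1).2 (h' u hu).2⟩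

lemma IsAdjSection.sub (h : 𝒢.IsAdjSection U η) (h' : 𝒢.IsAdjSection U η') :
    𝒢.IsAdjSection U fun u => η u - η' u :=
  ⟨SmoothMat.sub h.1 h'.1, fun u hu p => by
    beta_reduce
    rw [h.2 u hu p, h'.2 u hu p, Matrix.mul_sub, Matrix.sub_mul]⟩

lemma IsAdjSection.add (h : 𝒢.IsAdjSection U η) (h' : 𝒢.IsAdjSection U η') :
    𝒢.IsAdjSection U fun u => η u + η' u :=
  ⟨SmoothMat.add h.1 h'.1, fun u hu p => by
    beta_reduce
    rw [h.2 u hu p, h'.2 u hu p, Matrix.mul_add, Matrix.add_mul]⟩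

/-- If a fibrewise condition on lifts of the grading element amounts to an affine condition with
model spaces `N u`, then so does the corresponding condition on Weyl structures. -/
lemma isWeyl_and_iff_isSectionOf (hη : 𝒢.IsWeyl U η) {N : Q → Submodule ℝ (Mat n)}
    (hN : ∀ u ∈ 𝒢.proj ⁻¹' U, N u ≤ nilAlg n) {C : Q → Mat n → Prop}
    (hC : ∀ u ∈ 𝒢.proj ⁻¹' U, ∀ E, E - gradEl n ∈ nilAlg n → (C u E ↔ E - η u ∈ N u)) :
    (𝒢.IsWeyl U η' ∧ ∀ u ∈ 𝒢.proj ⁻¹' U, C u (η' u)) ↔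
      𝒢.IsSectionOf U N fun u => η' u - η u := by
  constructor
  · rintro ⟨h, h'⟩
    exact ⟨h.1.sub hη.1, fun u hu => (hC u hu _ (h.2 u hu)).1 (h' u hu)⟩
  · rintro ⟨h, h'⟩
    have h1 : ∀ u ∈ 𝒢.proj ⁻¹' U, η' u - gradEl n ∈ nilAlg n := fun u hu => by
      have := (nilAlg n).add_mem (hN u hu (h' u hu)) (hη.2 u hu)
      rwa [sub_add_sub_cancel] at this
    refine ⟨⟨?_, h1⟩, fun u hu => (hC u hu _ (h1 u hu)).2 (h' u hu)⟩
    have := h.add hη.1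
    simpa only [sub_add_cancel] using this

lemma isPreferred_iff_isSectionOf (hi : 𝒢.InjectiveOver U V) (h : 𝒢.IsPreferred U V η) :
    𝒢.IsPreferred U V η' ↔ 𝒢.IsSectionOf U (modelPref V η) fun u => η' u - η u := by
  rw [isPreferred_iff hi] at h ⊢
  refine isWeyl_and_iff_isSectionOf h.1 (fun u hu => model_le_nilAlg (h.1.2 u hu) _ _)
    fun u hu E hE => ?_
  change _ ↔ _ ∈ modelPref V η u
  rw [modelPref_eq]
  exact isPrefAt_iff_sub_mem (h.1.2 u hu) hE (h.2 u hu)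

lemma isStronglyPreferred_iff_isSectionOf (hi : 𝒢.InjectiveOver U V)
    (h : 𝒢.IsStronglyPreferred U V η) :
    𝒢.IsStronglyPreferred U V η' ↔ 𝒢.IsSectionOf U (modelStrong V η) fun u => η' u - η u := by
  rw [isStronglyPreferred_iff hi] at h ⊢
  refine isWeyl_and_iff_isSectionOf h.1 (fun u hu => model_le_nilAlg (h.1.2 u hu) _ _)
    fun u hu E hE => ?_
  change _ ↔ _ ∈ modelStrong V η u
  rw [modelStrong_eq (hi u hu)]
  exact isStrongAt_iff_sub_mem (h.1.2 u hu) hE (h.2 u hu)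

/-- Relative to any one of the `E i`, strongly preferred lifts form a translate of a linear
subspace, so weights of sum `1` keep the condition. -/
lemma isStrongAt_sum {L : Submodule ℝ (Std n)} {ι : Type*} (S : Finset ι) (w : ι → ℝ)
    (E : ι → Mat n) (hw : ∑ i ∈ S, w i = 1) (hE : ∀ i ∈ S, E i - gradEl n ∈ nilAlg n)
    (h : ∀ i ∈ S, IsStrongAt L (E i)) :
    (∑ i ∈ S, w i • E i) - gradEl n ∈ nilAlg n ∧ IsStrongAt L (∑ i ∈ S, w i • E i) := by
  have hsub : ∀ F : Mat n, (∑ i ∈ S, w i • E i) - F = ∑ i ∈ S, w i • (E i - F) := fun F => by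
    simp only [smul_sub, Finset.sum_sub_distrib, ← Finset.sum_smul, hw, one_smul]
  have hnil : (∑ i ∈ S, w i • E i) - gradEl n ∈ nilAlg n := by
    rw [hsub]
    exact Submodule.sum_mem _ fun i hi => Submodule.smul_mem _ _ (hE i hi)
  obtain ⟨i₀, h₀⟩ : S.Nonempty := by
    rw [Finset.nonempty_iff_ne_empty]
    rintro rfl
    simp at hw
  refine ⟨hnil, (isStrongAt_iff_sub_mem (hE _ h₀) hnil (h _ h₀)).2 ?_⟩
  rw [hsub]
  exact Submodule.sum_mem _ fun i hi => Submodule.smul_mem _ _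
    ((isStrongAt_iff_sub_mem (hE _ h₀) (hE i hi) (h _ h₀)).1 (h i hi))

theorem exists_isStrongWeyl [FiniteDimensional ℝ EM] [T2Space M] [SecondCountableTopology M]
    [IsManifold 𝓘(ℝ, EM) ∞ M] (hV : 𝒢.IsSubbundle r V) (hU : IsOpen U)
    (hi : 𝒢.InjectiveOver U V) : ∃ η, 𝒢.IsStrongWeyl U V η := by
  classical
  -- The partition of unity lives on `U` as a manifold in its own right, because the local solutions
  -- cover only `U`. The value of `η` off the preimage of `U` is irrelevant.
  let O : TopologicalSpace.Opens M := ⟨U, hU⟩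
  have : LocallyCompactSpace O := Manifold.locallyCompact_of_finiteDimensional 𝓘(ℝ, EM)
  choose W hWU hW hxW E hE using fun x : O => exists_isStrongWeyl_local hV hU hi x.2
  obtain ⟨ρ, hρ⟩ := SmoothPartitionOfUnity.exists_isSubordinate 𝓘(ℝ, EM) (s := (Set.univ : Set O))
    isClosed_univ (fun x => ((↑) : O → M) ⁻¹' W x) (fun x => (hW x).preimage continuous_subtype_val)
    fun x _ => Set.mem_iUnion.2 ⟨x, hxW x⟩
  let η : Q → Mat n := fun u => if h : 𝒢.proj u ∈ U then
    ∑ x ∈ ρ.finsupport ⟨𝒢.proj u, h⟩, ρ x ⟨𝒢.proj u, h⟩ • E x u else 0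
  have hη : ∀ (u : Q) (h : 𝒢.proj u ∈ U),
      η u = ∑ x ∈ ρ.finsupport ⟨𝒢.proj u, h⟩, ρ x ⟨𝒢.proj u, h⟩ • E x u :=
    fun u h => dif_pos h
  have hmem : ∀ (y : O), ∀ x ∈ ρ.finsupport y, (y : M) ∈ W x := fun y x hx =>
    hρ x (subset_closure ((ρ.mem_finsupport y).1 hx))
  have hpt : ∀ u ∈ 𝒢.proj ⁻¹' U, η u - gradEl n ∈ nilAlg n ∧ IsStrongAt (V u) (η u) := by
    intro u hu
    rw [hη u hu]
    exact isStrongAt_sum _ _ _ (ρ.sum_finsupport _ (Set.mem_univ _))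
      (fun x hx => (hE x).1.2 u (hmem _ x hx)) fun x hx => (hE x).2 u (hmem _ x hx)
  refine ⟨η, ⟨⟨fun i j u₀ hu₀ => ?_, fun u hu p => ?_⟩, fun u hu => (hpt u hu).1⟩,
    fun u hu => (hpt u hu).2⟩
  · let y₀ : O := ⟨𝒢.proj u₀, hu₀⟩
    -- Extension by zero makes the weights functions on `M`. Only smoothness at points of the open
    -- set `U` is needed, so nothing is claimed at its boundary.
    let ρ' : O → M → ℝ := fun x y => if h : y ∈ U then ρ x ⟨y, h⟩ else 0
    have hρ' : ∀ x (y : O), ρ' x y = ρ x y := fun x y => dif_pos y.2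
    -- The set of indices in the sum varies with the point; near `u₀` it is contained in one fixed
    -- finite set, and the added terms are zero.
    have hev : ∀ᶠ u in 𝓝 u₀, η u i j = ∑ x ∈ ρ.fintsupport y₀, ρ' x (𝒢.proj u) * E x u i j := by
      have h1 : ∀ᶠ y in 𝓝 (𝒢.proj u₀), ∃ h : y ∈ U, ρ.finsupport ⟨y, h⟩ ⊆ ρ.fintsupport y₀ := by
        have := ρ.eventually_finsupport_subset y₀
        rw [show 𝓝 (𝒢.proj u₀) = Filter.map ((↑) : O → M) (𝓝 y₀) from
          (hU.isOpenEmbedding_subtypeVal.map_nhds_eq y₀).symm, Filter.eventually_map]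
        exact this.mono fun y hy => ⟨y.2, hy⟩
      filter_upwards [𝒢.contMDiff_proj.continuous.continuousAt.eventually h1]
      rintro u ⟨h, h2⟩
      rw [hη u h, Matrix.sum_apply]
      have h3 : ∀ x, ρ' x (𝒢.proj u) = ρ x ⟨𝒢.proj u, h⟩ := fun x => hρ' x ⟨_, h⟩
      simp only [Matrix.smul_apply, smul_eq_mul, h3]
      refine Finset.sum_subset h2 fun x _ hx => ?_
      rw [ρ.mem_finsupport, Function.mem_support, not_not] at hx
      rw [hx, zero_mul]
    refine (ContMDiffAt.congr_of_eventuallyEq (ContMDiffAt.sum fun x hx => ?_) hev).contMDiffWithinAt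
    have hx : (y₀ : M) ∈ W x := hρ x ((ρ.mem_fintsupport_iff y₀ x).1 hx)
    refine ContMDiffAt.mul ?_ (((hE x).1.1.1 i j).contMDiffAt
      ((𝒢.isOpen_preimage (hW x)).mem_nhds hx))
    refine ContMDiffAt.comp u₀ (g := ρ' x) (I' := 𝓘(ℝ, EM)) ?_ 𝒢.contMDiff_proj.contMDiffAt
    refine (contMDiffAt_subtype_iff (U := O) (x := y₀)).1 ?_
    simp only [hρ']
    exact (ρ x).contMDiff.contMDiffAt
  · have hup : 𝒢.proj (𝒢.act u p) ∈ U := by rw [𝒢.proj_act]; exact hu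
    rw [hη _ hup, hη u hu]
    have h1 : (⟨𝒢.proj (𝒢.act u p), hup⟩ : O) = ⟨𝒢.proj u, hu⟩ := Subtype.ext (𝒢.proj_act u p)
    rw [h1, Matrix.mul_sum, Matrix.sum_mul]
    refine Finset.sum_congr rfl fun x hx => ?_
    rw [(hE x).1.1.2 u (hmem _ x hx) p, Matrix.mul_smul, Matrix.smul_mul]

end CartanGeometry

/-! ### Linear ordinary differential equations -/

section ODE

variable {E : Type*} [NormedAddCommGroup E] [NormedSpace ℝ E] {A : ℝ → E →L[ℝ] E} {T : Set ℝ}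

lemma exists_linear_bound (hT : T ∈ 𝓝 0) (hA : ContinuousOn A T) :
    ∃ K : NNReal, ∀ᶠ t in 𝓝 0, ‖A t‖₊ ≤ K := by
  have h := (hA.continuousAt hT).nnnorm
  refine ⟨‖A 0‖₊ + 1, ?_⟩
  exact (h.eventually (eventually_lt_nhds (lt_add_one ‖A 0‖₊))).mono fun t ht => le_of_lt ht

lemma exists_linear_solution [CompleteSpace E] (hT : T ∈ 𝓝 0) (hA : ContinuousOn A T) (x₀ : E) :
    ∃ x : ℝ → E, x 0 = x₀ ∧ ∀ᶠ t in 𝓝 0, HasDerivAt x (A t (x t)) t := by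
  obtain ⟨K, hK⟩ := exists_linear_bound hT hA
  obtain ⟨ε, hε, h⟩ := Metric.eventually_nhds_iff_ball.1 (hK.and hT)
  -- A bound for `A t x` on the unit ball around `x₀`; then `δ` is taken so small that solutions of
  -- speed at most `L` stay in that ball.
  set L : NNReal := K * (‖x₀‖₊ + 1) with hL
  obtain ⟨δ, hδ, hδε, hLδ⟩ : ∃ δ : ℝ, 0 < δ ∧ δ < ε ∧ L * δ ≤ 1 := by
    refine ⟨min (ε / 2) (1 / (L + 1)), by positivity, ?_, ?_⟩
    · exact (min_le_left _ _).trans_lt (by linarith)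
    · calc (L : ℝ) * min (ε / 2) (1 / (L + 1)) ≤ L * (1 / (L + 1)) := by
            gcongr; exact min_le_right _ _
        _ ≤ 1 := by
            rw [mul_one_div, div_le_one (by positivity)]
            linarith
  have hsub : Set.Icc (-δ) δ ⊆ Metric.ball 0 ε := fun t ht => by
    rw [Metric.mem_ball, dist_zero_right, Real.norm_eq_abs, abs_lt]
    exact ⟨by linarith [ht.1], by linarith [ht.2]⟩
  have hp : IsPicardLindelof (fun t x => A t x) (tmin := -δ) (tmax := δ) ⟨0, by simp [hδ.le]⟩
      x₀ 1 0 L K := by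
    refine ⟨fun t ht => ?_, fun x _ => ?_, fun t ht x hx => ?_, ?_⟩
    · exact ((A t).lipschitz.weaken (h t (hsub ht)).1).lipschitzOnWith
    · exact (hA.mono fun t ht => (h t (hsub ht)).2).clm_apply continuousOn_const
    · have hx' : ‖x‖ ≤ ‖x₀‖ + 1 := by
        rw [mem_closedBall_iff_norm] at hx
        have := norm_add_le x₀ (x - x₀)
        rw [add_sub_cancel] at this
        simp only [NNReal.coe_one] at hx
        linarith
      have h1 : ‖A t‖ ≤ K := (h t (hsub ht)).1
      calc ‖A t x‖ ≤ ‖A t‖ * ‖x‖ := (A t).le_opNorm x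
        _ ≤ K * (‖x₀‖ + 1) := by gcongr
        _ = L := by rw [hL]; push_cast; rfl
    · simpa using hLδ
  obtain ⟨x, hx, h'⟩ := hp.exists_eq_forall_mem_Icc_hasDerivWithinAt₀
  refine ⟨x, hx, ?_⟩
  filter_upwards [Ioo_mem_nhds (neg_lt_zero.2 hδ) hδ] with t ht
  exact (h' t (Set.Ioo_subset_Icc_self ht)).hasDerivAt (Icc_mem_nhds ht.1 ht.2)

lemma linear_solution_eq_zero (hT : T ∈ 𝓝 0) (hA : ContinuousOn A T) {x : ℝ → E} (h0 : x 0 = 0)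
    (hx : ∀ᶠ t in 𝓝 0, HasDerivAt x (A t (x t)) t) : ∀ᶠ t in 𝓝 0, x t = 0 := by
  obtain ⟨K, hK⟩ := exists_linear_bound hT hA
  exact ODE_solution_unique_of_eventually (v := fun t x => A t x) (s := fun _ => Set.univ) (g := 0)
    (hK.mono fun t ht => ((A t).lipschitz.weaken ht).lipschitzOnWith)
    (hx.mono fun t ht => ⟨ht, trivial⟩)
    (.of_forall fun t => ⟨by simp, trivial⟩) h0

end ODE

section matrixODE

variable {r : ℕ} {B : ℝ → Matrix (Fin r) (Fin r) ℝ} {T : Set ℝ}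

/-- The continuous linear map of a matrix. -/
def matCLM (r : ℕ) : Matrix (Fin r) (Fin r) ℝ →ₗ[ℝ] ((Fin r → ℝ) →L[ℝ] (Fin r → ℝ)) :=
  LinearMap.toContinuousLinearMap.toLinearMap ∘ₗ Matrix.toLin'.toLinearMap

@[simp] lemma matCLM_apply (b : Matrix (Fin r) (Fin r) ℝ) (x : Fin r → ℝ) :
    matCLM r b x = b *ᵥ x := rfl

lemma continuousOn_matCLM (hB : ∀ i j, ContinuousOn (fun t => B t i j) T) :
    ContinuousOn (fun t => matCLM r (B t)) T :=
  (LinearMap.continuous_of_finiteDimensional (matCLM r)).comp_continuousOn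
    (continuousOn_pi.2 fun i => continuousOn_pi.2 fun j => hB i j)

end matrixODE

/-! ### Curves in the total space -/

section Curve

variable {EQ : Type*} [NormedAddCommGroup EQ] [NormedSpace ℝ EQ]
  {Q : Type*} [TopologicalSpace Q] [ChartedSpace EQ Q]

/-- The velocity of a curve. -/
def velocity (c : ℝ → Q) (t : ℝ) : TangentSpace 𝓘(ℝ, EQ) (c t) :=
  mfderiv 𝓘(ℝ, ℝ) 𝓘(ℝ, EQ) c t (1 : ℝ)

lemma hasDerivAt_comp_curve {F : Type*} [NormedAddCommGroup F] [NormedSpace ℝ F] {c : ℝ → Q}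
    {t : ℝ} {f : Q → F} (hc : MDifferentiableAt 𝓘(ℝ, ℝ) 𝓘(ℝ, EQ) c t)
    (hf : MDifferentiableAt 𝓘(ℝ, EQ) 𝓘(ℝ, F) f (c t)) :
    HasDerivAt (fun τ => f (c τ)) (CartanGeometry.dirDeriv (EQ := EQ) f (c t) (velocity c t)) t := by
  have h := hf.hasMFDerivAt.comp t hc.hasMFDerivAt
  let D : ℝ →L[ℝ] F :=
    (mfderiv 𝓘(ℝ, EQ) 𝓘(ℝ, F) f (c t)).comp (mfderiv 𝓘(ℝ, ℝ) 𝓘(ℝ, EQ) c t)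
  have h' : HasFDerivAt (fun τ => f (c τ)) D t := hasMFDerivAt_iff_hasFDerivAt.1 h
  exact h'.hasDerivAt

/-- The curve is a straight line in the chart at `u`. It reduces later derivatives along `ξ` to
derivatives in one variable. -/
lemma exists_curve [IsManifold 𝓘(ℝ, EQ) ∞ Q] (u : Q) (ξ : TangentSpace 𝓘(ℝ, EQ) u) :
    ∃ c : ℝ → Q, c 0 = u ∧ (velocity c 0 : EQ) = (ξ : EQ) ∧ ∃ T : Set ℝ, IsOpen T ∧ 0 ∈ T ∧
      ContMDiffOn 𝓘(ℝ, ℝ) 𝓘(ℝ, EQ) ∞ c T := by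
  let φ := extChartAt 𝓘(ℝ, EQ) u
  let e : EQ := ξ
  let ℓ : ℝ → EQ := fun t => φ u + t • e
  have hℓ : ContDiff ℝ ∞ ℓ := contDiff_const.add (contDiff_id.smul contDiff_const)
  have hℓ0 : ℓ 0 = φ u := by simp [ℓ]
  have hT : IsOpen (ℓ ⁻¹' φ.target) := (isOpen_extChartAt_target u).preimage hℓ.continuous
  have h0 : (0 : ℝ) ∈ ℓ ⁻¹' φ.target := by
    rw [Set.mem_preimage, hℓ0]; exact mem_extChartAt_target u
  have hsm : ContMDiffOn 𝓘(ℝ, ℝ) 𝓘(ℝ, EQ) ∞ (fun t => φ.symm (ℓ t)) (ℓ ⁻¹' φ.target) :=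
    (contMDiffOn_extChartAt_symm u).comp hℓ.contMDiff.contMDiffOn fun t ht => ht
  have hc0 : φ.symm (ℓ 0) = u := by rw [hℓ0]; exact extChartAt_to_inv u
  refine ⟨fun t => φ.symm (ℓ t), hc0, ?_, _, hT, h0, hsm⟩
  have hd : HasMFDerivAt 𝓘(ℝ, ℝ) 𝓘(ℝ, EQ) (fun t => φ.symm (ℓ t)) 0
      (ContinuousLinearMap.toSpanSingleton ℝ e) := by
    refine ⟨(hsm.contMDiffAt (hT.mem_nhds h0)).continuousAt, ?_⟩
    -- The derivative at `0` is read in the same chart at `u` that defined the curve, so the curve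
    -- becomes the line `ℓ`.
    rw [writtenInExtChartAt, hc0]
    have h1 : HasFDerivAt ℓ (ContinuousLinearMap.toSpanSingleton ℝ e) 0 := by
      have : HasDerivAt ℓ e 0 := by
        have := ((hasDerivAt_id (0 : ℝ)).smul_const e).const_add (φ u)
        rw [one_smul] at this
        exact this
      exact this.hasFDerivAt
    refine (h1.congr_of_eventuallyEq ?_).hasFDerivWithinAt
    filter_upwards [hT.mem_nhds h0] with t ht
    exact φ.right_inv ht
  rw [velocity, hd.mfderiv]
  exact one_smul ℝ e

lemma continuousOn_velocity [IsManifold 𝓘(ℝ, EQ) ∞ Q] {c : ℝ → Q} {T : Set ℝ} (hT : IsOpen T)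
    (hc : ContMDiffOn 𝓘(ℝ, ℝ) 𝓘(ℝ, EQ) ∞ c T) :
    ContinuousOn (fun t => (⟨c t, velocity c t⟩ : TangentBundle 𝓘(ℝ, EQ) Q)) T := by
  have : IsManifold 𝓘(ℝ, EQ) 1 Q := IsManifold.of_le (n := ∞) (by norm_num)
  have h1 := hc.continuousOn_tangentMapWithin (by norm_num) hT.uniqueMDiffOn
  have h2 : Continuous fun t : ℝ => (⟨t, (1 : ℝ)⟩ : TangentBundle 𝓘(ℝ, ℝ) ℝ) :=
    (tangentBundleModelSpaceHomeomorph 𝓘(ℝ, ℝ)).symm.continuous.comp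
      (continuous_id.prodMk continuous_const)
  refine (h1.comp h2.continuousOn fun t ht => ht).congr fun t ht => ?_
  simp only [Function.comp, tangentMapWithin, velocity]
  rw [mfderivWithin_of_isOpen hT ht]

end Curve

/-! ### The action of `𝔤` on the three components of a tractor -/

section Algebra

variable {n : ℕ}

lemma piV_mulVec {a : Mat n} (ha : a ∈ gAlg n) (t : Std n) :
    piV (a *ᵥ t) = -((blk0 a)ᵀ *ᵥ piV t) + t iR • blk1 a - blk2 a *ᵥ piH n t := by
  funext i
  have h := gAlg_iV_iV ha
  simp only [piV_apply, Matrix.mulVec, dotProduct, Fintype.sum_sum_type, h, blk0, blk1, blk2,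
    Matrix.transpose_apply, Matrix.of_apply, Pi.add_apply, Pi.sub_apply, Pi.neg_apply,
    Pi.smul_apply, smul_eq_mul, neg_mul, Finset.sum_neg_distrib, Finset.univ_unique,
    Finset.sum_singleton, piH_apply]
  simp only [show (default : Unit) = () from rfl]
  ring

lemma iR_mulVec {a : Mat n} (ha : a ∈ gAlg n) (t : Std n) :
    (a *ᵥ t) iR = -(blkM1 a ⬝ᵥ piV t) - blk1 a ⬝ᵥ piH n t := by
  have h1 := gAlg_iR_iV ha
  have h2 := gAlg_iR_iH ha
  simp only [Matrix.mulVec, dotProduct, Fintype.sum_sum_type, h1, h2, blkM1, blk1,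
    Finset.univ_unique, Finset.sum_singleton, piH_apply, piV_apply, neg_mul,
    Finset.sum_neg_distrib]
  simp only [show (default : Unit) = () from rfl, gAlg_iR_iR ha]
  ring

lemma piH_mulVec (a : Mat n) (t : Std n) :
    piH n (a *ᵥ t) = blkM2 a *ᵥ piV t + t iR • blkM1 a + blk0 a *ᵥ piH n t := by
  funext i
  simp only [piV_apply, piH_apply, Matrix.mulVec, dotProduct, Fintype.sum_sum_type, blk0, blkM1,
    blkM2, Matrix.of_apply, Pi.add_apply, Pi.smul_apply, smul_eq_mul, Finset.univ_unique,
    Finset.sum_singleton]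
  simp only [show (default : Unit) = () from rfl]
  ring

lemma blkM2_transpose {a : Mat n} (ha : a ∈ gAlg n) : (blkM2 a)ᵀ = -blkM2 a := by
  ext i j
  exact mem_gAlg_iff.1 ha (iV i) (iV j)

lemma blk2_transpose {a : Mat n} (ha : a ∈ gAlg n) : (blk2 a)ᵀ = -blk2 a := by
  ext i j
  simp only [blk2, Matrix.transpose_apply, Matrix.of_apply, Matrix.neg_apply, neg_inj]
  exact mem_gAlg_iff.1 ha (iH i) (iH j)

lemma gradEl_eq (n : ℕ) : gradEl n = gradEl n + nilM 0 0 := by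
  have : nilM (0 : Fin n → ℝ) 0 = 0 := by
    ext x y
    rcases x with i | _ | i <;> rcases y with j | _ | j <;> simp [nilM]
  rw [this, add_zero]

lemma gradEl_lift (n : ℕ) : gradEl n - gradEl n ∈ nilAlg n := by
  rw [sub_self]; exact Submodule.zero_mem _

lemma piV_projP_gradEl (t : Std n) : piV (projP (gradEl n) *ᵥ t) = piV t := by
  rw [gradEl_eq, piV_projP]
  simp

lemma metricH_projP_gradEl (t s : Std n) :
    metricH (projP (gradEl n) *ᵥ t) s = (1 / 2) * (piV t ⬝ᵥ piH n s) := by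
  rw [metricH_projP_of_lift (gradEl_lift n), piV_projP_gradEl]

lemma IsPrefAt.iR_eq_of_lift {L : Submodule ℝ (Std n)} {E : Mat n} (hE : E - gradEl n ∈ nilAlg n)
    (h : IsPrefAt L E) {t : Std n} (ht : t ∈ L) : t iR = (fun i => E (iV i) iR) ⬝ᵥ piH n t := by
  obtain ⟨b, c, hc, rfl⟩ := exists_eq_of_lift hE
  rw [h.iR_eq hc ht]
  congr 1
  funext i
  simp [gradEl, nilM]

lemma IsPrefAt.iR_eq_zero {L : Submodule ℝ (Std n)} (h : IsPrefAt L (gradEl n)) {t : Std n}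
    (ht : t ∈ L) : t iR = 0 := by
  rw [h.iR_eq_of_lift (gradEl_lift n) ht]
  simp [gradEl]

/-- The relations between the blocks of an element of `𝔤` that infinitesimally preserves the
conditions on a preferred connection. -/
lemma block_relation {L : Submodule ℝ (Std n)} (hL : IsPrefAt L (gradEl n)) {a : Mat n}
    (ha : a ∈ gAlg n) {t s : Std n} (ht : t ∈ L) (hs : s ∈ L)
    (h : metricH (projP (gradEl n) *ᵥ (a *ᵥ t)) s
      + metricH (projP (gradEl n) *ᵥ t) (a *ᵥ s) = 0) :
    (blk2 a *ᵥ piH n t) ⬝ᵥ piH n s = piV t ⬝ᵥ (blkM2 a *ᵥ piV s) := by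
  rw [metricH_projP_gradEl, metricH_projP_gradEl, piV_mulVec ha, piH_mulVec, hL.iR_eq_zero ht,
    hL.iR_eq_zero hs] at h
  simp only [zero_smul, add_zero, sub_dotProduct, neg_dotProduct, dotProduct_add] at h
  -- The two `𝔤_0` terms cancel, since the actions on `H` and `H*` are dual; only degrees `2` and
  -- `-2` remain.
  rw [dotProduct_mulVec_transpose (blk0 a)] at h
  linarith

end Algebra

/-! ### Derivatives along curves -/

section Deriv

variable {n : ℕ} {x : ℝ}

lemma hasDerivAt_metricH {f g : ℝ → Std n} {f' g' : Std n} (hf : HasDerivAt f f' x)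
    (hg : HasDerivAt g g' x) :
    HasDerivAt (fun τ => metricH (f τ) (g τ)) (metricH f' (g x) + metricH (f x) g') x := by
  rw [hasDerivAt_pi] at hf hg
  have h : ∀ s t : Std n, metricH s t = (1 / 2) * ∑ a, s a * t (dualIdx a) := fun s t => by
    simp only [metricH, dotProduct, gramJ_mulVec]
  simp only [h]
  rw [← mul_add, ← Finset.sum_add_distrib]
  exact (HasDerivAt.fun_sum fun a _ => (hf a).mul (hg (dualIdx a))).const_mul (1 / 2)

/-- Along a direction tangent to the reduction the splitting is constant to first order, so the
projection passes through the derivative. -/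
lemma hasDerivAt_projP_mulVec {e : ℝ → Mat n} {f : ℝ → Std n} {f' : Std n}
    (he : ∀ i j, HasDerivAt (fun τ => e τ i j) 0 x) (hf : HasDerivAt f f' x) :
    HasDerivAt (fun τ => projP (e τ) *ᵥ f τ) (projP (e x) *ᵥ f') x := by
  rw [hasDerivAt_pi] at hf ⊢
  have hP : ∀ i j, HasDerivAt (fun τ => projP (e τ) i j) 0 x := fun i j => by
    have := ((HasDerivAt.fun_sum fun k (_ : k ∈ Finset.univ) => (he i k).mul (he k j)).add
      (he i j)).const_mul (1 / 2 : ℝ)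
    simpa [projP, Matrix.mul_apply] using this
  intro i
  have := HasDerivAt.fun_sum fun j (_ : j ∈ Finset.univ) => (hP i j).mul (hf j)
  simpa [Matrix.mulVec, dotProduct] using this

end Deriv

/-! ### Sections of `V` and differentiation of the preferred condition -/

namespace CartanGeometry

variable {n : ℕ}
  {EM : Type*} [NormedAddCommGroup EM] [NormedSpace ℝ EM]
  {M : Type*} [TopologicalSpace M] [ChartedSpace EM M]
  {EQ : Type*} [NormedAddCommGroup EQ] [NormedSpace ℝ EQ]
  {Q : Type*} [TopologicalSpace Q] [ChartedSpace EQ Q] [IsManifold 𝓘(ℝ, EQ) ∞ Q]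
  {𝒢 : CartanGeometry n EM M EQ Q} {r : ℕ} {V : Q → Submodule ℝ (Std n)} {U W : Set M}
  {η : Q → Mat n}

lemma IsTractorSection.mdifferentiableAt (hW : IsOpen W) {t : Q → Std n}
    (ht : 𝒢.IsTractorSection W t) {u : Q} (hu : u ∈ 𝒢.proj ⁻¹' W) :
    MDifferentiableAt 𝓘(ℝ, EQ) 𝓘(ℝ, Std n) t u :=
  (ht.1.contMDiffAt ((𝒢.isOpen_preimage hW).mem_nhds hu)).mdifferentiableAt (by norm_num)

lemma IsAdjSection.mdifferentiableAt (hU : IsOpen U) (hη : 𝒢.IsAdjSection U η) {u : Q}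
    (hu : u ∈ 𝒢.proj ⁻¹' U) (i j : Idx n) :
    MDifferentiableAt 𝓘(ℝ, EQ) 𝓘(ℝ, ℝ) (fun u => η u i j) u :=
  ((hη.1 i j).contMDiffAt ((𝒢.isOpen_preimage hU).mem_nhds hu)).mdifferentiableAt (by norm_num)

/-- Sections of `V` over `W`. -/
def IsSectionIn (𝒢 : CartanGeometry n EM M EQ Q) (W : Set M) (V : Q → Submodule ℝ (Std n))
    (t : Q → Std n) : Prop :=
  𝒢.IsTractorSection W t ∧ ∀ u ∈ 𝒢.proj ⁻¹' W, t u ∈ V u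

lemma IsFrame.isSectionIn_sum {s : Fin r → Q → Std n} (h : 𝒢.IsFrame V W s) (x : Fin r → ℝ) :
    𝒢.IsSectionIn W V fun u => ∑ k, x k • s k u := by
  refine ⟨⟨?_, fun u hu p => ?_⟩, fun u hu => h.sum_mem hu x⟩
  · refine contMDiffOn_finsetSum fun k _ => ?_
    have hk : ContMDiffOn 𝓘(ℝ, EQ) 𝓘(ℝ, ℝ) ∞ (fun _ : Q => x k) (𝒢.proj ⁻¹' W) :=
      contMDiffOn_const
    exact hk.smul (h.isSection k).1
  · rw [Matrix.mulVec_sum]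
    refine Finset.sum_congr rfl fun k _ => ?_
    rw [(h.isSection k).2 u hu p, Matrix.mulVec_smul]

lemma exists_isSectionIn (hV : 𝒢.IsSubbundle r V) (hU : IsOpen U) (hi : 𝒢.InjectiveOver U V)
    {u : Q} (hu : u ∈ 𝒢.proj ⁻¹' U) :
    ∃ W ⊆ U, IsOpen W ∧ u ∈ 𝒢.proj ⁻¹' W ∧
      ∀ t₀ ∈ V u, ∃ t, 𝒢.IsSectionIn W V t ∧ t u = t₀ := by
  obtain ⟨W, hWU, hxW, s, hs⟩ := exists_isFrame hV hU hi hu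
  refine ⟨W, hWU, hs.isOpen, hxW, fun t₀ ht₀ => ?_⟩
  obtain ⟨x, hx⟩ := hs.exists_eq u hxW t₀ ht₀
  exact ⟨_, hs.isSectionIn_sum x, hx.symm⟩

/-- Smoothness holds because the coefficients in a frame are `(XᵀX)⁻¹ Xᵀ` applied to the section;
equivariance holds because the lift to `V` is unique. -/
lemma IsASection.isSectionIn_liftA (hV : 𝒢.IsSubbundle r V) (hU : IsOpen U)
    (hi : 𝒢.InjectiveOver U V) (hW : IsOpen W) (hWU : W ⊆ U) {X : Q → Fin n → ℝ}
    (hX : 𝒢.IsASection W V X) : 𝒢.IsSectionIn W V fun u => liftA V u (X u) := by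
  refine ⟨⟨fun u₀ hu₀ => ?_, fun u hu p => ?_⟩, fun u hu => (liftA_mem (hX.2 u hu)).1⟩
  · obtain ⟨W', hW'U, hxW', s, hs⟩ := exists_isFrame hV hU hi (hWU hu₀)
    have ho : IsOpen (W ∩ W') := hW.inter hs.isOpen
    have hs := hs.mono ho Set.inter_subset_right
    have hXs : ∀ i, ContMDiffOn 𝓘(ℝ, EQ) 𝓘(ℝ, ℝ) ∞ (fun u => X u i) (𝒢.proj ⁻¹' (W ∩ W')) :=
      fun i => (contMDiffOn_pi_space.1 hX.1.1 i).mono (Set.preimage_mono Set.inter_subset_left)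
    have h1 : ContMDiffOn 𝓘(ℝ, EQ) 𝓘(ℝ, Std n) ∞
        (fun u => ∑ k, (IsFrame.coeff s u *ᵥ X u) k • s k u) (𝒢.proj ⁻¹' (W ∩ W')) :=
      contMDiffOn_finsetSum fun k _ =>
        (hs.smooth_coeff.mulVec hXs k).smul (hs.isSection k).1
    have h2 := h1.congr (f₁ := fun u => liftA V u (X u)) fun u hu => by
      have := hs.eq_sum_coeff hu (liftA_mem (hX.2 u hu.1)).1
      rwa [(liftA_mem (hX.2 u hu.1)).2] at this
    exact (h2.contMDiffAt ((𝒢.isOpen_preimage ho).mem_nhds ⟨hu₀, hxW'⟩)).contMDiffWithinAt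
  · have h1 := liftA_mem (hX.2 u hu)
    have h2 : pMat p⁻¹ *ᵥ liftA V u (X u) ∈ V (𝒢.act u p) := by
      rw [hV.1]; exact ⟨_, h1.1, rfl⟩
    have hup : 𝒢.act u p ∈ 𝒢.proj ⁻¹' U := by
      rw [Set.mem_preimage, 𝒢.proj_act]; exact hWU hu
    have h3 := liftA_piH (hi _ hup) h2
    rwa [piH_pMat_mulVec, h1.2, ← hX.1.2 u hu p] at h3

/-- The relations satisfied at a point of the reduction, if the tractor connection preserves
`V`. -/
lemma connection_relations (hpres : 𝒢.PreservedOver U V)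
    (hη : 𝒢.IsWeyl U η ∧ ∀ u ∈ 𝒢.proj ⁻¹' U, IsPrefAt (V u) (η u))
    (hW : IsOpen W) (hWU : W ⊆ U) {t s : Q → Std n} (ht : 𝒢.IsSectionIn W V t)
    (hs : 𝒢.IsSectionIn W V s) {u : Q} (hu : u ∈ 𝒢.proj ⁻¹' W) {ξ : TangentSpace 𝓘(ℝ, EQ) u}
    (hξ : 𝒢.TangentToReduction η u ξ) :
    metricH (projP (gradEl n) *ᵥ ((𝒢.cform u ξ : Mat n) *ᵥ t u)) (s u)
      + metricH (projP (gradEl n) *ᵥ t u) ((𝒢.cform u ξ : Mat n) *ᵥ s u) = 0 ∧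
    ((𝒢.cform u ξ : Mat n) *ᵥ t u) iR = 0 := by
  obtain ⟨c, hc0, hv, T, hT, h0, hc⟩ := exists_curve u ξ
  subst hc0
  obtain rfl : ξ = velocity c 0 := hv.symm
  obtain ⟨hE, hξ⟩ := hξ
  have hg := (𝒢.cform (c 0) (velocity c 0)).2
  set a : Mat n := (𝒢.cform (c 0) (velocity c 0) : Mat n) with ha
  have hcd : MDifferentiableAt 𝓘(ℝ, ℝ) 𝓘(ℝ, EQ) c 0 :=
    (hc.contMDiffAt (hT.mem_nhds h0)).mdifferentiableAt (by norm_num)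
  have hev : ∀ᶠ τ in 𝓝 0, c τ ∈ 𝒢.proj ⁻¹' W :=
    hcd.continuousAt.eventually ((𝒢.isOpen_preimage hW).mem_nhds hu)
  have ft := hasDerivAt_comp_curve hcd (ht.1.mdifferentiableAt hW hu)
  have fs := hasDerivAt_comp_curve hcd (hs.1.mdifferentiableAt hW hu)
  have fη : ∀ i j, HasDerivAt (fun τ => η (c τ) i j) 0 0 := fun i j => by
    have hη' : 𝒢.IsAdjSection W η :=
      ⟨fun i j => (hη.1.1.1 i j).mono (Set.preimage_mono hWU), fun u hu => hη.1.1.2 u (hWU hu)⟩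
    have h := hasDerivAt_comp_curve hcd (hη'.mdifferentiableAt hW hu i j)
    rwa [hξ i j] at h
  have ht' := hpres W hW hWU t ht.1 ht.2 (c 0) hu (velocity c 0)
  have hs' := hpres W hW hWU s hs.1 hs.2 (c 0) hu (velocity c 0)
  have hpref : IsPrefAt (V (c 0)) (gradEl n) := by
    have := hη.2 (c 0) (hWU hu)
    rwa [hE] at this
  rw [tractorDeriv, ← ha] at ht' hs'
  set Dt := dirDeriv (EQ := EQ) t (c 0) (velocity c 0)
  set Ds := dirDeriv (EQ := EQ) s (c 0) (velocity c 0)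
  constructor
  · have h1 := (hasDerivAt_metricH (hasDerivAt_projP_mulVec fη ft) fs).const_mul 2
    have h2 := hasDerivAt_metricH ft fs
    have h3 : (fun τ => 2 * metricH (projP (η (c τ)) *ᵥ t (c τ)) (s (c τ))) =ᶠ[𝓝 0]
        fun τ => metricH (t (c τ)) (s (c τ)) := hev.mono fun τ hτ =>
      hη.2 _ (hWU hτ) _ (ht.2 _ hτ) _ (hs.2 _ hτ)
    have h4 := h1.unique (h2.congr_of_eventuallyEq h3)
    rw [hE] at h4
    -- The tractor derivatives lie in `V` and satisfy the preferred condition. Subtracting its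
    -- derivative `h4` leaves only terms in `a`, and the right-hand sides cancel because `a` is skew
    -- for the metric.
    have h5 := hpref _ ht' _ (hs.2 _ hu)
    have h6 := hpref _ (ht.2 _ hu) _ hs'
    have h7 := metricH_mulVec_left hg (t (c 0)) (s (c 0))
    simp only [Matrix.mulVec_add, ← metricB_apply, map_add, LinearMap.add_apply] at *
    linarith
  · have h1 := hasDerivAt_pi.1 ft iR
    have h2 := HasDerivAt.fun_sum fun i (_ : i ∈ Finset.univ) =>
      (fη (iV i) iR).mul (hasDerivAt_pi.1 ft (iH i))
    have h3 : (fun τ => t (c τ) iR) =ᶠ[𝓝 0] fun τ => ∑ i, η (c τ) (iV i) iR * t (c τ) (iH i) :=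
      hev.mono fun τ hτ => (hη.2 _ (hWU hτ)).iR_eq_of_lift (hη.1.2 _ (hWU hτ)) (ht.2 _ hτ)
    -- At a point of the reduction `b` is zero together with its derivative along `ξ`, so the middle
    -- component of `t` has derivative zero.
    have h4 := h1.unique (HasDerivAt.congr_of_eventuallyEq h2 h3)
    have h5 := hpref.iR_eq_zero ht'
    rw [Pi.add_apply, h4] at h5
    have h6 : ∀ i : Fin n, gradEl n (iV i) iR = 0 := fun i => by
      simp [gradEl]
    simpa [hE, h6] using h5

end CartanGeometry

lemma mulVec_mem_of_mem_wedgeSpan {n : ℕ} {A : Submodule ℝ (Fin n → ℝ)}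
    {Z : Matrix (Fin n) (Fin n) ℝ} (hZ : Z ∈ wedgeSpan A A) (v : Fin n → ℝ) : Z *ᵥ v ∈ A := by
  induction hZ using Submodule.span_induction with
  | mem w h =>
    obtain ⟨α, hα, β, hβ, rfl⟩ := h
    rw [wedge_mulVec]
    exact A.sub_mem (A.smul_mem _ hβ) (A.smul_mem _ hα)
  | zero => simp
  | add a b _ _ ha hb => rw [Matrix.add_mulVec]; exact A.add_mem ha hb
  | smul c a _ ha => rw [Matrix.smul_mulVec]; exact A.smul_mem c ha

lemma mulVec_eq_zero_of_mem_wedgeSpan {n : ℕ} {S : Set (Fin n → ℝ)}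
    {Z : Matrix (Fin n) (Fin n) ℝ} (hZ : Z ∈ wedgeSpan (perp S) (perp S)) {v : Fin n → ℝ}
    (hv : v ∈ S) : Z *ᵥ v = 0 := by
  induction hZ using Submodule.span_induction with
  | mem w h =>
    obtain ⟨α, hα, β, hβ, rfl⟩ := h
    rw [wedge_mulVec, hα v hv, hβ v hv]
    simp
  | zero => simp
  | add a b _ _ ha hb => rw [Matrix.add_mulVec, ha, hb, add_zero]
  | smul c a _ ha => rw [Matrix.smul_mulVec, ha, smul_zero]

namespace CartanGeometry

variable {n : ℕ}
  {EM : Type*} [NormedAddCommGroup EM] [NormedSpace ℝ EM]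
  {M : Type*} [TopologicalSpace M] [ChartedSpace EM M]
  {EQ : Type*} [NormedAddCommGroup EQ] [NormedSpace ℝ EQ]
  {Q : Type*} [TopologicalSpace Q] [ChartedSpace EQ Q] [IsManifold 𝓘(ℝ, EQ) ∞ Q]
  {𝒢 : CartanGeometry n EM M EQ Q} {r : ℕ} {V : Q → Submodule ℝ (Std n)} {U W : Set M}
  {η : Q → Mat n}

/-! ### Parallel transport of the radical -/

/-- A vector of the radical is transported parallelly along a curve with velocity `ξ`. It stays in
`V` and in the radical, so its projection is identically zero, and differentiating this at `0` gives
the claim. -/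
lemma blk2_mulVec_radical (hV : 𝒢.IsSubbundle r V) (hU : IsOpen U) (hi : 𝒢.InjectiveOver U V)
    (hpres : 𝒢.PreservedOver U V) (hη : 𝒢.IsStrongWeyl U V η) {u : Q} (hu : u ∈ 𝒢.proj ⁻¹' U)
    {ξ : TangentSpace 𝓘(ℝ, EQ) u} (hξ : 𝒢.TangentToReduction η u ξ) {t₀ : Std n}
    (ht₀ : t₀ ∈ radical (V u)) : blk2 (𝒢.cform u ξ : Mat n) *ᵥ piH n t₀ = 0 := by
  obtain ⟨W, hWU, hxW, s, hs⟩ := exists_isFrame hV hU hi hu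
  obtain ⟨c, hc0, hv, T', hT', h0', hc'⟩ := exists_curve u ξ
  subst hc0
  obtain rfl : ξ = velocity c 0 := hv.symm
  obtain ⟨hE, hξ⟩ := hξ
  obtain ⟨T, hT, h0, hc, hTW⟩ : ∃ T : Set ℝ, IsOpen T ∧ 0 ∈ T ∧
      ContMDiffOn 𝓘(ℝ, ℝ) 𝓘(ℝ, EQ) ∞ c T ∧ Set.MapsTo c T (𝒢.proj ⁻¹' W) :=
    ⟨_, hc'.continuousOn.isOpen_inter_preimage hT' (𝒢.isOpen_preimage hs.isOpen), ⟨h0', hxW⟩,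
      hc'.mono Set.inter_subset_left, fun t ht => ht.2⟩
  have hTn : T ∈ 𝓝 (0 : ℝ) := hT.mem_nhds h0
  have hcd : ∀ τ ∈ T, MDifferentiableAt 𝓘(ℝ, ℝ) 𝓘(ℝ, EQ) c τ := fun τ hτ =>
    (hc.contMDiffAt (hT.mem_nhds hτ)).mdifferentiableAt (by norm_num)
  let a : ℝ → Mat n := fun τ => (𝒢.cform (c τ) (velocity c τ) : Mat n)
  have hag : ∀ τ, a τ ∈ gAlg n := fun τ => (𝒢.cform (c τ) (velocity c τ)).2
  let D : Fin r → ℝ → Std n := fun k τ => 𝒢.tractorDeriv (s k) (c τ) (velocity c τ)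
  have hds : ∀ k, ∀ τ ∈ T, HasDerivAt (fun τ => s k (c τ)) (D k τ - a τ *ᵥ s k (c τ)) τ := by
    intro k τ hτ
    have := hasDerivAt_comp_curve (hcd τ hτ)
      ((hs.isSection k).mdifferentiableAt hs.isOpen (hTW hτ))
    simpa [D, a, tractorDeriv] using this
  -- The connection matrix of the frame along the curve; it exists because the tractor derivatives
  -- of the frame lie in `V`.
  let Γ : ℝ → Matrix (Fin r) (Fin r) ℝ := fun τ =>
    Matrix.of fun k l => (IsFrame.coeff s (c τ) *ᵥ piH n (D k τ)) l
  have hD : ∀ k, ∀ τ ∈ T, D k τ = ∑ l, Γ τ k l • s l (c τ) := fun k τ hτ =>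
    hs.eq_sum_coeff (hTW hτ)
      (hpres W hs.isOpen hWU (s k) (hs.isSection k) (hs.mem k) _ (hTW hτ) (velocity c τ))
  have hacont : ∀ i j, ContinuousOn (fun τ => a τ i j) T := fun i j =>
    (𝒢.contMDiff_cform i j).continuous.comp_continuousOn (continuousOn_velocity hT hc)
  have hscont : ∀ k, ContDiffOn ℝ ∞ (fun τ => s k (c τ)) T := fun k =>
    contMDiffOn_iff_contDiffOn.1 ((hs.isSection k).1.comp hc hTW)
  have hDcont : ∀ k i, ContinuousOn (fun τ => D k τ i) T := fun k i => by
    have h1 : ∀ τ ∈ T, D k τ i =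
        deriv (fun τ => s k (c τ)) τ i + ∑ j, a τ i j * s k (c τ) j := fun τ hτ => by
      rw [(hds k τ hτ).deriv]
      simp [Matrix.mulVec, dotProduct]
    refine ContinuousOn.congr (.add ?_ ?_) h1
    · exact continuousOn_pi.1 ((hscont k).continuousOn_deriv_of_isOpen hT (by norm_num)) i
    · exact continuousOn_finsetSum _ fun j _ =>
        (hacont i j).mul (continuousOn_pi.1 (hscont k).continuousOn j)
  have hΓ : ∀ k l, ContinuousOn (fun τ => Γ τ k l) T := fun k l => by
    change ContinuousOn (fun τ => ∑ i, IsFrame.coeff s (c τ) l i * D k τ (iH i)) T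
    exact continuousOn_finsetSum _ fun i _ => ((hs.smooth_coeff l i).continuousOn.comp hc.continuousOn hTW).mul (hDcont k (iH i))
  obtain ⟨x₀, hx₀⟩ := hs.exists_eq (c 0) hxW t₀ ht₀.1
  -- The equation `x' = -Γᵀ x` for the coefficients says that the vector `f` below has tractor
  -- derivative zero.
  obtain ⟨x, hx0, hx⟩ := exists_linear_solution hTn
    (continuousOn_matCLM (B := fun τ => -(Γ τ)ᵀ) fun i j => (hΓ j i).neg) x₀
  let f : ℝ → Std n := fun τ => ∑ k, x τ k • s k (c τ)
  have hf0 : f 0 = t₀ := by rw [hx₀, ← hx0]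
  have hf : ∀ᶠ τ in 𝓝 0, HasDerivAt f (-(a τ *ᵥ f τ)) τ := by
    filter_upwards [hx, hTn] with τ hxτ hτ
    have h1 := HasDerivAt.fun_sum fun k (_ : k ∈ Finset.univ) =>
      (hasDerivAt_pi.1 hxτ k).smul (hds k τ hτ)
    convert! h1 using 1
    have h2 : ∑ k, x τ k • D k τ = ∑ l, (∑ k, Γ τ k l * x τ k) • s l (c τ) := by
      simp only [Finset.sum_smul]
      rw [Finset.sum_comm]
      refine Finset.sum_congr rfl fun k _ => ?_
      rw [hD k τ hτ, Finset.smul_sum]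
      exact Finset.sum_congr rfl fun l _ => by rw [smul_smul, mul_comm]
    have h3 : ∀ l, matCLM r (-(Γ τ)ᵀ) (x τ) l = -∑ k, Γ τ k l * x τ k := fun l => by
      rw [matCLM_apply, Matrix.neg_mulVec]
      rfl
    simp only [h3, smul_sub, neg_smul, Finset.sum_add_distrib, Finset.sum_sub_distrib, h2,
      Finset.sum_neg_distrib]
    simp only [f, Matrix.mulVec_sum, Matrix.mulVec_smul]
    abel
  -- The pairings of `f` with the frame satisfy `y' = Γ y`, as the metric is parallel. They vanish
  -- at `0`, hence nearby, and so `f` stays in the radical.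
  let y : ℝ → Fin r → ℝ := fun τ m => metricH (f τ) (s m (c τ))
  have hy : ∀ᶠ τ in 𝓝 0, HasDerivAt y (matCLM r (Γ τ) (y τ)) τ := by
    filter_upwards [hf, hTn] with τ hfτ hτ
    rw [hasDerivAt_pi]
    intro m
    convert! hasDerivAt_metricH hfτ (hds m τ hτ) using 1
    have h1 := metricH_mulVec_left (hag τ) (f τ) (s m (c τ))
    have h2 : metricH (f τ) (D m τ) = ∑ l, Γ τ m l * metricH (f τ) (s l (c τ)) := by
      rw [hD m τ hτ]
      simp only [← metricB_apply, map_sum, map_smul, smul_eq_mul]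
    rw [matCLM_apply]
    simp only [← metricB_apply, map_neg, map_sub, LinearMap.neg_apply] at h1 h2 ⊢
    rw [h1, h2]
    simp [Matrix.mulVec, dotProduct, y]
  have hy0 : ∀ᶠ τ in 𝓝 0, y τ = 0 := by
    refine linear_solution_eq_zero hTn (continuousOn_matCLM hΓ) ?_ hy
    funext m
    change metricH (f 0) (s m (c 0)) = 0
    rw [hf0]
    exact ht₀.2 _ (hs.mem m _ hxW)
  have hzero : (fun τ => projP (η (c τ)) *ᵥ f τ) =ᶠ[𝓝 0] fun _ => 0 := by
    filter_upwards [hy0, hTn] with τ hyτ hτ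
    refine (hη.2 _ (hWU (hTW hτ))).2 _ ⟨hs.sum_mem (hTW hτ) (x τ), fun t ht => ?_⟩
    obtain ⟨z, rfl⟩ := hs.exists_eq _ (hTW hτ) t ht
    rw [← metricB_apply, map_sum]
    refine Finset.sum_eq_zero fun k _ => ?_
    rw [map_smul, metricB_apply, show metricH (f τ) (s k (c τ)) = 0 from congrFun hyτ k, smul_zero]
  have hηd : ∀ i j, HasDerivAt (fun τ => η (c τ) i j) 0 0 := fun i j => by
    have h := hasDerivAt_comp_curve (hcd 0 h0) (hη.1.1.mdifferentiableAt hU hu i j)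
    rwa [hξ i j] at h
  -- The derivative of the zero function is `-projP (a t₀)`. As `t₀` has zero `H*` and middle
  -- components, only the block `blk2` acts on it in the `H*` component.
  have h1 := (hasDerivAt_projP_mulVec hηd hf.self_of_nhds).unique
    ((hasDerivAt_const (0 : ℝ) (0 : Std n)).congr_of_eventuallyEq hzero)
  have hst := hη.2 _ hu
  rw [hE] at h1 hst
  rw [hf0, Matrix.mulVec_neg, neg_eq_zero, projP_eq_zero_iff_of_lift (gradEl_lift n),
    piV_projP_gradEl, piV_mulVec (hag 0), hst.1.iR_eq_zero ht₀.1] at h1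
  have h2 : piV t₀ = 0 := by
    rw [← piV_projP_gradEl, hst.2 t₀ ht₀]; rfl
  rw [h2, Matrix.mulVec_zero, neg_zero, zero_smul, zero_add, zero_sub, neg_eq_zero] at h1
  exact h1

/-! ### The consequences of a parallel subbundle -/

/-- A preferred Weyl structure over `U`, where the tractor connection preserves `V`. -/
structure IsParallel (𝒢 : CartanGeometry n EM M EQ Q) (r : ℕ) (U : Set M)
    (V : Q → Submodule ℝ (Std n)) (η : Q → Mat n) : Prop where
  isSubbundle : 𝒢.IsSubbundle r V
  isOpen : IsOpen U
  injective : 𝒢.InjectiveOver U V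
  preserved : 𝒢.PreservedOver U V
  pref : 𝒢.IsWeyl U η ∧ ∀ u ∈ 𝒢.proj ⁻¹' U, IsPrefAt (V u) (η u)

namespace IsParallel

variable {u : Q} {ξ : TangentSpace 𝓘(ℝ, EQ) u} {t s : Q → Std n}
  {m : Matrix (Fin n) (Fin n) ℝ}

lemma isPrefAt (h : 𝒢.IsParallel r U V η) (hu : u ∈ 𝒢.proj ⁻¹' U) (hE : η u = gradEl n) :
    IsPrefAt (V u) (gradEl n) := by
  have := h.pref.2 u hu
  rwa [hE] at this

lemma tractorDeriv_mem (h : 𝒢.IsParallel r U V η) (hW : IsOpen W) (hWU : W ⊆ U)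
    (ht : 𝒢.IsSectionIn W V t) (hu : u ∈ 𝒢.proj ⁻¹' W) : 𝒢.tractorDeriv t u ξ ∈ V u :=
  h.preserved W hW hWU t ht.1 ht.2 u hu ξ

lemma muMap_piH_gradEl (h : 𝒢.IsParallel r U V η) (hu : u ∈ 𝒢.proj ⁻¹' U) (hE : η u = gradEl n)
    {t₀ : Std n} (ht₀ : t₀ ∈ V u) : muMap V η u (piH n t₀) = piV t₀ := by
  rw [muMap_piH (h.injective u hu) ht₀, hE, piV_projP_gradEl]

lemma symmExtension_mulVec (h : 𝒢.IsParallel r U V η) (hu : u ∈ 𝒢.proj ⁻¹' U)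
    (hE : η u = gradEl n) (hm : IsSymmExtension V η u m) {t₀ : Std n} (ht₀ : t₀ ∈ V u) :
    m *ᵥ piH n t₀ = piV t₀ := by
  rw [hm.2 _ ⟨t₀, ht₀, rfl⟩, h.muMap_piH_gradEl hu hE ht₀]

/-- The component `P_1` of the rho-tensor, up to `A^⊥`. -/
lemma rho1_add_mem (h : 𝒢.IsParallel r U V η) (hu : u ∈ 𝒢.proj ⁻¹' U)
    (hξ : 𝒢.TangentToReduction η u ξ) {t₀ : Std n} (ht₀ : t₀ ∈ V u) :
    𝒢.rho1 u ξ ⬝ᵥ piH n t₀ = -(𝒢.zM1 u ξ ⬝ᵥ piV t₀) := by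
  obtain ⟨W, hWU, hW, huW, hsec⟩ := exists_isSectionIn h.isSubbundle h.isOpen h.injective hu
  obtain ⟨t, ht, rfl⟩ := hsec t₀ ht₀
  have h1 := (connection_relations h.preserved h.pref hW hWU ht ht huW hξ).2
  rw [iR_mulVec (𝒢.cform u ξ).2] at h1
  simp only [rho1, zM1]
  linarith

/-- The component `P_2` of the rho-tensor on `A ⊗ A`. -/
lemma rho2_dotProduct (h : 𝒢.IsParallel r U V η) (hu : u ∈ 𝒢.proj ⁻¹' U)
    (hξ : 𝒢.TangentToReduction η u ξ) {t₀ s₀ : Std n} (ht₀ : t₀ ∈ V u) (hs₀ : s₀ ∈ V u) :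
    (𝒢.rho2 u ξ *ᵥ piH n t₀) ⬝ᵥ piH n s₀ = piV t₀ ⬝ᵥ (𝒢.zM2 u ξ *ᵥ piV s₀) := by
  obtain ⟨W, hWU, hW, huW, hsec⟩ := exists_isSectionIn h.isSubbundle h.isOpen h.injective hu
  obtain ⟨t, ht, rfl⟩ := hsec t₀ ht₀
  obtain ⟨s, hs, rfl⟩ := hsec s₀ hs₀
  exact block_relation (h.isPrefAt hu hξ.1) (𝒢.cform u ξ).2 ht₀ hs₀
    (connection_relations h.preserved h.pref hW hWU ht hs huW hξ).1

/-- This is the `H` component of the tractor connection: the term with `Z_{-1}` drops out because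
the middle component is zero on `V`. -/
lemma covDeriv_eq (h : 𝒢.IsParallel r U V η) (hW : IsOpen W) (hWU : W ⊆ U)
    (ht : 𝒢.IsSectionIn W V t) (hu : u ∈ 𝒢.proj ⁻¹' W) (hξ : 𝒢.TangentToReduction η u ξ)
    {X : Q → Fin n → ℝ} (hX : 𝒢.IsASection W V X) (htX : ∀ u ∈ 𝒢.proj ⁻¹' W, piH n (t u) = X u) :
    𝒢.covDeriv X u ξ = piH n (𝒢.tractorDeriv t u ξ) - 𝒢.zM2 u ξ *ᵥ piV (t u) := by
  have hd : dirDeriv X u ξ = piH n (dirDeriv t u ξ) := by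
    obtain ⟨c, hc0, hv, T, hT, h0, hc⟩ := exists_curve u ξ
    subst hc0
    obtain rfl : ξ = velocity c 0 := hv.symm
    have hcd : MDifferentiableAt 𝓘(ℝ, ℝ) 𝓘(ℝ, EQ) c 0 :=
      (hc.contMDiffAt (hT.mem_nhds h0)).mdifferentiableAt (by norm_num)
    have hn := (𝒢.isOpen_preimage hW).mem_nhds hu
    have h1 := hasDerivAt_comp_curve hcd
      ((hX.1.1.contMDiffAt hn).mdifferentiableAt (by norm_num))
    have h2 := hasDerivAt_comp_curve hcd (ht.1.mdifferentiableAt hW hu)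
    have h3 : HasDerivAt (fun τ => piH n (t (c τ)))
        (piH n (dirDeriv (EQ := EQ) t (c 0) (velocity c 0))) 0 :=
      hasDerivAt_pi.2 fun i => hasDerivAt_pi.1 h2 (iH i)
    refine h1.unique (h3.congr_of_eventuallyEq ?_)
    exact (hcd.continuousAt.eventually hn).mono fun τ hτ => (htX _ hτ).symm
  rw [covDeriv, hd, tractorDeriv, map_add, piH_mulVec, htX u hu,
    (h.isPrefAt (hWU hu) hξ.1).iR_eq_zero (ht.2 u hu), zM2,
    zero_smul, add_zero]
  abel

/-- The tractor derivative projects into `A`, so `Z_{-2} μ(X)` must lie in `A`. The part of `Z_{-2}`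
in `A ∧ A` maps all of `H*` to `A`, and the part in `μ(A)^⊥ ∧ μ(A)^⊥` kills `μ(X)`. -/
lemma preservesAAlongC (h : 𝒢.IsParallel r U V η) : 𝒢.PreservesAAlongC U V η := by
  intro W hW hWU X hX u hu ξ hξ hC
  have ht := hX.isSectionIn_liftA h.isSubbundle h.isOpen h.injective hW hWU
  rw [h.covDeriv_eq hW hWU ht hu hξ hX fun u hu => (liftA_mem (hX.2 u hu)).2]
  refine (subA V u).sub_mem ⟨_, h.tractorDeriv_mem hW hWU ht hu, rfl⟩ ?_
  rw [bundleC, bundleB, hξ.1, gradEl_eq] at hC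
  obtain ⟨y, hy, z, hz, hyz⟩ := Submodule.mem_sup.1 (blkM2_sup hC)
  rw [zM2, ← hyz, Matrix.add_mulVec]
  have hmu : piV (liftA V u (X u)) ∈ muA V η u :=
    ⟨X u, hX.2 u hu, by
      rw [← h.muMap_piH_gradEl (hWU hu) hξ.1 (ht.2 u hu), (liftA_mem (hX.2 u hu)).2]⟩
  rw [mulVec_eq_zero_of_mem_wedgeSpan hz hmu, add_zero]
  exact mulVec_mem_of_mem_wedgeSpan hy _

lemma symm_dotProduct (hm : m.IsSymm) (x y : Fin n → ℝ) : (m *ᵥ x) ⬝ᵥ y = x ⬝ᵥ (m *ᵥ y) := by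
  rw [dotProduct_mulVec_transpose, hm.eq]

lemma dirDeriv_metricH (hW : IsOpen W) (ht : 𝒢.IsTractorSection W t)
    (hs : 𝒢.IsTractorSection W s) (hu : u ∈ 𝒢.proj ⁻¹' W) :
    dirDeriv (fun u' => metricH (t u') (s u')) u ξ =
      metricH (𝒢.tractorDeriv t u ξ) (s u) + metricH (t u) (𝒢.tractorDeriv s u ξ) := by
  have hg : MDifferentiableAt 𝓘(ℝ, EQ) 𝓘(ℝ, ℝ) (fun u' => metricH (t u') (s u')) u := by
    have h1 : ContMDiffOn 𝓘(ℝ, EQ) 𝓘(ℝ, ℝ) ∞ (fun u' => metricH (t u') (s u')) (𝒢.proj ⁻¹' W) := by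
      simp only [metricH, dotProduct, gramJ_mulVec]
      exact contMDiffOn_const.mul
        (contMDiffOn_finsetSum fun a _ => (ht.apply a).mul (hs.apply (dualIdx a)))
    exact (h1.contMDiffAt ((𝒢.isOpen_preimage hW).mem_nhds hu)).mdifferentiableAt (by norm_num)
  obtain ⟨c, hc0, hv, T, hT, h0, hc⟩ := exists_curve u ξ
  subst hc0
  obtain rfl : ξ = velocity c 0 := hv.symm
  have hcd : MDifferentiableAt 𝓘(ℝ, ℝ) 𝓘(ℝ, EQ) c 0 :=
    (hc.contMDiffAt (hT.mem_nhds h0)).mdifferentiableAt (by norm_num)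
  rw [(hasDerivAt_comp_curve hcd hg).unique
    (hasDerivAt_metricH (hasDerivAt_comp_curve hcd (ht.mdifferentiableAt hW hu))
      (hasDerivAt_comp_curve hcd (hs.mdifferentiableAt hW hu)))]
  have h1 := metricH_mulVec_left (𝒢.cform (c 0) (velocity c 0)).2 (t (c 0)) (s (c 0))
  simp only [tractorDeriv, ← metricB_apply, map_add, LinearMap.add_apply] at h1 ⊢
  linarith

/-- On `A` the form `μ` is the metric of the lifts, which is parallel for the tractor connection. -/
lemma nablaMuZero (h : 𝒢.IsParallel r U V η) : 𝒢.NablaMuZero U V η := by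
  intro W hW hWU X Y hX hY u hu ξ hξ m hm
  have ht := hX.isSectionIn_liftA h.isSubbundle h.isOpen h.injective hW hWU
  have hs := hY.isSectionIn_liftA h.isSubbundle h.isOpen h.injective hW hWU
  have htX := fun u hu => (liftA_mem (hX.2 u hu)).2
  have hsY := fun u hu => (liftA_mem (hY.2 u hu)).2
  rw [h.covDeriv_eq hW hWU ht hu hξ hX htX, h.covDeriv_eq hW hWU hs hu hξ hY hsY]
  have ht' := h.tractorDeriv_mem (ξ := ξ) hW hWU ht hu
  have hs' := h.tractorDeriv_mem (ξ := ξ) hW hWU hs hu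
  have hgsymm : ∀ t₀ ∈ V u, ∀ s₀ ∈ V u, metricH t₀ s₀ = (m *ᵥ piH n t₀) ⬝ᵥ piH n s₀ := by
    intro t₀ ht₀ s₀ hs₀
    rw [← h.isPrefAt (hWU hu) hξ.1 t₀ ht₀ s₀ hs₀, metricH_projP_gradEl,
      h.symmExtension_mulVec (hWU hu) hξ.1 hm ht₀]
    ring
  have hd : dirDeriv (fun u' => muMap V η u' (X u') ⬝ᵥ Y u') u ξ =
      metricH (𝒢.tractorDeriv (fun u => liftA V u (X u)) u ξ) (liftA V u (Y u)) +
        metricH (liftA V u (X u)) (𝒢.tractorDeriv (fun u => liftA V u (Y u)) u ξ) := by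
    rw [← dirDeriv_metricH hW ht.1 hs.1 hu]
    refine congrArg (fun L : TangentSpace 𝓘(ℝ, EQ) u →L[ℝ] ℝ => L ξ)
      (Filter.EventuallyEq.mfderiv_eq ?_)
    filter_upwards [(𝒢.isOpen_preimage hW).mem_nhds hu] with u' hu'
    exact (muMap_eq_metricG_iff (h.injective u' (hWU hu')) (h.pref.1.2 u' (hWU hu'))).2
      (h.pref.2 u' (hWU hu')) _ (hX.2 u' hu') _ (hY.2 u' hu')
  rw [hd, hgsymm _ ht' _ (hs.2 u hu), hgsymm _ (ht.2 u hu) _ hs', htX u hu, hsY u hu]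
  have h1 : m *ᵥ X u = piV (liftA V u (X u)) := by
    rw [← h.symmExtension_mulVec (hWU hu) hξ.1 hm (ht.2 u hu), htX u hu]
  have h2 : m *ᵥ Y u = piV (liftA V u (Y u)) := by
    rw [← h.symmExtension_mulVec (hWU hu) hξ.1 hm (hs.2 u hu), hsY u hu]
  -- Passing from tractor derivatives to `∇` adds `-(Z_{-2} mX) · mY - mX · (Z_{-2} mY)`, which is
  -- zero because `Z_{-2}` is skew.
  rw [← h1, ← h2, Matrix.mulVec_sub, sub_dotProduct, dotProduct_sub, symm_dotProduct hm.1 (_ *ᵥ _),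
    dotProduct_mulVec_transpose (𝒢.zM2 u ξ) (m *ᵥ X u), zM2, blkM2_transpose (𝒢.cform u ξ).2,
    Matrix.neg_mulVec, neg_dotProduct]
  ring

lemma rho1_mem (h : 𝒢.IsParallel r U V η) (hu : u ∈ 𝒢.proj ⁻¹' U)
    (hξ : 𝒢.TangentToReduction η u ξ) (hm : IsSymmExtension V η u m) :
    𝒢.rho1 u ξ + m *ᵥ 𝒢.zM1 u ξ ∈ perpA V u := by
  rintro _ ⟨t₀, ht₀, rfl⟩
  rw [add_dotProduct, h.rho1_add_mem hu hξ ht₀, symm_dotProduct hm.1,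
    h.symmExtension_mulVec hu hξ.1 hm ht₀]
  ring

lemma ofBlk2_eq (w : Matrix (Fin n) (Fin n) ℝ) : ofBlk2 w = nilM 0 (-w) := by
  ext x y
  rcases x with i | _ | i <;> rcases y with j | _ | j <;> simp [ofBlk2, nilM]

/-- The component `P_2` of the rho-tensor, up to the brackets of `A^⊥` with `K^⊥`. -/
lemma rho2_mem (h : 𝒢.IsParallel r U V η) (hu : u ∈ 𝒢.proj ⁻¹' U)
    (hξ : 𝒢.TangentToReduction η u ξ) (hm : IsSymmExtension V η u m) {K : Set (Fin n → ℝ)}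
    (hK : K ⊆ subA V u)
    (hK' : ∀ x ∈ K, 𝒢.rho2 u ξ *ᵥ x = 0 ∧ m *ᵥ x = 0) :
    ofBlk2 (𝒢.rho2 u ξ + m * 𝒢.zM2 u ξ * m) ∈
      brk (inP1 (η u) (perpA V u)) (inP1 (η u) (perp K)) := by
  have hZ : (𝒢.zM2 u ξ)ᵀ = -𝒢.zM2 u ξ := blkM2_transpose (𝒢.cform u ξ).2
  have hS : (𝒢.rho2 u ξ)ᵀ = -𝒢.rho2 u ξ := blk2_transpose (𝒢.cform u ξ).2
  rw [ofBlk2_eq, brk_comm, hξ.1, gradEl_eq]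
  refine (nilM_mem_brk_iff 0 0 hK ?_).2 ⟨?_, fun x hx => ?_⟩
  · rw [Matrix.transpose_neg, Matrix.transpose_add, Matrix.transpose_mul, Matrix.transpose_mul, hZ,
      hS, hm.1.eq]
    simp only [Matrix.mul_neg, Matrix.neg_mul, Matrix.mul_assoc]
    abel
  · rintro _ ⟨t₀, ht₀, rfl⟩ _ ⟨s₀, hs₀, rfl⟩
    rw [Matrix.neg_mulVec, Matrix.add_mulVec, neg_dotProduct, add_dotProduct,
      h.rho2_dotProduct hu hξ ht₀ hs₀, ← Matrix.mulVec_mulVec, ← Matrix.mulVec_mulVec,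
      symm_dotProduct hm.1, h.symmExtension_mulVec hu hξ.1 hm ht₀,
      h.symmExtension_mulVec hu hξ.1 hm hs₀, dotProduct_mulVec_transpose, hZ, Matrix.neg_mulVec,
      neg_dotProduct]
    ring
  · rw [Matrix.neg_mulVec, Matrix.add_mulVec, ← Matrix.mulVec_mulVec, (hK' x hx).1, (hK' x hx).2]
    simp

lemma exists_symmExtension (h : 𝒢.IsParallel r U V η) (hu : u ∈ 𝒢.proj ⁻¹' U) :
    ∃ m, IsSymmExtension V η u m :=
  exists_isSymmExtension (h.injective u hu) (h.pref.1.2 u hu) (h.pref.2 u hu)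

lemma rho22Form (h : 𝒢.IsParallel r U V η) : 𝒢.Rho22Form U V η fun _ => ⊤ := by
  intro u hu ξ hξ _ m hm
  have := h.rho2_mem hu hξ hm (Set.empty_subset _) (by simp)
  rwa [perp_empty] at this

/-- The relation for `P_2` holds for every `ξ` tangent to the reduction; when `Z_{-2} = 0` its `μ`
term is zero, whichever extension of `μ` is used. -/
lemma rho12_of_rho22 (h : 𝒢.IsParallel r U V η) {S : Submodule ℝ (Fin n → ℝ)}
    (hu : u ∈ 𝒢.proj ⁻¹' U) (hz : 𝒢.zM2 u ξ = 0)
    (hS : ∀ m, IsSymmExtension V η u m → ofBlk2 (𝒢.rho2 u ξ + m * 𝒢.zM2 u ξ * m) ∈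
      brk (inP1 (η u) (perpA V u)) (inP1 (η u) S)) :
    ofBlk2 (𝒢.rho2 u ξ) ∈ brk (inP1 (η u) (perpA V u)) (inP1 (η u) S) := by
  obtain ⟨m, hm⟩ := h.exists_symmExtension hu
  have := hS m hm
  rwa [hz, Matrix.mul_zero, Matrix.zero_mul, add_zero] at this

lemma rho12Form (h : 𝒢.IsParallel r U V η) : 𝒢.Rho12Form U V η fun _ => ⊤ := by
  intro u hu ξ hξ hz
  refine h.rho12_of_rho22 hu hz fun m hm => ?_
  have := h.rho2_mem hu hξ hm (Set.empty_subset _) (by simp)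
  rwa [perp_empty] at this

lemma rho11Form (h : 𝒢.IsParallel r U V η) : 𝒢.Rho11Form U V η :=
  fun _ hu _ hξ _ _ hm => h.rho1_mem hu hξ hm

lemma rho21Form (h : 𝒢.IsParallel r U V η) : 𝒢.Rho21Form U V η := by
  intro u hu ξ hξ hz
  obtain ⟨m, hm⟩ := h.exists_symmExtension hu
  have := h.rho1_mem hu hξ hm
  rwa [hz, Matrix.mulVec_zero, add_zero] at this

/-- On `iso(A)` the term `P_2` vanishes by parallel transport of the radical, and `μ` vanishes
because the structure is strongly preferred. -/
lemma rho2_mem_isoA (h : 𝒢.IsParallel r U V η) (hη : 𝒢.IsStrongWeyl U V η)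
    (hu : u ∈ 𝒢.proj ⁻¹' U) (hξ : 𝒢.TangentToReduction η u ξ) (hm : IsSymmExtension V η u m) :
    ofBlk2 (𝒢.rho2 u ξ + m * 𝒢.zM2 u ξ * m) ∈
      brk (inP1 (η u) (perpA V u)) (inP1 (η u) (perp (isoA V u))) := by
  refine h.rho2_mem hu hξ hm (fun x hx => hx.1) ?_
  rw [mem_isoA_iff (h.injective u hu)]
  rintro _ ⟨t₀, ht₀, rfl⟩
  refine ⟨blk2_mulVec_radical h.isSubbundle h.isOpen h.injective h.preserved hη hu hξ ht₀, ?_⟩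
  have h1 := (hη.2 u hu).2 t₀ ht₀
  rw [hξ.1] at h1
  rw [h.symmExtension_mulVec hu hξ.1 hm ht₀.1, ← piV_projP_gradEl, h1]
  rfl

end IsParallel

end CartanGeometry

end FreeDist

end

/-! ### The theorem -/

theorem mainTheorem6 (n r : ℕ) (hr : r ≤ n)
    {EM : Type*} [NormedAddCommGroup EM] [NormedSpace ℝ EM] [FiniteDimensional ℝ EM]
    {M : Type*} [TopologicalSpace M] [T2Space M] [SecondCountableTopology M]
    [ChartedSpace EM M] [IsManifold 𝓘(ℝ, EM) ∞ M]
    {EQ : Type*} [NormedAddCommGroup EQ] [NormedSpace ℝ EQ] [FiniteDimensional ℝ EQ]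
    {Q : Type*} [TopologicalSpace Q] [ChartedSpace EQ Q] [IsManifold 𝓘(ℝ, EQ) ∞ Q]
    (𝒢 : FreeDist.CartanGeometry n EM M EQ Q)
    (V : Q → Submodule ℝ (FreeDist.Std n)) (hV : 𝒢.IsSubbundle r V) (hgen : 𝒢.IsGeneric V) :
    ∀ U : Set M, IsOpen U → 𝒢.InjectiveOver U V →
      -- existence
      (∃ η, 𝒢.IsPreferred U V η) ∧
      (∃ η, 𝒢.IsStronglyPreferred U V η) ∧
      -- affine structures
      (∀ η, 𝒢.IsPreferred U V η → ∀ η' : Q → FreeDist.Mat n,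
        𝒢.IsPreferred U V η' ↔
          𝒢.IsSectionOf U (FreeDist.modelPref V η) (fun u => η' u - η u)) ∧
      (∀ η, 𝒢.IsStronglyPreferred U V η → ∀ η' : Q → FreeDist.Mat n,
        𝒢.IsStronglyPreferred U V η' ↔
          𝒢.IsSectionOf U (FreeDist.modelStrong V η) (fun u => η' u - η u)) ∧
      -- `B` is independent of the choice
      (∀ η η', 𝒢.IsPreferred U V η → 𝒢.IsPreferred U V η' →
        ∀ u ∈ 𝒢.proj ⁻¹' U, FreeDist.bundleB V η u = FreeDist.bundleB V η' u) ∧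
      -- `μ` extends to a symmetric form on `H`
      (∀ η, 𝒢.IsPreferred U V η →
        ∀ u ∈ 𝒢.proj ⁻¹' U, ∃ m, FreeDist.IsSymmExtension V η u m) ∧
      -- the case where the tractor connection preserves `V`
      (𝒢.PreservedOver U V → ∀ η, 𝒢.IsPreferred U V η →
        𝒢.PreservesAAlongC U V η ∧
        𝒢.NablaMuZero U V η ∧
        𝒢.Rho11Form U V η ∧
        𝒢.Rho22Form U V η (fun _ => ⊤) ∧
        𝒢.Rho21Form U V η ∧
        𝒢.Rho12Form U V η (fun _ => ⊤) ∧
        (𝒢.IsStronglyPreferred U V η →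
          𝒢.Rho22Form U V η (fun u => FreeDist.perp (FreeDist.isoA V u)) ∧
          𝒢.Rho12Form U V η (fun u => FreeDist.perp (FreeDist.isoA V u)))) := by
  intro U hU hi
  obtain ⟨η₀, hη₀⟩ := FreeDist.CartanGeometry.exists_isStrongWeyl hV hU hi
  have hη₀ := (FreeDist.CartanGeometry.isStronglyPreferred_iff hi).2 hη₀
  refine ⟨⟨η₀, hη₀.1⟩, ⟨η₀, hη₀⟩,
    fun η h η' => FreeDist.CartanGeometry.isPreferred_iff_isSectionOf hi h,
    fun η h η' => FreeDist.CartanGeometry.isStronglyPreferred_iff_isSectionOf hi h,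
    fun η η' h h' u hu => ?_, fun η h u hu => ?_, fun hpres η h => ?_⟩
  · rw [FreeDist.CartanGeometry.isPreferred_iff hi] at h h'
    exact FreeDist.bundleB_eq (h.1.2 u hu) (h.2 u hu) (h'.1.2 u hu) (h'.2 u hu)
  · rw [FreeDist.CartanGeometry.isPreferred_iff hi] at h
    exact FreeDist.exists_isSymmExtension (hi u hu) (h.1.2 u hu) (h.2 u hu)
  · have hp : 𝒢.IsParallel r U V η :=
      ⟨hV, hU, hi, hpres, (FreeDist.CartanGeometry.isPreferred_iff hi).1 h⟩
    refine ⟨hp.preservesAAlongC, hp.nablaMuZero, hp.rho11Form, hp.rho22Form, hp.rho21Form,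
      hp.rho12Form, fun hs => ?_⟩
    have hs := (FreeDist.CartanGeometry.isStronglyPreferred_iff hi).1 hs
    exact ⟨fun u hu ξ hξ _ m hm => hp.rho2_mem_isoA hs hu hξ hm,
      fun u hu ξ hξ hz => hp.rho12_of_rho22 hu hz fun m hm => hp.rho2_mem_isoA hs hu hξ hm⟩
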